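/- **Setting.** Let $\mathcal X,\mathcal S,\mathcal A$ be measurable spaces and let $\phi:\mathcal S\times\mathcal A\to\mathbb R^{d_1}$, $\psi_0:\mathcal X\to\mathbb R$, $\psi:\mathcal X\to\mathbb R^{d_2}$ be known measurable feature maps. Put $r_\theta(s,a)=\theta^\top\phi(s,a)$, $\sigma_\gamma(x)=\psi_0(x)+\gamma^\top\psi(x)$, $\mu(v)=1/(1+e^{-v})$. An observation $(x,s,a^{(0)},a^{(1)},y)$, $y\in\{0,1\}$, has law $D$ with $\mathbb P(y=1\mid x,s,a^{(0)},a^{(1)})=\mu\big(\sigma_{\gamma_*}(x)[r_{\theta_*}(s,a^{(1)})-r_{\theta_*}(s,a^{(0)})]\big)$ for true parameters $\theta_*,\gamma_*$; write $z=\phi(s,a^{(1)})-\phi(s,a^{(0)})$. Given $n$ i.i.d. observations from $D$, let $$L_n(\theta,\gamma)=-\tfrac1n\sum_{i=1}^n\big\{y_i\log\mu(\sigma_\gamma(x_i)\theta^\top z_i)+(1-y_i)\log[1-\mu(\sigma_\gamma(x_i)\theta^\top z_i)]\big\},$$ and let $(\theta_T,\gamma_T)$ be the $T$-th iterate of alternating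 gradient descent $\theta_t=\theta_{t-1}-\eta_1\nabla_\theta L_n(\theta_{t-1},\gamma_{t-1})$, $\gamma_t=\gamma_{t-1}-\eta_2\nabla_\gamma L_n(\theta_t,\gamma_{t-1})$ started at $(\theta_0,\gamma_0)$. **Assumptions.** With positive constants $\phi_{\max},\theta_{\max},\psi_{\max},\gamma_{\max}$: (1) $\|\phi(s,a)\|_2\le\phi_{\max}$ for all $s,a$, and $\|\theta_*\|_\infty\le\theta_{\max}$. (2) $\psi_0\not\equiv0$, $\sup_x\|(\psi_0(x),\psi(x))\|_2\le\psi_{\max}$, $\|(1,\gamma_*)\|_\infty\le\gamma_{\max}$. (3) $\mathbb E[\sigma_{\gamma_*}^2(x)zz^\top]$ and $\mathbb E[(\theta_*^\top z)^2\psi(x)\psi(x)^\top]$ have smallest eigenvalues $\lambda_\phi>0$ and $\lambda_\psi>0$. (4) $M=\big\|\mathbb E\{\mu(v)[1-\mu(v)]\,v\,\psi(x)z^\top\}\big\|_2$ with $v=\sigma_{\gamma_*}(x)\theta_*^\top z$ satisfies $M<\min\{\lambda_\phi,\lambda_\psi\}/(6c_0)$, where $c_0=(1+e^{C_{\max}})^2/e^{C_{\max}}$,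 $C_{\max}=(\sqrt2\gamma_{\max}+\tilde b)(\sqrt2\theta_{\max}+\tilde b)\sqrt{d_1d_2}\,\phi_{\max}\psi_{\max}$ and $\tilde b=\min\{\lambda_\phi/(\sqrt{d_2}\gamma_{\max}),\lambda_\psi/(\sqrt{d_1}\theta_{\max})\}/(8\sqrt2\phi_{\max}^2\psi_{\max}^2)$. (5) With $\mathcal I_{\theta\theta},\mathcal I_{\theta\gamma},\mathcal I_{\gamma\theta},\mathcal I_{\gamma\gamma}$ the blocks of $\mathbb E\nabla^2L_n(\theta_*,\gamma_*)$, the matrix $\tilde{\mathcal I}=\mathcal I_{\theta\theta}-\mathcal I_{\theta\gamma}\mathcal I_{\gamma\gamma}^{-1}\mathcal I_{\gamma\theta}$ is positive definite. **Pessimistic best-of-$N$.** Let $\hat{\mathcal I}_{\theta\theta},\hat{\mathcal I}_{\gamma\gamma},\hat{\mathcal I}_{\gamma\theta}=\hat{\mathcal I}_{\theta\gamma}^\top$ at $(\theta,\gamma)$ be the averages over $i=1,\dots,n$ of $w_i\sigma_\gamma^2(x_i)z_iz_i^\top$, $w_i(\theta^\top z_i)^2\psi(x_i)\psi(x_i)^\top$,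 $w_i\sigma_\gamma(x_i)(\theta^\top z_i)\psi(x_i)z_i^\top$, where $w_i=\mu(v_i)[1-\mu(v_i)]$, $v_i=\sigma_\gamma(x_i)\theta^\top z_i$, and let $S_\theta^2=[\hat{\mathcal I}_{\theta\theta}-\hat{\mathcal I}_{\theta\gamma}\hat{\mathcal I}_{\gamma\gamma}^{-1}\hat{\mathcal I}_{\theta\gamma}^\top]^{-1}$ evaluated at $(\theta_T,\gamma_T)$. Let $q_{1-\alpha/2}$ be the $(1-\alpha/2)$-quantile of $\mathcal N(0,1)$, write $\|v\|_B=\sqrt{v^\top Bv}$, and define the pessimistic value (lower confidence bound) $$\hat r(s,a)=\min\big\{r_\theta(s,a):\ \|\theta-\theta_T\|_{S_\theta^{-2}}\le q_{1-\alpha/2}/\sqrt n\big\}.$$ For each prompt $s$ there is a set $\mathcal A_N(s)=\{a_1(s),\dots,a_N(s)\}$ of candidate responses, with $a_j(\cdot)$ measurable. Prompts are drawn from a probability law, whose expectation is $\mathbb E_s$. Let $a_*(s)\in\arg\max_{a\in\mathcal A_N(s)}r_{\theta_*}(s,a)$ be a measurable oracle policy, let $a_{pBoN}(s)\in\arg\max_{a\in\mathcal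 A_N(s)}\hat r(s,a)$ be any measurable selection, and set $\mathsf{SubOpt}(a_{pBoN})=\mathbb E_s[r_{\theta_*}(s,a_*(s))-r_{\theta_*}(s,a_{pBoN}(s))]$. **Theorem.** Suppose (1)–(5) hold and $\mathbb E_s\phi(s,a_*(s))\ne0$. There are constants $b_0,\eta_0>0$ such that for all $b<b_0$ and $0<\eta_1,\eta_2<\eta_0$ there is a constant $c>0$ with the following property. For all $\delta,\alpha\in(0,1)$ there are constants $n_0,T_0$ such that for all $n>n_0$, all $T>T_0$ with $T>c\log n$, and all initial points with $\|\theta_0-\theta_*\|_2\le b/\sqrt2$, $\|\gamma_0-\gamma_*\|_2\le b/\sqrt2$, with probability at least $1-\delta-\frac1n$, $$\mathsf{SubOpt}(a_{pBoN})\le\frac{3\,q_{1-\alpha/2}\,\big\|\tilde{\mathcal I}^{-1/2}\,\mathbb E_s\phi(s,a_*(s))\big\|_2}{\sqrt n}.$$ The constants may depend on all fixed data of the problem (feature maps, true parameters, laws, candidate sets, oracle policy). -/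

import Mathlib

open MeasureTheory ProbabilityTheory

noncomputable section

namespace HetPref

/-- The parameter spaces carry the Euclidean norm. -/
abbrev Vec (d : ℕ) := EuclideanSpace ℝ (Fin d)

/-- A comparison task `(x, s, a⁰, a¹)`: teacher context, prompt and two candidate responses. -/
abbrev Task (X S A : Type*) := X × S × A × A

/-- A labelled comparison; the label is `true` (i.e. `y = 1`) if the teacher prefers `a¹`. -/
abbrev Obs (X S A : Type*) := Task X S A × Bool

/-- The label as a real number `y ∈ {0, 1}`. -/
def label (c : Bool) : ℝ := if c then 1 else 0

/-- The known feature maps. -/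
structure Features (X S A : Type*) (d₁ d₂ : ℕ) where
  phi : S → A → Vec d₁
  psi0 : X → ℝ
  psi : X → Vec d₂

section Model

variable {X S A : Type*} {d₁ d₂ : ℕ}

namespace Features

/-- The linear reward `r_θ(s, a) = θᵀ φ(s, a)`. -/
def reward (F : Features X S A d₁ d₂) (θ : Vec d₁) (s : S) (a : A) : ℝ :=
  inner ℝ θ (F.phi s a)

/-- The rationality scale `σ_γ(x) = ψ₀(x) + γᵀ ψ(x)`. -/
def scale (F : Features X S A d₁ d₂) (γ : Vec d₂) (x : X) : ℝ :=
  F.psi0 x + inner ℝ γ (F.psi x)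

/-- The feature difference `z = φ(s, a¹) - φ(s, a⁰)`. -/
def z (F : Features X S A d₁ d₂) (w : Task X S A) : Vec d₁ :=
  F.phi w.2.1 w.2.2.2 - F.phi w.2.1 w.2.2.1

/-- The probability `μ(σ_γ(x) (r_θ(s, a¹) - r_θ(s, a⁰)))` that `a¹` is preferred to `a⁰`,
with `μ` the logistic function. -/
def prefProb (F : Features X S A d₁ d₂) (θ : Vec d₁) (γ : Vec d₂) (w : Task X S A) : ℝ :=
  Real.sigmoid (F.scale γ w.1 * (F.reward θ w.2.1 w.2.2.2 - F.reward θ w.2.1 w.2.2.1))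

/-- Negative log-likelihood of one observation. -/
def obsLoss (F : Features X S A d₁ d₂) (θ : Vec d₁) (γ : Vec d₂) (o : Obs X S A) : ℝ :=
  -(label o.2 * Real.log (F.prefProb θ γ o.1)
    + (1 - label o.2) * Real.log (1 - F.prefProb θ γ o.1))

/-- The negative log-likelihood `L_n(θ, γ)` of a dataset of size `n`. -/
def loss (F : Features X S A d₁ d₂) {n : ℕ} (data : Fin n → Obs X S A)
    (θ : Vec d₁) (γ : Vec d₂) : ℝ :=
  (1 / (n : ℝ)) * ∑ i, F.obsLoss θ γ (data i)

/-- Alternating gradient descent: the iterates `(θ_t, γ_t)` with learning rates `η₁, η₂` started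
at `(θ₀, γ₀)`; the `γ`-step already uses the updated `θ_{t+1}`. -/
def agd (F : Features X S A d₁ d₂) {n : ℕ} (data : Fin n → Obs X S A)
    (η₁ η₂ : ℝ) (θ₀ : Vec d₁) (γ₀ : Vec d₂) : ℕ → Vec d₁ × Vec d₂
  | 0 => (θ₀, γ₀)
  | t + 1 =>
    let p := agd F data η₁ η₂ θ₀ γ₀ t
    let θ' := p.1 - η₁ • gradient (fun θ => F.loss data θ p.2) p.1
    (θ', p.2 - η₂ • gradient (fun γ => F.loss data θ' γ) p.2)

/-- The weight `μ(v)(1 - μ(v))` at `v = σ_γ(x) θᵀ z`. -/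
def weight (F : Features X S A d₁ d₂) (θ : Vec d₁) (γ : Vec d₂) (w : Task X S A) : ℝ :=
  F.prefProb θ γ w * (1 - F.prefProb θ γ w)

/-! ### Empirical information matrices and the plug-in variance estimator -/

def empThetaTheta (F : Features X S A d₁ d₂) {n : ℕ} (data : Fin n → Obs X S A)
    (θ : Vec d₁) (γ : Vec d₂) : Matrix (Fin d₁) (Fin d₁) ℝ :=
  Matrix.of fun j k => (1 / (n : ℝ)) * ∑ i, F.weight θ γ (data i).1
    * F.scale γ (data i).1.1 ^ 2 * F.z (data i).1 j * F.z (data i).1 k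

def empGammaGamma (F : Features X S A d₁ d₂) {n : ℕ} (data : Fin n → Obs X S A)
    (θ : Vec d₁) (γ : Vec d₂) : Matrix (Fin d₂) (Fin d₂) ℝ :=
  Matrix.of fun j k => (1 / (n : ℝ)) * ∑ i, F.weight θ γ (data i).1
    * (inner ℝ θ (F.z (data i).1)) ^ 2 * F.psi (data i).1.1 j * F.psi (data i).1.1 k

def empGammaTheta (F : Features X S A d₁ d₂) {n : ℕ} (data : Fin n → Obs X S A)
    (θ : Vec d₁) (γ : Vec d₂) : Matrix (Fin d₂) (Fin d₁) ℝ :=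
  Matrix.of fun j k => (1 / (n : ℝ)) * ∑ i, F.weight θ γ (data i).1
    * F.scale γ (data i).1.1 * inner ℝ θ (F.z (data i).1)
    * F.psi (data i).1.1 j * F.z (data i).1 k

/-- `S_θ²(θ, γ) = [Î_θθ - Î_θγ Î_γγ⁻¹ Î_θγᵀ]⁻¹`, where `Î_θγ = Î_γθᵀ`. -/
def sTheta2 (F : Features X S A d₁ d₂) {n : ℕ} (data : Fin n → Obs X S A)
    (θ : Vec d₁) (γ : Vec d₂) : Matrix (Fin d₁) (Fin d₁) ℝ :=
  (F.empThetaTheta data θ γ - (F.empGammaTheta data θ γ).transpose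
    * (F.empGammaGamma data θ γ)⁻¹ * F.empGammaTheta data θ γ)⁻¹

/-! ### Population quantities; `D` is the law of one observation -/

variable [MeasurableSpace X] [MeasurableSpace S] [MeasurableSpace A]

/-- `E ∇²_θθ L_n(θ, γ)`; as `L_n` is an average over identically distributed observations, this is
the expected Hessian of the loss of a single observation. -/
def infoThetaTheta (F : Features X S A d₁ d₂) (D : Measure (Obs X S A))
    (θ : Vec d₁) (γ : Vec d₂) : Matrix (Fin d₁) (Fin d₁) ℝ :=
  Matrix.of fun j k => ∫ o, lineDeriv ℝ (fun θ' => lineDeriv ℝ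
    (fun θ'' => F.obsLoss θ'' γ o) θ' (EuclideanSpace.single k 1))
      θ (EuclideanSpace.single j 1) ∂D

/-- `E ∇²_γγ L_n(θ, γ)`. -/
def infoGammaGamma (F : Features X S A d₁ d₂) (D : Measure (Obs X S A))
    (θ : Vec d₁) (γ : Vec d₂) : Matrix (Fin d₂) (Fin d₂) ℝ :=
  Matrix.of fun j k => ∫ o, lineDeriv ℝ (fun γ' => lineDeriv ℝ
    (fun γ'' => F.obsLoss θ γ'' o) γ' (EuclideanSpace.single k 1))
      γ (EuclideanSpace.single j 1) ∂D

/-- `E ∇²_γθ L_n(θ, γ)`: rows are indexed by the coordinates of `γ`, columns by those of `θ`. -/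
def infoGammaTheta (F : Features X S A d₁ d₂) (D : Measure (Obs X S A))
    (θ : Vec d₁) (γ : Vec d₂) : Matrix (Fin d₂) (Fin d₁) ℝ :=
  Matrix.of fun j k => ∫ o, lineDeriv ℝ (fun γ' => lineDeriv ℝ
    (fun θ' => F.obsLoss θ' γ' o) θ (EuclideanSpace.single k 1))
      γ (EuclideanSpace.single j 1) ∂D

/-- `E ∇²_θγ L_n(θ, γ)`: rows are indexed by the coordinates of `θ`, columns by those of `γ`. -/
def infoThetaGamma (F : Features X S A d₁ d₂) (D : Measure (Obs X S A))
    (θ : Vec d₁) (γ : Vec d₂) : Matrix (Fin d₁) (Fin d₂) ℝ :=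
  Matrix.of fun j k => ∫ o, lineDeriv ℝ (fun θ' => lineDeriv ℝ
    (fun γ' => F.obsLoss θ' γ' o) γ (EuclideanSpace.single k 1))
      θ (EuclideanSpace.single j 1) ∂D

/-- The information for `θ` adjusted for the nuisance parameter `γ`:
`Ĩ = I_θθ - I_θγ I_γγ⁻¹ I_γθ`. -/
def infoTilde (F : Features X S A d₁ d₂) (D : Measure (Obs X S A))
    (θ : Vec d₁) (γ : Vec d₂) : Matrix (Fin d₁) (Fin d₁) ℝ :=
  F.infoThetaTheta D θ γ
    - F.infoThetaGamma D θ γ * (F.infoGammaGamma D θ γ)⁻¹ * F.infoGammaTheta D θ γ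

/-- `E[σ_γ(x)² z zᵀ]`. -/
def designTheta (F : Features X S A d₁ d₂) (D : Measure (Obs X S A)) (γ : Vec d₂) :
    Matrix (Fin d₁) (Fin d₁) ℝ :=
  Matrix.of fun j k => ∫ o, F.scale γ o.1.1 ^ 2 * F.z o.1 j * F.z o.1 k ∂D

/-- `E[(θᵀ z)² ψ(x) ψ(x)ᵀ]`. -/
def designGamma (F : Features X S A d₁ d₂) (D : Measure (Obs X S A)) (θ : Vec d₁) :
    Matrix (Fin d₂) (Fin d₂) ℝ :=
  Matrix.of fun j k => ∫ o, (inner ℝ θ (F.z o.1)) ^ 2 * F.psi o.1.1 j * F.psi o.1.1 k ∂D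

/-- `E{μ(v)[1 - μ(v)] v ψ(x) zᵀ}` with `v = σ_γ(x) θᵀ z`. -/
def crossMatrix (F : Features X S A d₁ d₂) (D : Measure (Obs X S A))
    (θ : Vec d₁) (γ : Vec d₂) : Matrix (Fin d₂) (Fin d₁) ℝ :=
  Matrix.of fun j k => ∫ o, F.weight θ γ o.1 * F.scale γ o.1.1 * inner ℝ θ (F.z o.1)
    * F.psi o.1.1 j * F.z o.1 k ∂D

open scoped Matrix.Norms.L2Operator in
/-- The coupling strength `M`, a spectral norm. -/
def coupling (F : Features X S A d₁ d₂) (D : Measure (Obs X S A))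
    (θ : Vec d₁) (γ : Vec d₂) : ℝ :=
  ‖F.crossMatrix D θ γ‖

/-- The feature maps are measurable. -/
structure Measurability (F : Features X S A d₁ d₂) : Prop where
  phi : Measurable fun p : S × A => F.phi p.1 p.2
  psi0 : Measurable F.psi0
  psi : Measurable F.psi

end Features

/-! ### The assumptions -/

/-- Linear bounded reward: `‖φ(s, a)‖₂ ≤ φ_max` and `‖θ_*‖_∞ ≤ θ_max`. -/
structure RewardAssumption (F : Features X S A d₁ d₂) (θs : Vec d₁) (φmax θmax : ℝ) : Prop where
  phi_pos : 0 < φmax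
  theta_pos : 0 < θmax
  phi_le : ∀ s a, ‖F.phi s a‖ ≤ φmax
  theta_le : ∀ i, |θs i| ≤ θmax

/-- Bounded scale: `ψ₀ ≢ 0`, `‖(ψ₀(x), ψ(x))‖₂ ≤ ψ_max` and `‖(1, γ_*)‖_∞ ≤ γ_max`. -/
structure ScaleAssumption (F : Features X S A d₁ d₂) (γs : Vec d₂) (ψmax γmax : ℝ) : Prop where
  psi_pos : 0 < ψmax
  gamma_pos : 0 < γmax
  psi0_ne : ∃ x, F.psi0 x ≠ 0
  psi_le : ∀ x, Real.sqrt (F.psi0 x ^ 2 + ‖F.psi x‖ ^ 2) ≤ ψmax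
  one_le : 1 ≤ γmax
  gamma_le : ∀ i, |γs i| ≤ γmax

/-- The radius
`b̃ = min{λ_φ / (√d₂ γ_max), λ_ψ / (√d₁ θ_max)} / (8 √2 φ_max² ψ_max²)`. -/
def bTilde (d₁ d₂ : ℕ) (φmax θmax ψmax γmax lamφ lamψ : ℝ) : ℝ :=
  min (lamφ / (Real.sqrt d₂ * γmax)) (lamψ / (Real.sqrt d₁ * θmax))
    / (8 * Real.sqrt 2 * φmax ^ 2 * ψmax ^ 2)

/-- `C_max = (√2 γ_max + b̃)(√2 θ_max + b̃) √(d₁ d₂) φ_max ψ_max`. -/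
def cMax (d₁ d₂ : ℕ) (φmax θmax ψmax γmax lamφ lamψ : ℝ) : ℝ :=
  (Real.sqrt 2 * γmax + bTilde d₁ d₂ φmax θmax ψmax γmax lamφ lamψ)
    * (Real.sqrt 2 * θmax + bTilde d₁ d₂ φmax θmax ψmax γmax lamφ lamψ)
    * Real.sqrt (d₁ * d₂) * φmax * ψmax

/-- `c₀ = (1 + e^{C_max})² / e^{C_max}`. -/
def cZero (d₁ d₂ : ℕ) (φmax θmax ψmax γmax lamφ lamψ : ℝ) : ℝ :=
  (1 + Real.exp (cMax d₁ d₂ φmax θmax ψmax γmax lamφ lamψ)) ^ 2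
    / Real.exp (cMax d₁ d₂ φmax θmax ψmax γmax lamφ lamψ)

/-- `l` is the smallest eigenvalue of the (symmetric) matrix `B`, and it is positive. -/
def IsPosSmallestEigenvalue {d : ℕ} (B : Matrix (Fin d) (Fin d) ℝ) (l : ℝ) : Prop :=
  IsLeast (spectrum ℝ B) l ∧ 0 < l

section Law

variable [MeasurableSpace X] [MeasurableSpace S] [MeasurableSpace A]

/-- Under `D`, the conditional probability of `y = 1` given the task `(x, s, a⁰, a¹)` is
`μ(σ_γ(x) (r_θ(s, a¹) - r_θ(s, a⁰)))`. -/
def FollowsPreferenceModel (F : Features X S A d₁ d₂) (D : Measure (Obs X S A))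
    [IsFiniteMeasure D] (θs : Vec d₁) (γs : Vec d₂) : Prop :=
  ∀ᵐ w ∂D.fst, (D.condKernel w).real {true} = F.prefProb θs γs w

end Law

end Model

/-! ### Best-of-`N` policies -/

/-- The `p`-quantile of the standard normal distribution. -/
def normalQuantile (p : ℝ) : ℝ := sInf {x : ℝ | p ≤ cdf (gaussianReal 0 1) x}

/-- The weighted norm `‖v‖_B = √(vᵀ B v)`. -/
def weightedNorm {d : ℕ} (B : Matrix (Fin d) (Fin d) ℝ) (v : Vec d) : ℝ :=
  Real.sqrt (v.ofLp ⬝ᵥ (B.mulVec v.ofLp))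

/-- `B^{-1/2} v` for a symmetric positive definite matrix `B`. -/
def invSqrtMulVec {d : ℕ} (B : Matrix (Fin d) (Fin d) ℝ) (v : Vec d) : Vec d :=
  WithLp.toLp 2 ((cfc (fun t : ℝ => t ^ (-(1 / 2) : ℝ)) B).mulVec v.ofLp)

section Policy

variable {X S A : Type*} {d₁ d₂ : ℕ}

/-- The confidence set `{θ : ‖θ - θ_T‖_{S_θ⁻²(θ_T, γ_T)} ≤ q_{1-α/2} / √n}`. -/
def confSet (F : Features X S A d₁ d₂) {n : ℕ} (data : Fin n → Obs X S A)
    (θT : Vec d₁) (γT : Vec d₂) (α : ℝ) : Set (Vec d₁) :=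
  {θ | weightedNorm (F.sTheta2 data θT γT)⁻¹ (θ - θT)
    ≤ normalQuantile (1 - α / 2) / Real.sqrt n}

/-- The pessimistic value (lower confidence bound) `r̂(s, a)`, the minimum of `r_θ(s, a)` over the
confidence set. -/
def pessValue (F : Features X S A d₁ d₂) {n : ℕ} (data : Fin n → Obs X S A)
    (θT : Vec d₁) (γT : Vec d₂) (α : ℝ) (s : S) (a : A) : ℝ :=
  sInf ((fun θ => F.reward θ s a) '' confSet F data θT γT α)

/-- `π` is a (measurable) best-of-`N` policy for the value function `v`: it selects, for every
prompt `s`, a maximiser of `v s` among the candidates `cand 0 s, …, cand (N-1) s`. -/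
structure IsBestOfN [MeasurableSpace S] [MeasurableSpace A] {N : ℕ} (cand : Fin N → S → A)
    (v : S → A → ℝ) (π : S → A) : Prop where
  measurable : Measurable π
  mem : ∀ s, π s ∈ Set.range fun j => cand j s
  le : ∀ s j, v s (cand j s) ≤ v s (π s)

/-- The expected suboptimality `E_s[r_θ(s, a_*(s)) - r_θ(s, π(s))]`, with prompts drawn from `ν`. -/
def subOpt [MeasurableSpace S] (F : Features X S A d₁ d₂) (ν : Measure S) (θs : Vec d₁)
    (aStar π : S → A) : ℝ :=
  ∫ s, (F.reward θs s (aStar s) - F.reward θs s (π s)) ∂ν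

end Policy

/-- The event `E` has probability at least `p`: it contains a measurable event of probability at
least `p`. -/
def WithProbAtLeast {Ω : Type*} [MeasurableSpace Ω] (P : Measure Ω) (p : ℝ) (E : Set Ω) : Prop :=
  ∃ G, MeasurableSet G ∧ G ⊆ E ∧ p ≤ P.real G

end HetPref

end

/-!
The bound holds because the pessimistic policy loses only `o(1 / √n)`, whereas the right-hand side
is a fixed positive multiple of `1 / √n`: the quantile `q_{1-α/2}` is positive since `α < 1`
(`normalQuantile_pos`), and `Ĩ^{-1/2} E φ(s, a_*(s))` is nonzero (`invSqrtMulVec_ne_zero`).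

With probability at least `1 - δ` the estimate satisfies `‖θ_T - θ_*‖ ≤ C / √n`, and the confidence
set is contained in a ball of radius `C / √n`. The pessimistic values are then uniformly within
`C / √n` of the true rewards, so that the policy never selects a candidate with a gap above
`ρ = C / √n` (`gap_le`). Hence its suboptimality is at most `ρ` times the probability of a prompt
with some gap in `(0, ρ]` (`subOpt_le`), and this probability tends to zero with `ρ`
(`exists_pos_measureReal_nearTies_le`). No asymptotic normality is needed.

The rate of the estimate combines three facts.
* The Fisher information of `(θ, γ)` is positive definite, since its `γ`-block and the Schur
  complement `Ĩ` of that block are (`Features.fisher_posDef`).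
* By Chebyshev's inequality, with high probability the score at the true parameters is of order
  `1 / √n` and the empirical second-order quantities there are close to their expectations
  (`Features.exists_typical_event`). The margin `σ_γ(x) θᵀ z` is bilinear, so the Hessian also has a
  term proportional to the residual `μ - y`; its expectation vanishes under the preference model.
* The logistic loss is smooth, so on such an event the empirical loss grows quadratically around the
  true parameters, up to a tolerance of the order of the squared score
  (`Features.Typical.descentLandscape`). Each round of alternating gradient descent decreases the
  loss by a multiple of the squared gradient norm, and a gradient-domination inequality turns this
  into linear convergence up to the tolerance (`DescentLandscape.iterate_le`). With `T > c log n`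
  rounds both contributions to the squared error are of order `1 / n`.

The radius of the confidence set is controlled by a lower bound on the plug-in information matrix,
which passes to its Schur complement (`norm_sub_le_of_mem_confSet`).
-/

noncomputable section

namespace HetPref

/-! ### The logistic loss of a real score -/

/-- The logistic loss `-(y log μ(v) + (1 - y) log (1 - μ(v)))` of the score `v`. -/
def logisticLoss (y v : ℝ) : ℝ :=
  -(y * Real.log (Real.sigmoid v) + (1 - y) * Real.log (1 - Real.sigmoid v))

/-- The derivative `μ(v) (1 - μ(v))` of the logistic function. -/
def logisticWeight (v : ℝ) : ℝ := Real.sigmoid v * (1 - Real.sigmoid v)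

lemma logisticWeight_pos (v : ℝ) : 0 < logisticWeight v :=
  mul_pos (Real.sigmoid_pos v) (sub_pos.2 (Real.sigmoid_lt_one v))

lemma logisticWeight_le_one (v : ℝ) : logisticWeight v ≤ 1 := by
  have h₁ := Real.sigmoid_pos v
  have h₂ := Real.sigmoid_lt_one v
  unfold logisticWeight
  nlinarith

lemma hasDerivAt_logisticLoss (y v : ℝ) :
    HasDerivAt (logisticLoss y) (Real.sigmoid v - y) v := by
  have h₁ := Real.sigmoid_pos v
  have h₂ : 0 < 1 - Real.sigmoid v := sub_pos.2 (Real.sigmoid_lt_one v)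
  have hs := Real.hasDerivAt_sigmoid v
  have := (((hs.log h₁.ne').const_mul y).add
    (((hs.const_sub 1).log h₂.ne').const_mul (1 - y))).neg
  refine this.congr_deriv ?_
  field_simp
  ring

lemma hasDerivAt_logisticWeight (v : ℝ) :
    HasDerivAt logisticWeight (logisticWeight v * (1 - 2 * Real.sigmoid v)) v := by
  have hs := Real.hasDerivAt_sigmoid v
  refine (hs.mul (hs.const_sub 1)).congr_deriv ?_
  unfold logisticWeight
  ring

/-- The mean value inequality, with the derivative bounded only at points between `v` and `v'`. -/
lemma abs_sub_le_of_hasDerivAt {f f' : ℝ → ℝ} {v v' B : ℝ} (hf : ∀ x, HasDerivAt f (f' x) x)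
    (hB : ∀ x, |x - v| ≤ |v' - v| → |f' x| ≤ B) : |f v' - f v| ≤ B * |v' - v| := by
  have := (convex_uIcc v v').norm_image_sub_le_of_norm_hasDerivWithin_le
    (fun x _ => (hf x).hasDerivWithinAt)
    (fun x hx => by simpa using hB x (Set.abs_sub_left_of_mem_uIcc hx))
    Set.left_mem_uIcc Set.right_mem_uIcc
  simpa using this

lemma abs_sigmoid_sub_le (v v' : ℝ) : |Real.sigmoid v' - Real.sigmoid v| ≤ |v' - v| := by
  have := abs_sub_le_of_hasDerivAt (v := v) (v' := v') (B := 1) Real.hasDerivAt_sigmoid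
    fun x _ => by
      exact (abs_of_pos (logisticWeight_pos x)).trans_le (logisticWeight_le_one x)
  simpa using this

lemma abs_logisticWeight_sub_le (v v' : ℝ) :
    |logisticWeight v' - logisticWeight v| ≤ |v' - v| := by
  have := abs_sub_le_of_hasDerivAt (v := v) (v' := v') (B := 1) hasDerivAt_logisticWeight
    fun x _ => by
      have h₁ := Real.sigmoid_pos x
      have h₂ := Real.sigmoid_lt_one x
      rw [abs_mul, abs_of_pos (logisticWeight_pos x)]
      exact mul_le_one₀ (logisticWeight_le_one x) (abs_nonneg _)
        (abs_le.2 ⟨by linarith, by linarith⟩)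
  simpa using this

/-- First-order Taylor bound for the logistic function. -/
lemma abs_sigmoid_taylor_le (v v' : ℝ) :
    |Real.sigmoid v' - Real.sigmoid v - logisticWeight v * (v' - v)| ≤ |v' - v| ^ 2 := by
  have := abs_sub_le_of_hasDerivAt (v := v) (v' := v') (B := |v' - v|)
    (f := fun x => Real.sigmoid x - logisticWeight v * x)
    (f' := fun x => logisticWeight x - logisticWeight v)
    (fun x => by
      refine ((Real.hasDerivAt_sigmoid x).sub
        ((hasDerivAt_id x).const_mul (logisticWeight v))).congr_deriv ?_
      simp [logisticWeight])
    fun x hx => (abs_logisticWeight_sub_le v x).trans hx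
  rw [← pow_two] at this
  convert this using 2
  ring

/-- Second-order Taylor bound for the logistic loss. -/
lemma abs_logisticLoss_taylor_le (y v v' : ℝ) :
    |logisticLoss y v' - logisticLoss y v - (Real.sigmoid v - y) * (v' - v)
      - logisticWeight v * (v' - v) ^ 2 / 2| ≤ |v' - v| ^ 3 := by
  have := abs_sub_le_of_hasDerivAt (v := v) (v' := v') (B := |v' - v| ^ 2)
    (f := fun x => logisticLoss y x - (Real.sigmoid v - y) * x
      - logisticWeight v * (x - v) ^ 2 / 2)
    (f' := fun x => Real.sigmoid x - Real.sigmoid v - logisticWeight v * (x - v))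
    (fun x => by
      refine (((hasDerivAt_logisticLoss y x).sub
        ((hasDerivAt_id x).const_mul (Real.sigmoid v - y))).sub
        (((((hasDerivAt_id x).sub_const v).pow 2).const_mul
          (logisticWeight v)).div_const 2)).congr_deriv ?_
      simp
      ring)
    fun x hx => (abs_sigmoid_taylor_le v x).trans (by gcongr)
  calc _ = _ := by congr 1; ring
    _ ≤ _ := this
    _ = _ := by ring

/-- The logistic loss is smooth: it lies below its tangents up to a quadratic term. -/
lemma logisticLoss_le (y v v' : ℝ) :
    logisticLoss y v' ≤ logisticLoss y v + (Real.sigmoid v - y) * (v' - v) + (v' - v) ^ 2 := by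
  have := abs_sub_le_of_hasDerivAt (v := v) (v' := v') (B := |v' - v|)
    (f := fun x => logisticLoss y x - (Real.sigmoid v - y) * x)
    (f' := fun x => Real.sigmoid x - Real.sigmoid v)
    (fun x => by
      refine ((hasDerivAt_logisticLoss y x).sub
        ((hasDerivAt_id x).const_mul (Real.sigmoid v - y))).congr_deriv ?_
      simp)
    fun x hx => (abs_sigmoid_sub_le v x).trans hx
  rw [abs_mul_abs_self] at this
  have := (abs_le.1 this).2
  nlinarith

section Expansion

variable {y v l β K ρ : ℝ}

/-- Expansion of the logistic loss when the score increment splits into a part `l` of first order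
and a part `β` of second order in a small parameter `ρ`. -/
lemma abs_logisticLoss_expansion_le (hK : 1 ≤ K) (hρ : 0 ≤ ρ)
    (hρ1 : ρ ≤ 1) (hl : |l| ≤ 2 * K ^ 2 * ρ) (hβ : |β| ≤ K ^ 2 * ρ ^ 2) :
    |logisticLoss y (v + (l + β)) - logisticLoss y v - (Real.sigmoid v - y) * l
      - (logisticWeight v * l ^ 2 + 2 * ((Real.sigmoid v - y) * β)) / 2|
      ≤ 50 * K ^ 6 * ρ ^ 3 := by
  have hT := abs_logisticLoss_taylor_le y v (v + (l + β))
  rw [add_sub_cancel_left] at hT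
  have hβ' : |β| ≤ K ^ 2 * ρ := hβ.trans (by gcongr; nlinarith)
  have hh : |l + β| ≤ 3 * K ^ 2 * ρ := (abs_add_le _ _).trans (by linarith)
  have h3 : |l + β| ^ 3 ≤ (3 * K ^ 2 * ρ) ^ 3 := by gcongr
  have hw := logisticWeight_pos v
  have hw1 := logisticWeight_le_one v
  have h2 : |logisticWeight v * (β * (2 * l + β)) / 2| ≤ 1 * (K ^ 2 * ρ ^ 2 * (5 * K ^ 2 * ρ)) := by
    have : |2 * l + β| ≤ 5 * K ^ 2 * ρ := by
      refine (abs_add_le _ _).trans ?_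
      rw [abs_mul, abs_two]; linarith
    rw [abs_div, abs_mul, abs_mul, abs_of_pos hw, abs_two]
    refine (half_le_self (by positivity)).trans ?_
    gcongr
  have hK6 : K ^ 4 ≤ K ^ 6 := pow_le_pow_right₀ hK (by norm_num)
  have e : logisticLoss y (v + (l + β)) - logisticLoss y v - (Real.sigmoid v - y) * l
      - (logisticWeight v * l ^ 2 + 2 * ((Real.sigmoid v - y) * β)) / 2
      = (logisticLoss y (v + (l + β)) - logisticLoss y v - (Real.sigmoid v - y) * (l + β)
      - logisticWeight v * (l + β) ^ 2 / 2) + logisticWeight v * (β * (2 * l + β)) / 2 := by ring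
  rw [e]
  refine (abs_add_le _ _).trans ((add_le_add (hT.trans h3) h2).trans ?_)
  have : K ^ 4 * ρ ^ 3 ≤ K ^ 6 * ρ ^ 3 := by gcongr
  have h0 : 0 ≤ K ^ 6 * ρ ^ 3 := by positivity
  nlinarith

/-- Expansion of the derivative of the logistic loss in the direction of the increment, in the
situation of `abs_logisticLoss_expansion_le`. -/
lemma abs_residual_expansion_le (hK : 1 ≤ K) (hρ : 0 ≤ ρ)
    (hρ1 : ρ ≤ 1) (hl : |l| ≤ 2 * K ^ 2 * ρ) (hβ : |β| ≤ K ^ 2 * ρ ^ 2) :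
    |(Real.sigmoid (v + (l + β)) - y) * (l + 2 * β) - (Real.sigmoid v - y) * l
      - (logisticWeight v * l ^ 2 + 2 * ((Real.sigmoid v - y) * β))|
      ≤ 50 * K ^ 6 * ρ ^ 3 := by
  have hT := abs_sigmoid_taylor_le v (v + (l + β))
  rw [add_sub_cancel_left] at hT
  have hβ' : |β| ≤ K ^ 2 * ρ := hβ.trans (by gcongr; nlinarith)
  have hh : |l + β| ≤ 3 * K ^ 2 * ρ := (abs_add_le _ _).trans (by linarith)
  have h3 : |l + β| ^ 2 ≤ (3 * K ^ 2 * ρ) ^ 2 := by gcongr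
  have hw := logisticWeight_pos v
  have hw1 := logisticWeight_le_one v
  have h2 : |logisticWeight v * (β * (3 * l + 2 * β))| ≤ 1 * (K ^ 2 * ρ ^ 2 * (8 * K ^ 2 * ρ)) := by
    have : |3 * l + 2 * β| ≤ 8 * K ^ 2 * ρ := by
      refine (abs_add_le _ _).trans ?_
      rw [abs_mul, abs_mul, abs_two, abs_of_pos (by norm_num : (0 : ℝ) < 3)]; linarith
    rw [abs_mul, abs_mul, abs_of_pos hw]
    gcongr
  have h4 : |l + 2 * β| ≤ 4 * K ^ 2 * ρ := by
    refine (abs_add_le _ _).trans ?_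
    rw [abs_mul, abs_two]; linarith
  have hK6 : K ^ 4 ≤ K ^ 6 := pow_le_pow_right₀ hK (by norm_num)
  have e : (Real.sigmoid (v + (l + β)) - y) * (l + 2 * β) - (Real.sigmoid v - y) * l
      - (logisticWeight v * l ^ 2 + 2 * ((Real.sigmoid v - y) * β))
      = (Real.sigmoid (v + (l + β)) - Real.sigmoid v - logisticWeight v * (l + β)) * (l + 2 * β)
        + logisticWeight v * (β * (3 * l + 2 * β)) := by ring
  rw [e]
  refine (abs_add_le _ _).trans ?_
  rw [abs_mul]
  refine (add_le_add (mul_le_mul (hT.trans h3) h4 (abs_nonneg _) (by positivity)) h2).trans ?_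
  have : K ^ 4 * ρ ^ 3 ≤ K ^ 6 * ρ ^ 3 := by gcongr
  have h0 : 0 ≤ K ^ 6 * ρ ^ 3 := by positivity
  nlinarith

end Expansion

/-! ### Alternating gradient descent near a point of strong convexity -/

section AlternatingDescent

variable {E₁ E₂ : Type*} [NormedAddCommGroup E₁] [InnerProductSpace ℝ E₁]
  [NormedAddCommGroup E₂] [InnerProductSpace ℝ E₂]

/-- The properties of a function `L` and of its partial gradients `g₁, g₂` that make alternating
gradient descent contract towards `(x, y)` up to the tolerance `ς`: the partial gradients are
bounded, they satisfy the descent inequality, the `y`-gradient is Lipschitz in the first argument,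
and `L` has quadratic growth around `(x, y)` up to `ς`. -/
structure DescentLandscape (L : E₁ → E₂ → ℝ) (g₁ : E₁ → E₂ → E₁) (g₂ : E₁ → E₂ → E₂)
    (x : E₁) (y : E₂) (R m Λ ς : ℝ) : Prop where
  radius_pos : 0 < R
  radius_le : R ≤ 1
  m_pos : 0 < m
  m_le : m ≤ Λ
  one_le : 1 ≤ Λ
  tol_nonneg : 0 ≤ ς
  norm_g₁_le : ∀ u v, ‖u - x‖ ≤ 1 → ‖v - y‖ ≤ 1 → ‖g₁ u v‖ ≤ Λ
  norm_g₂_le : ∀ u v, ‖u - x‖ ≤ 1 → ‖v - y‖ ≤ 1 → ‖g₂ u v‖ ≤ Λ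
  descent₁ : ∀ u u' v, ‖u - x‖ ≤ 1 → ‖v - y‖ ≤ 1 →
    L u' v ≤ L u v + inner ℝ (g₁ u v) (u' - u) + Λ * ‖u' - u‖ ^ 2
  descent₂ : ∀ u v v', ‖u - x‖ ≤ 1 → ‖v - y‖ ≤ 1 →
    L u v' ≤ L u v + inner ℝ (g₂ u v) (v' - v) + Λ * ‖v' - v‖ ^ 2
  lipschitz : ∀ u u' v, ‖u - x‖ ≤ 1 → ‖u' - x‖ ≤ 1 → ‖v - y‖ ≤ 1 →
    ‖g₂ u' v - g₂ u v‖ ≤ Λ * ‖u' - u‖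
  le_inner : ∀ u v, ‖u - x‖ ^ 2 + ‖v - y‖ ^ 2 ≤ R ^ 2 →
    m * (‖u - x‖ ^ 2 + ‖v - y‖ ^ 2) - ς ≤ inner ℝ (g₁ u v) (u - x) + inner ℝ (g₂ u v) (v - y)
  le_sub : ∀ u v, ‖u - x‖ ^ 2 + ‖v - y‖ ^ 2 ≤ R ^ 2 →
    m * (‖u - x‖ ^ 2 + ‖v - y‖ ^ 2) - ς ≤ L u v - L x y
  sub_le : ∀ u v, ‖u - x‖ ^ 2 + ‖v - y‖ ^ 2 ≤ R ^ 2 →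
    L u v - L x y ≤ Λ * (‖u - x‖ ^ 2 + ‖v - y‖ ^ 2) + ς

namespace DescentLandscape

variable {L : E₁ → E₂ → ℝ} {g₁ : E₁ → E₂ → E₁} {g₂ : E₁ → E₂ → E₂} {x : E₁} {y : E₂}
  {R m Λ ς : ℝ} {η₁ η₂ η : ℝ}

lemma norm_sub_le_one (h : DescentLandscape L g₁ g₂ x y R m Λ ς) {u : E₁} {v : E₂}
    (huv : ‖u - x‖ ^ 2 + ‖v - y‖ ^ 2 ≤ R ^ 2) : ‖u - x‖ ≤ 1 ∧ ‖v - y‖ ≤ 1 := by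
  have h1 : R ^ 2 ≤ 1 := pow_le_one₀ h.radius_pos.le h.radius_le
  constructor <;> refine abs_le_of_sq_le_sq' (b := 1) ?_ one_pos.le |>.2
  · nlinarith [sq_nonneg ‖v - y‖]
  · nlinarith [sq_nonneg ‖u - x‖]

/-- One round of alternating gradient descent decreases `L` by a multiple of the squared norm of
the full gradient at the old point. -/
lemma step_le (h : DescentLandscape L g₁ g₂ x y R m Λ ς) (hη₁ : η ≤ η₁) (hη₂ : η ≤ η₂)
    (hη : 0 < η) (hη₁' : Λ * η₁ ≤ 1 / 2) (hη₂' : Λ * η₂ ≤ 1 / 2) {u : E₁} {v : E₂}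
    (hu : ‖u - x‖ ≤ 1) (hv : ‖v - y‖ ≤ 1) (hu' : ‖u - η₁ • g₁ u v - x‖ ≤ 1) :
    L (u - η₁ • g₁ u v) (v - η₂ • g₂ (u - η₁ • g₁ u v) v)
      ≤ L u v - η / 4 * (‖g₁ u v‖ ^ 2 + ‖g₂ u v‖ ^ 2) := by
  set u' := u - η₁ • g₁ u v with hu'_def
  have e1 : u' - u = -(η₁ • g₁ u v) := by rw [hu'_def]; abel
  have h1 := h.descent₁ u u' v hu hv
  have h2 := h.descent₂ u' v (v - η₂ • g₂ u' v) hu' hv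
  have h3 := h.lipschitz u u' v hu hu' hv
  have e2 : v - η₂ • g₂ u' v - v = -(η₂ • g₂ u' v) := by abel
  rw [e1, inner_neg_right, inner_smul_right, real_inner_self_eq_norm_sq, norm_neg, norm_smul,
    Real.norm_of_nonneg (hη.le.trans hη₁)] at h1
  rw [e2, inner_neg_right, inner_smul_right, real_inner_self_eq_norm_sq, norm_neg, norm_smul,
    Real.norm_of_nonneg (hη.le.trans hη₂)] at h2
  rw [e1, norm_neg, norm_smul, Real.norm_of_nonneg (hη.le.trans hη₁)] at h3
  set a := ‖g₁ u v‖
  set b := ‖g₂ u v‖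
  set b' := ‖g₂ u' v‖
  have ha : 0 ≤ a := norm_nonneg _
  have hb' : 0 ≤ b' := norm_nonneg _
  have h4 : b ≤ b' + a / 2 := by
    have := norm_sub_norm_le (g₂ u v) (g₂ u' v)
    rw [norm_sub_rev] at this
    nlinarith
  have h5 : b ^ 2 ≤ 2 * b' ^ 2 + a ^ 2 / 2 := by
    have hb : 0 ≤ b := norm_nonneg _
    have : b ^ 2 ≤ (b' + a / 2) ^ 2 := by gcongr
    nlinarith [sq_nonneg (b' - a / 2)]
  have h6 : Λ * (η₁ * a) ^ 2 ≤ η₁ / 2 * a ^ 2 := by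
    have : 0 ≤ η₁ * a ^ 2 := mul_nonneg (hη.le.trans hη₁) (sq_nonneg _)
    nlinarith
  have h7 : Λ * (η₂ * b') ^ 2 ≤ η₂ / 2 * b' ^ 2 := by
    have : 0 ≤ η₂ * b' ^ 2 := mul_nonneg (hη.le.trans hη₂) (sq_nonneg _)
    nlinarith
  -- The descent is measured at `u'`; `h5` transfers it to the gradient at the old point.
  have h8 : η * a ^ 2 ≤ η₁ * a ^ 2 := by gcongr
  have h9 : η * b' ^ 2 ≤ η₂ * b' ^ 2 := by gcongr
  have h10 : η * b ^ 2 ≤ η * (2 * b' ^ 2 + a ^ 2 / 2) := by gcongr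
  have h11 : 0 ≤ η * a ^ 2 := by positivity
  nlinarith

/-- A gradient-domination (Polyak-Łojasiewicz) inequality up to the tolerance. -/
lemma le_norm_sq (h : DescentLandscape L g₁ g₂ x y R m Λ ς) {u : E₁} {v : E₂}
    (huv : ‖u - x‖ ^ 2 + ‖v - y‖ ^ 2 ≤ R ^ 2) :
    m ^ 2 / Λ * (L u v - L x y - (1 + 2 * Λ / m) * ς) ≤ ‖g₁ u v‖ ^ 2 + ‖g₂ u v‖ ^ 2 := by
  have hm := h.m_pos
  have hΛ : 0 < Λ := one_pos.trans_le h.one_le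
  have h1 := h.le_inner u v huv
  have h2 := h.sub_le u v huv
  set q := ‖u - x‖ ^ 2 + ‖v - y‖ ^ 2 with hq
  have h3 : inner ℝ (g₁ u v) (u - x) ≤ ‖g₁ u v‖ ^ 2 / (2 * m) + m / 2 * ‖u - x‖ ^ 2 := by
    refine (real_inner_le_norm _ _).trans ?_
    have : 0 ≤ (‖g₁ u v‖ - m * ‖u - x‖) ^ 2 / (2 * m) := by positivity
    have e : (‖g₁ u v‖ - m * ‖u - x‖) ^ 2 / (2 * m)
      = ‖g₁ u v‖ ^ 2 / (2 * m) + m / 2 * ‖u - x‖ ^ 2 - ‖g₁ u v‖ * ‖u - x‖ := by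
      field_simp; ring
    linarith
  have h4 : inner ℝ (g₂ u v) (v - y) ≤ ‖g₂ u v‖ ^ 2 / (2 * m) + m / 2 * ‖v - y‖ ^ 2 := by
    refine (real_inner_le_norm _ _).trans ?_
    have : 0 ≤ (‖g₂ u v‖ - m * ‖v - y‖) ^ 2 / (2 * m) := by positivity
    have e : (‖g₂ u v‖ - m * ‖v - y‖) ^ 2 / (2 * m)
      = ‖g₂ u v‖ ^ 2 / (2 * m) + m / 2 * ‖v - y‖ ^ 2 - ‖g₂ u v‖ * ‖v - y‖ := by
      field_simp; ring
    linarith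
  have h5 : m / 2 * q - ς ≤ (‖g₁ u v‖ ^ 2 + ‖g₂ u v‖ ^ 2) / (2 * m) := by
    rw [add_div, hq]
    linarith
  rw [le_div_iff₀ (by positivity)] at h5
  refine le_trans ?_ h5
  have h6 : m ^ 2 / Λ * (L u v - L x y) ≤ m ^ 2 / Λ * (Λ * q + ς) := by gcongr
  have e : m ^ 2 / Λ * (Λ * q + ς) - m ^ 2 / Λ * ((1 + 2 * Λ / m) * ς)
      = (m / 2 * q - ς) * (2 * m) := by
    field_simp
    ring
  linarith

/-- One round of alternating gradient descent from a point of the half-radius ball that does not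
increase `L` beyond `l`, where `l` is so small that the sublevel set stays away from the boundary
of the ball. -/
lemma step_mem (h : DescentLandscape L g₁ g₂ x y R m Λ ς) (hη₁ : η ≤ η₁) (hη₂ : η ≤ η₂)
    (hη : 0 < η) (hη₁' : Λ * η₁ ≤ R / 4) (hη₂' : Λ * η₂ ≤ R / 4) {l : ℝ}
    (hl : l + ς ≤ m * (R ^ 2 / 4)) {u : E₁} {v : E₂}
    (huv : ‖u - x‖ ^ 2 + ‖v - y‖ ^ 2 ≤ R ^ 2 / 4) (hL : L u v - L x y ≤ l) :
    ‖u - η₁ • g₁ u v - x‖ ^ 2 + ‖v - η₂ • g₂ (u - η₁ • g₁ u v) v - y‖ ^ 2 ≤ R ^ 2 / 4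
    ∧ L (u - η₁ • g₁ u v) (v - η₂ • g₂ (u - η₁ • g₁ u v) v) ≤ L u v - η / 4 * (m ^ 2 / Λ *
      (L u v - L x y - (1 + 2 * Λ / m) * ς))
    ∧ L (u - η₁ • g₁ u v) (v - η₂ • g₂ (u - η₁ • g₁ u v) v) ≤ L u v := by
  have hR := h.radius_pos
  have hR1 := h.radius_le
  have huv' : ‖u - x‖ ^ 2 + ‖v - y‖ ^ 2 ≤ R ^ 2 := by nlinarith
  obtain ⟨hu, hv⟩ := h.norm_sub_le_one huv'
  set u' := u - η₁ • g₁ u v with hu'_def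
  have key {s c : ℝ} (hs : 0 ≤ s) (hc : 0 ≤ c) (hcR : c ≤ R / 4) :
      (s + c) ^ 2 ≤ 2 * s ^ 2 + R ^ 2 / 8 := by
    nlinarith [sq_nonneg (s - c)]
  have hu1 : ‖u' - x‖ ≤ ‖u - x‖ + η₁ * ‖g₁ u v‖ := by
    have : u' - x = (u - x) - η₁ • g₁ u v := by rw [hu'_def]; abel
    rw [this]
    refine (norm_sub_le _ _).trans_eq ?_
    rw [norm_smul, Real.norm_of_nonneg (hη.le.trans hη₁)]
  have hc1 : η₁ * ‖g₁ u v‖ ≤ R / 4 := by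
    have := mul_le_mul_of_nonneg_left (h.norm_g₁_le u v hu hv) (hη.le.trans hη₁)
    linarith
  have hu2 : ‖u' - x‖ ^ 2 ≤ 2 * ‖u - x‖ ^ 2 + R ^ 2 / 8 :=
    (pow_le_pow_left₀ (norm_nonneg _) hu1 2).trans
      (key (norm_nonneg _) (mul_nonneg (hη.le.trans hη₁) (norm_nonneg _)) hc1)
  have hu3 : ‖u' - x‖ ≤ 1 := by
    refine (h.norm_sub_le_one (u := u') (v := y) ?_).1
    simp
    nlinarith [sq_nonneg ‖v - y‖]
  set v' := v - η₂ • g₂ u' v with hv'_def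
  have hv1 : ‖v' - y‖ ≤ ‖v - y‖ + η₂ * ‖g₂ u' v‖ := by
    have : v' - y = (v - y) - η₂ • g₂ u' v := by rw [hv'_def]; abel
    rw [this]
    refine (norm_sub_le _ _).trans_eq ?_
    rw [norm_smul, Real.norm_of_nonneg (hη.le.trans hη₂)]
  have hc2 : η₂ * ‖g₂ u' v‖ ≤ R / 4 := by
    have := mul_le_mul_of_nonneg_left (h.norm_g₂_le u' v hu3 hv) (hη.le.trans hη₂)
    linarith
  have hv2 : ‖v' - y‖ ^ 2 ≤ 2 * ‖v - y‖ ^ 2 + R ^ 2 / 8 :=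
    (pow_le_pow_left₀ (norm_nonneg _) hv1 2).trans
      (key (norm_nonneg _) (mul_nonneg (hη.le.trans hη₂) (norm_nonneg _)) hc2)
  have hstep := h.step_le hη₁ hη₂ hη (by linarith) (by linarith) hu hv hu3
  have hdec : L u' v' ≤ L u v := hstep.trans (sub_le_self _ (by positivity))
  refine ⟨?_, ?_, hdec⟩
  · have := h.le_sub u' v' (by nlinarith)
    exact le_of_mul_le_mul_left (by linarith) h.m_pos
  · have := mul_le_mul_of_nonneg_left (h.le_norm_sq huv') (by positivity : 0 ≤ η / 4)
    linarith

lemma rate_le_one (h : DescentLandscape L g₁ g₂ x y R m Λ ς) (hη₁ : η ≤ η₁) (hη : 0 < η)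
    (hη₁' : Λ * η₁ ≤ R / 4) : η / 4 * (m ^ 2 / Λ) ≤ 1 := by
  have hm := h.m_pos
  have hΛ : 0 < Λ := one_pos.trans_le h.one_le
  have hR1 := h.radius_le
  have h1 : η * Λ ≤ 1 := by nlinarith
  have h2 : m ^ 2 ≤ Λ ^ 2 := by gcongr; exact h.m_le
  rw [div_mul_div_comm, div_le_one (by positivity)]
  nlinarith

/-- Alternating gradient descent converges linearly to a neighbourhood of `(x, y)` whose squared
radius is of the order of the tolerance. -/
lemma iterate_le (h : DescentLandscape L g₁ g₂ x y R m Λ ς) (hη₁ : η ≤ η₁) (hη₂ : η ≤ η₂)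
    (hη : 0 < η) (hη₁' : Λ * η₁ ≤ R / 4) (hη₂' : Λ * η₂ ≤ R / 4) {p : ℕ → E₁ × E₂}
    (hp₁ : ∀ t, (p (t + 1)).1 = (p t).1 - η₁ • g₁ (p t).1 (p t).2)
    (hp₂ : ∀ t, (p (t + 1)).2 = (p t).2 - η₂ • g₂ (p (t + 1)).1 (p t).2)
    {b : ℝ} (hb : ‖(p 0).1 - x‖ ^ 2 + ‖(p 0).2 - y‖ ^ 2 ≤ b ^ 2)
    (hbR : b ^ 2 ≤ R ^ 2 / 4) (hbς : Λ * b ^ 2 + 2 * ς ≤ m * (R ^ 2 / 4)) (T : ℕ) :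
    ‖(p T).1 - x‖ ^ 2 + ‖(p T).2 - y‖ ^ 2
      ≤ ((1 - η / 4 * (m ^ 2 / Λ)) ^ T * (Λ * b ^ 2 + ς) + (2 + 2 * Λ / m) * ς) / m
    ∧ ‖(p T).1 - x‖ ^ 2 + ‖(p T).2 - y‖ ^ 2 ≤ R ^ 2 / 4 := by
  have hm := h.m_pos
  have hΛ : 0 < Λ := one_pos.trans_le h.one_le
  have hς := h.tol_nonneg
  have hR := h.radius_pos
  have hR1 := h.radius_le
  set κ := η / 4 * (m ^ 2 / Λ) with hκ
  have hκ1 : κ ≤ 1 := h.rate_le_one hη₁ hη hη₁'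
  set C := (1 + 2 * Λ / m) * ς with hC
  have hC0 : 0 ≤ C := by positivity
  have main : ∀ t, ‖(p t).1 - x‖ ^ 2 + ‖(p t).2 - y‖ ^ 2 ≤ R ^ 2 / 4
      ∧ L (p t).1 (p t).2 - L x y ≤ Λ * b ^ 2 + ς
      ∧ L (p t).1 (p t).2 - L x y - C ≤ (1 - κ) ^ t * (Λ * b ^ 2 + ς) := by
    intro t
    induction t with
    | zero =>
      have h0 := h.sub_le (p 0).1 (p 0).2 (by nlinarith)
      have h1 : L (p 0).1 (p 0).2 - L x y ≤ Λ * b ^ 2 + ς := h0.trans (by gcongr)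
      exact ⟨hb.trans hbR, h1, by simp; linarith⟩
    | succ t ih =>
      obtain ⟨i1, i2, i3⟩ := ih
      have hs := h.step_mem hη₁ hη₂ hη hη₁' hη₂' (l := Λ * b ^ 2 + ς) (by linarith) i1 i2
      rw [← hp₁, ← hp₂] at hs
      obtain ⟨s1, s2, s3⟩ := hs
      refine ⟨s1, by linarith, ?_⟩
      have := mul_le_mul_of_nonneg_left i3 (by linarith : 0 ≤ 1 - κ)
      rw [pow_succ]
      have e : η / 4 * (m ^ 2 / Λ * (L (p t).1 (p t).2 - L x y - C))
        = κ * (L (p t).1 (p t).2 - L x y - C) := by rw [hκ]; ring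
      rw [e] at s2
      nlinarith
  obtain ⟨m1, -, m3⟩ := main T
  refine ⟨?_, m1⟩
  have := h.le_sub (p T).1 (p T).2 (by nlinarith)
  rw [le_div_iff₀ hm]
  have e : (2 + 2 * Λ / m) * ς = C + ς := by rw [hC]; ring
  rw [e]
  linarith

end DescentLandscape

end AlternatingDescent

/-! ### Concentration of empirical means -/

/-- The empirical mean of `f` over a dataset. -/
def empMean {Ω : Type*} {n : ℕ} (data : Fin n → Ω) (f : Ω → ℝ) : ℝ :=
  (1 / (n : ℝ)) * ∑ i, f (data i)

section EmpMean

variable {Ω : Type*} {n : ℕ} (data : Fin n → Ω)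

lemma empMean_add (f g : Ω → ℝ) :
    empMean data (fun o => f o + g o) = empMean data f + empMean data g := by
  simp [empMean, Finset.sum_add_distrib, mul_add]

lemma empMean_sub (f g : Ω → ℝ) :
    empMean data (fun o => f o - g o) = empMean data f - empMean data g := by
  simp [empMean, Finset.sum_sub_distrib, mul_sub]

lemma empMean_const_mul (c : ℝ) (f : Ω → ℝ) :
    empMean data (fun o => c * f o) = c * empMean data f := by
  simp only [empMean, ← Finset.mul_sum]
  ring

lemma empMean_sum {ι : Type*} (s : Finset ι) (f : ι → Ω → ℝ) :
    empMean data (fun o => ∑ k ∈ s, f k o) = ∑ k ∈ s, empMean data (f k) := by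
  simp only [empMean, ← Finset.mul_sum]
  rw [Finset.sum_comm]

lemma empMean_mono {f g : Ω → ℝ} (h : ∀ o, f o ≤ g o) : empMean data f ≤ empMean data g :=
  mul_le_mul_of_nonneg_left (Finset.sum_le_sum fun i _ => h (data i)) (by positivity)

lemma empMean_le {f : Ω → ℝ} {B : ℝ} (hB : 0 ≤ B) (h : ∀ o, f o ≤ B) : empMean data f ≤ B := by
  rcases Nat.eq_zero_or_pos n with rfl | hn
  · simpa [empMean] using hB
  · refine (empMean_mono data h).trans_eq ?_
    have : (n : ℝ) ≠ 0 := by positivity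
    simp [empMean]
    field_simp

lemma abs_empMean_le {f : Ω → ℝ} {B : ℝ} (hB : 0 ≤ B) (h : ∀ o, |f o| ≤ B) :
    |empMean data f| ≤ B := by
  refine abs_le.2 ⟨?_, empMean_le data hB fun o => (abs_le.1 (h o)).2⟩
  have := empMean_le data (f := fun o => (-1) * f o) hB fun o => by
    linarith [(abs_le.1 (h o)).1]
  rw [empMean_const_mul] at this
  linarith

lemma measurable_empMean [MeasurableSpace Ω] {f : Ω → ℝ} (hf : Measurable f) :
    Measurable fun data : Fin n → Ω => empMean data f := by
  unfold empMean
  fun_prop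

end EmpMean

section Chebyshev

variable {Ω : Type*} [MeasurableSpace Ω] (D : Measure Ω) [IsProbabilityMeasure D]

/-- Chebyshev's inequality for the empirical mean of a bounded function. -/
lemma measureReal_empMean_sub_integral_ge_le {n : ℕ} (hn : 0 < n) {f : Ω → ℝ} (hf : Measurable f)
    {B : ℝ} (hB : ∀ o, |f o| ≤ B) {t : ℝ} (ht : 0 < t) :
    (Measure.pi fun _ : Fin n => D).real {data | t ≤ |empMean data f - ∫ o, f o ∂D|}
      ≤ B ^ 2 / (n * t ^ 2) := by
  set P := Measure.pi fun _ : Fin n => D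
  have hn' : (n : ℝ) ≠ 0 := by positivity
  have hL : MemLp f 2 D := MemLp.of_bound hf.aestronglyMeasurable B (.of_forall hB)
  have hLi (i : Fin n) : MemLp (fun data : Fin n → Ω => f (data i)) 2 P :=
    MemLp.of_bound (hf.comp (measurable_pi_apply i)).aestronglyMeasurable B
      (.of_forall fun data => hB (data i))
  have hL' : MemLp (fun data : Fin n → Ω => empMean data f) 2 P :=
    MemLp.of_bound (measurable_empMean hf).aestronglyMeasurable B
      (.of_forall fun data => abs_empMean_le data ((abs_nonneg _).trans (hB (data ⟨0, hn⟩))) hB)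
  have hmean : ∫ data, empMean data f ∂P = ∫ o, f o ∂D := by
    simp only [empMean, integral_const_mul]
    rw [integral_finsetSum _ fun i _ => (hLi i).integrable (by norm_num)]
    have (i : Fin n) : ∫ data, f (data i) ∂P = ∫ o, f o ∂D :=
      integral_comp_eval (μ := fun _ : Fin n => D) (i := i) hf.aestronglyMeasurable
    simp only [this]
    simp
    field_simp
  have hvar : variance (fun data : Fin n → Ω => empMean data f) P ≤ B ^ 2 / n := by
    have h1 : variance (∑ i, fun data : Fin n → Ω => f (data i)) P = n * variance f D := by
      rw [variance_sum_pi (μ := fun _ : Fin n => D) (X := fun _ => f) fun _ => hL]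
      simp
    have h2 : variance f D ≤ B ^ 2 := by
      refine (variance_le_expectation_sq hf.aestronglyMeasurable).trans ?_
      refine (integral_mono (hL.integrable_sq) (integrable_const (B ^ 2))
        fun o => ?_).trans_eq (by simp)
      exact sq_le_sq' (abs_le.1 (hB o)).1 (abs_le.1 (hB o)).2
    have h3 : (fun data : Fin n → Ω => empMean data f)
        = fun data => (1 / (n : ℝ)) * (∑ i, fun data : Fin n → Ω => f (data i)) data := by
      funext data
      simp [empMean]
    rw [h3, variance_const_mul, h1]
    calc (1 / (n : ℝ)) ^ 2 * (n * variance f D) = variance f D / n := by field_simp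
      _ ≤ _ := by gcongr
  have := meas_ge_le_variance_div_sq hL' ht
  rw [hmean] at this
  refine (ENNReal.toReal_mono ENNReal.ofReal_ne_top this).trans ?_
  rw [ENNReal.toReal_ofReal (div_nonneg (variance_nonneg _ _) (by positivity))]
  calc _ ≤ B ^ 2 / n / t ^ 2 := by gcongr
    _ = _ := by rw [div_div]

/-- Finitely many empirical means of bounded functions are simultaneously close to the
expectations. -/
lemma measureReal_forall_empMean_sub_integral_lt_ge {ι : Type*} [Fintype ι] {n : ℕ} (hn : 0 < n)
    {f : ι → Ω → ℝ} (hf : ∀ k, Measurable (f k)) {B : ℝ} (hB : ∀ k o, |f k o| ≤ B) {t : ι → ℝ}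
    (ht : ∀ k, 0 < t k) :
    MeasurableSet {data : Fin n → Ω | ∀ k, |empMean data (f k) - ∫ o, f k o ∂D| < t k} ∧
    1 - ∑ k, B ^ 2 / (n * t k ^ 2) ≤ (Measure.pi fun _ : Fin n => D).real
      {data | ∀ k, |empMean data (f k) - ∫ o, f k o ∂D| < t k} := by
  set P := Measure.pi fun _ : Fin n => D
  have hm : MeasurableSet
      {data : Fin n → Ω | ∀ k, |empMean data (f k) - ∫ o, f k o ∂D| < t k} := by
    rw [Set.ofPred_forall]
    refine .iInter fun k => measurableSet_lt ?_ measurable_const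
    exact ((measurable_empMean (hf k)).sub_const _).abs
  refine ⟨hm, ?_⟩
  have hc : {data : Fin n → Ω | ∀ k, |empMean data (f k) - ∫ o, f k o ∂D| < t k}ᶜ
      = ⋃ k, {data | t k ≤ |empMean data (f k) - ∫ o, f k o ∂D|} := by
    ext data
    simp
  have h1 := probReal_compl_eq_one_sub (μ := P) hm
  have h2 := measureReal_iUnion_fintype_le (μ := P)
    fun k => {data : Fin n → Ω | t k ≤ |empMean data (f k) - ∫ o, f k o ∂D|}
  rw [← hc, h1] at h2
  have h3 := h2.trans (Finset.sum_le_sum fun k _ =>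
    measureReal_empMean_sub_integral_ge_le D hn (hf k) (hB k) (ht k))
  linarith

end Chebyshev

/-! ### The loss near the true parameters -/

section Landscape

variable {X S A : Type*} {d₁ d₂ : ℕ}

lemma abs_sub_label_le {p : ℝ} (h0 : 0 ≤ p) (h1 : p ≤ 1) (c : Bool) : |p - label c| ≤ 1 := by
  cases c <;> simp only [label, if_true, if_false, Bool.false_eq_true] <;>
    exact abs_le.2 ⟨by linarith, by linarith⟩

/-- To bound the norm of a vector it suffices to bound its inner products. -/
lemma norm_le_of_forall_inner_le {E : Type*} [NormedAddCommGroup E] [InnerProductSpace ℝ E]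
    {x : E} {B : ℝ} (hB : 0 ≤ B) (h : ∀ u, inner ℝ x u ≤ B * ‖u‖) : ‖x‖ ≤ B := by
  rcases eq_or_ne x 0 with rfl | hx
  · simpa using hB
  · have := h x
    rw [real_inner_self_eq_norm_mul_norm] at this
    exact le_of_mul_le_mul_right this (norm_pos_iff.2 hx)

lemma hasGradientAt_mean_logisticLoss {E : Type*} [NormedAddCommGroup E] [InnerProductSpace ℝ E]
    [CompleteSpace E] {n : ℕ} (y c : Fin n → ℝ) (a : Fin n → E) (x : E) :
    HasGradientAt (fun x => (1 / (n : ℝ)) * ∑ i, logisticLoss (y i) (c i + inner ℝ x (a i)))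
      ((1 / (n : ℝ)) • ∑ i, (Real.sigmoid (c i + inner ℝ x (a i)) - y i) • a i) x := by
  rw [hasGradientAt_iff_hasFDerivAt]
  have h1 (i : Fin n) : HasFDerivAt (fun x => logisticLoss (y i) (c i + inner ℝ x (a i)))
      ((Real.sigmoid (c i + inner ℝ x (a i)) - y i) • InnerProductSpace.toDual ℝ E (a i)) x := by
    have hm : HasFDerivAt (fun x => c i + inner ℝ x (a i))
        (InnerProductSpace.toDual ℝ E (a i)) x := by
      have e : (fun x => c i + inner ℝ x (a i))
          = fun x => c i + InnerProductSpace.toDual ℝ E (a i) x := by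
        funext x
        rw [InnerProductSpace.toDual_apply_apply, real_inner_comm]
      rw [e]
      exact (InnerProductSpace.toDual ℝ E (a i)).hasFDerivAt.const_add (c i)
    exact (hasDerivAt_logisticLoss (y i) _).comp_hasFDerivAt x hm
  have h2 := (HasFDerivAt.fun_sum (u := Finset.univ) fun i _ => h1 i).const_mul (1 / (n : ℝ))
  have e : InnerProductSpace.toDual ℝ E
      ((1 / (n : ℝ)) • ∑ i, (Real.sigmoid (c i + inner ℝ x (a i)) - y i) • a i)
      = (1 / (n : ℝ)) • ∑ i, (Real.sigmoid (c i + inner ℝ x (a i)) - y i)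
        • InnerProductSpace.toDual ℝ E (a i) := by
    simp only [map_smul, map_sum]
  rw [e]
  exact h2

namespace Features

/-- The logit `σ_γ(x) θᵀ z` of the preference probability. -/
def margin (F : Features X S A d₁ d₂) (θ : Vec d₁) (γ : Vec d₂) (w : Task X S A) : ℝ :=
  F.scale γ w.1 * inner ℝ θ (F.z w)

/-- The derivative of the margin at `(θ, γ)` in the direction `(u, v)`. -/
def tangent (F : Features X S A d₁ d₂) (θ : Vec d₁) (γ : Vec d₂) (u : Vec d₁) (v : Vec d₂)
    (w : Task X S A) : ℝ :=
  F.scale γ w.1 * inner ℝ u (F.z w) + inner ℝ θ (F.z w) * inner ℝ v (F.psi w.1)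

/-- The second-order part of the margin, which is bilinear in the direction `(u, v)`. -/
def bend (F : Features X S A d₁ d₂) (u : Vec d₁) (v : Vec d₂) (w : Task X S A) : ℝ :=
  inner ℝ u (F.z w) * inner ℝ v (F.psi w.1)

/-- The residual `μ(σ_γ(x) θᵀ z) - y`. -/
def residual (F : Features X S A d₁ d₂) (θ : Vec d₁) (γ : Vec d₂) (o : Obs X S A) : ℝ :=
  F.prefProb θ γ o.1 - label o.2

/-- The partial gradient of the loss in `θ`. -/
def gradTheta (F : Features X S A d₁ d₂) {n : ℕ} (data : Fin n → Obs X S A)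
    (θ : Vec d₁) (γ : Vec d₂) : Vec d₁ :=
  (1 / (n : ℝ)) • ∑ i, (F.residual θ γ (data i) * F.scale γ (data i).1.1) • F.z (data i).1

/-- The partial gradient of the loss in `γ`. -/
def gradGamma (F : Features X S A d₁ d₂) {n : ℕ} (data : Fin n → Obs X S A)
    (θ : Vec d₁) (γ : Vec d₂) : Vec d₂ :=
  (1 / (n : ℝ)) • ∑ i, (F.residual θ γ (data i) * inner ℝ θ (F.z (data i).1))
    • F.psi (data i).1.1

/-- A common bound `K ≥ 1` for the feature vectors and for the two factors of the margin at the
parameters `(θ, γ)`. -/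
structure BoundedBy (F : Features X S A d₁ d₂) (θ : Vec d₁) (γ : Vec d₂) (K : ℝ) : Prop where
  one_le : 1 ≤ K
  z_le : ∀ w, ‖F.z w‖ ≤ K
  psi_le : ∀ x, ‖F.psi x‖ ≤ K
  scale_le : ∀ x, |F.scale γ x| ≤ K
  inner_le : ∀ w, |inner ℝ θ (F.z w)| ≤ K

section Identities

variable (F : Features X S A d₁ d₂) (θ θs : Vec d₁) (γ γs : Vec d₂)

lemma prefProb_eq (w : Task X S A) : F.prefProb θ γ w = Real.sigmoid (F.margin θ γ w) := by
  simp [prefProb, margin, reward, z, inner_sub_right]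

lemma obsLoss_eq (o : Obs X S A) :
    F.obsLoss θ γ o = logisticLoss (label o.2) (F.margin θ γ o.1) := by
  simp [obsLoss, logisticLoss, prefProb_eq]

lemma residual_eq (o : Obs X S A) :
    F.residual θ γ o = Real.sigmoid (F.margin θ γ o.1) - label o.2 := by
  rw [residual, prefProb_eq]

lemma weight_eq (w : Task X S A) : F.weight θ γ w = logisticWeight (F.margin θ γ w) := by
  rw [weight, prefProb_eq, logisticWeight]

lemma abs_residual_le (o : Obs X S A) : |F.residual θ γ o| ≤ 1 := by
  rw [residual_eq]
  exact abs_sub_label_le (Real.sigmoid_nonneg _) (Real.sigmoid_le_one _) _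

lemma weight_pos (w : Task X S A) : 0 < F.weight θ γ w := by
  rw [weight_eq]; exact logisticWeight_pos _

lemma weight_le_one (w : Task X S A) : F.weight θ γ w ≤ 1 := by
  rw [weight_eq]; exact logisticWeight_le_one _

lemma scale_eq_add (x : X) : F.scale γ x = F.scale γs x + inner ℝ (γ - γs) (F.psi x) := by
  simp only [scale, inner_sub_left]
  ring

lemma inner_z_eq_add (w : Task X S A) :
    inner ℝ θ (F.z w) = inner ℝ θs (F.z w) + inner ℝ (θ - θs) (F.z w) := by
  simp only [inner_sub_left]
  ring

/-- The margin is a quadratic polynomial in the parameters. -/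
lemma margin_eq_add (w : Task X S A) :
    F.margin θ γ w = F.margin θs γs w
      + (F.tangent θs γs (θ - θs) (γ - γs) w + F.bend (θ - θs) (γ - γs) w) := by
  rw [margin, scale_eq_add F γ γs, inner_z_eq_add F θ θs, margin, tangent, bend]
  ring

lemma tangent_eq_add (u : Vec d₁) (v : Vec d₂) (w : Task X S A) :
    F.tangent θ γ u v w = F.tangent θs γs u v w + (F.bend u (γ - γs) w + F.bend (θ - θs) v w) := by
  rw [tangent, scale_eq_add F γ γs, inner_z_eq_add F θ θs, tangent, bend, bend]
  ring

lemma loss_eq {n : ℕ} (data : Fin n → Obs X S A) :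
    F.loss data θ γ = empMean data (F.obsLoss θ γ) := rfl

lemma inner_gradTheta {n : ℕ} (data : Fin n → Obs X S A) (u : Vec d₁) :
    inner ℝ (F.gradTheta data θ γ) u
      = empMean data fun o => F.residual θ γ o * (F.scale γ o.1.1 * inner ℝ u (F.z o.1)) := by
  rw [gradTheta, real_inner_smul_left, sum_inner, empMean]
  simp only [real_inner_comm u, real_inner_smul_right, mul_assoc]

lemma inner_gradGamma {n : ℕ} (data : Fin n → Obs X S A) (v : Vec d₂) :
    inner ℝ (F.gradGamma data θ γ) v
      = empMean data fun o => F.residual θ γ o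
        * (inner ℝ θ (F.z o.1) * inner ℝ v (F.psi o.1.1)) := by
  rw [gradGamma, real_inner_smul_left, sum_inner, empMean]
  simp only [real_inner_comm v, real_inner_smul_right, mul_assoc]

lemma hasDerivAt_margin_theta (u : Vec d₁) (w : Task X S A) (t : ℝ) :
    HasDerivAt (fun t : ℝ => F.margin (θ + t • u) γ w) (F.scale γ w.1 * inner ℝ u (F.z w)) t := by
  have : (fun t : ℝ => F.margin (θ + t • u) γ w)
      = fun t => F.margin θ γ w + t * (F.scale γ w.1 * inner ℝ u (F.z w)) := by
    funext t
    simp only [margin, inner_add_left, inner_smul_left]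
    simp
    ring
  rw [this]
  simpa using ((hasDerivAt_id t).mul_const (F.scale γ w.1 * inner ℝ u (F.z w))).const_add
    (F.margin θ γ w)

lemma hasDerivAt_margin_gamma (v : Vec d₂) (w : Task X S A) (t : ℝ) :
    HasDerivAt (fun t : ℝ => F.margin θ (γ + t • v) w)
      (inner ℝ θ (F.z w) * inner ℝ v (F.psi w.1)) t := by
  have : (fun t : ℝ => F.margin θ (γ + t • v) w)
      = fun t => F.margin θ γ w + t * (inner ℝ θ (F.z w) * inner ℝ v (F.psi w.1)) := by
    funext t
    simp only [margin, scale, inner_add_left, inner_smul_left]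
    simp
    ring
  rw [this]
  simpa using ((hasDerivAt_id t).mul_const (inner ℝ θ (F.z w) * inner ℝ v (F.psi w.1))).const_add
    (F.margin θ γ w)

lemma gradient_loss_theta {n : ℕ} (data : Fin n → Obs X S A) :
    gradient (fun θ => F.loss data θ γ) θ = F.gradTheta data θ γ := by
  have := (hasGradientAt_mean_logisticLoss (fun i => label (data i).2) (fun _ => 0)
    (fun i => F.scale γ (data i).1.1 • F.z (data i).1) θ).gradient
  simp only [zero_add, real_inner_smul_right] at this
  simp only [loss, obsLoss_eq, gradTheta, residual_eq, mul_smul]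
  exact this

lemma gradient_loss_gamma {n : ℕ} (data : Fin n → Obs X S A) :
    gradient (fun γ => F.loss data θ γ) γ = F.gradGamma data θ γ := by
  have := (hasGradientAt_mean_logisticLoss (fun i => label (data i).2)
    (fun i => inner ℝ θ (F.z (data i).1) * F.psi0 (data i).1.1)
    (fun i => inner ℝ θ (F.z (data i).1) • F.psi (data i).1.1) γ).gradient
  simp only [real_inner_smul_right, ← mul_add] at this
  have hm (γ : Vec d₂) (w : Task X S A) :
      F.margin θ γ w = inner ℝ θ (F.z w) * (F.psi0 w.1 + inner ℝ γ (F.psi w.1)) := by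
    rw [margin, scale, mul_comm]
  simp only [loss, obsLoss_eq, gradGamma, residual_eq, mul_smul, hm]
  exact this

end Identities

namespace BoundedBy

variable {F : Features X S A d₁ d₂} {θs θ : Vec d₁} {γs γ : Vec d₂} {K : ℝ}

lemma pos (h : F.BoundedBy θs γs K) : 0 < K := one_pos.trans_le h.one_le

lemma abs_inner_z_le (h : F.BoundedBy θs γs K) (u : Vec d₁) (w : Task X S A) :
    |inner ℝ u (F.z w)| ≤ ‖u‖ * K :=
  (abs_real_inner_le_norm _ _).trans (by gcongr; exact h.z_le w)

lemma abs_inner_psi_le (h : F.BoundedBy θs γs K) (v : Vec d₂) (x : X) :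
    |inner ℝ v (F.psi x)| ≤ ‖v‖ * K :=
  (abs_real_inner_le_norm _ _).trans (by gcongr; exact h.psi_le x)

lemma abs_scale_le (h : F.BoundedBy θs γs K) (hγ : ‖γ - γs‖ ≤ 1) (x : X) :
    |F.scale γ x| ≤ 2 * K := by
  rw [scale_eq_add F γ γs]
  refine (abs_add_le _ _).trans ?_
  have h1 := h.abs_inner_psi_le (γ - γs) x
  have h2 : ‖γ - γs‖ * K ≤ 1 * K := mul_le_mul_of_nonneg_right hγ h.pos.le
  linarith [h.scale_le x]

lemma abs_inner_z_le' (h : F.BoundedBy θs γs K) (hθ : ‖θ - θs‖ ≤ 1) (w : Task X S A) :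
    |inner ℝ θ (F.z w)| ≤ 2 * K := by
  rw [inner_z_eq_add F θ θs]
  refine (abs_add_le _ _).trans ?_
  have h1 := h.abs_inner_z_le (θ - θs) w
  have h2 : ‖θ - θs‖ * K ≤ 1 * K := mul_le_mul_of_nonneg_right hθ h.pos.le
  linarith [h.inner_le w]

lemma abs_tangent_le (h : F.BoundedBy θs γs K) {u : Vec d₁} {v : Vec d₂} {ρ : ℝ} (hu : ‖u‖ ≤ ρ)
    (hv : ‖v‖ ≤ ρ) (w : Task X S A) : |F.tangent θs γs u v w| ≤ 2 * K ^ 2 * ρ := by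
  have hK := h.pos
  rw [tangent]
  refine (abs_add_le _ _).trans ?_
  rw [abs_mul, abs_mul]
  have h1 : |F.scale γs w.1| * |inner ℝ u (F.z w)| ≤ K * (ρ * K) := by
    gcongr
    · exact h.scale_le _
    · exact (h.abs_inner_z_le u w).trans (by gcongr)
  have h2 : |inner ℝ θs (F.z w)| * |inner ℝ v (F.psi w.1)| ≤ K * (ρ * K) := by
    gcongr
    · exact h.inner_le _
    · exact (h.abs_inner_psi_le v w.1).trans (by gcongr)
  linarith

lemma abs_bend_le (h : F.BoundedBy θs γs K) {u : Vec d₁} {v : Vec d₂} {ρ r : ℝ} (hu : ‖u‖ ≤ ρ)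
    (hv : ‖v‖ ≤ r) (w : Task X S A) : |F.bend u v w| ≤ K ^ 2 * (ρ * r) := by
  have hK := h.pos
  have hρ := (norm_nonneg _).trans hu
  rw [bend, abs_mul]
  have : |inner ℝ u (F.z w)| * |inner ℝ v (F.psi w.1)| ≤ (ρ * K) * (r * K) := by
    gcongr
    · exact (h.abs_inner_z_le u w).trans (by gcongr)
    · exact (h.abs_inner_psi_le v w.1).trans (by gcongr)
  linarith

variable {n : ℕ} (data : Fin n → Obs X S A)

lemma norm_gradTheta_le (h : F.BoundedBy θs γs K) (hγ : ‖γ - γs‖ ≤ 1) :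
    ‖F.gradTheta data θ γ‖ ≤ 2 * K ^ 2 := by
  have hK := h.pos
  refine norm_le_of_forall_inner_le (by positivity) fun u => ?_
  rw [inner_gradTheta]
  refine empMean_le data (by positivity) fun o => (le_abs_self _).trans ?_
  rw [abs_mul, abs_mul]
  have : |F.residual θ γ o| * (|F.scale γ o.1.1| * |inner ℝ u (F.z o.1)|)
      ≤ 1 * (2 * K * (‖u‖ * K)) := by
    gcongr
    · exact F.abs_residual_le θ γ o
    · exact h.abs_scale_le hγ _
    · exact h.abs_inner_z_le _ _
  linarith

lemma norm_gradGamma_le (h : F.BoundedBy θs γs K) (hθ : ‖θ - θs‖ ≤ 1) :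
    ‖F.gradGamma data θ γ‖ ≤ 2 * K ^ 2 := by
  have hK := h.pos
  refine norm_le_of_forall_inner_le (by positivity) fun u => ?_
  rw [inner_gradGamma]
  refine empMean_le data (by positivity) fun o => (le_abs_self _).trans ?_
  rw [abs_mul, abs_mul]
  have : |F.residual θ γ o| * (|inner ℝ θ (F.z o.1)| * |inner ℝ u (F.psi o.1.1)|)
      ≤ 1 * (2 * K * (‖u‖ * K)) := by
    gcongr
    · exact F.abs_residual_le θ γ o
    · exact h.abs_inner_z_le' hθ _
    · exact h.abs_inner_psi_le _ _
  linarith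

lemma loss_theta_descent (h : F.BoundedBy θs γs K) (hγ : ‖γ - γs‖ ≤ 1) (θ' : Vec d₁) :
    F.loss data θ' γ ≤ F.loss data θ γ + inner ℝ (F.gradTheta data θ γ) (θ' - θ)
      + 4 * K ^ 4 * ‖θ' - θ‖ ^ 2 := by
  have hK := h.pos
  rw [inner_gradTheta, loss_eq, loss_eq, ← sub_le_iff_le_add', ← empMean_add, ← empMean_sub]
  refine empMean_le data (by positivity) fun o => ?_
  have e : F.margin θ' γ o.1 - F.margin θ γ o.1 = F.scale γ o.1.1 * inner ℝ (θ' - θ) (F.z o.1) := by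
    simp only [margin, inner_sub_left]
    ring
  have h1 := logisticLoss_le (label o.2) (F.margin θ γ o.1) (F.margin θ' γ o.1)
  rw [← obsLoss_eq, ← obsLoss_eq, ← residual_eq, e] at h1
  have h2 : |F.scale γ o.1.1 * inner ℝ (θ' - θ) (F.z o.1)| ≤ 2 * K * (‖θ' - θ‖ * K) := by
    rw [abs_mul]
    gcongr
    · exact h.abs_scale_le hγ _
    · exact h.abs_inner_z_le _ _
  have h3 := pow_le_pow_left₀ (abs_nonneg _) h2 2
  rw [sq_abs] at h3
  linarith

lemma loss_gamma_descent (h : F.BoundedBy θs γs K) (hθ : ‖θ - θs‖ ≤ 1) (γ' : Vec d₂) :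
    F.loss data θ γ' ≤ F.loss data θ γ + inner ℝ (F.gradGamma data θ γ) (γ' - γ)
      + 4 * K ^ 4 * ‖γ' - γ‖ ^ 2 := by
  have hK := h.pos
  rw [inner_gradGamma, loss_eq, loss_eq, ← sub_le_iff_le_add', ← empMean_add, ← empMean_sub]
  refine empMean_le data (by positivity) fun o => ?_
  have e : F.margin θ γ' o.1 - F.margin θ γ o.1
      = inner ℝ θ (F.z o.1) * inner ℝ (γ' - γ) (F.psi o.1.1) := by
    simp only [margin, scale, inner_sub_left]
    ring
  have h1 := logisticLoss_le (label o.2) (F.margin θ γ o.1) (F.margin θ γ' o.1)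
  rw [← obsLoss_eq, ← obsLoss_eq, ← residual_eq, e] at h1
  have h2 : |inner ℝ θ (F.z o.1) * inner ℝ (γ' - γ) (F.psi o.1.1)| ≤ 2 * K * (‖γ' - γ‖ * K) := by
    rw [abs_mul]
    gcongr
    · exact h.abs_inner_z_le' hθ _
    · exact h.abs_inner_psi_le _ _
  have h3 := pow_le_pow_left₀ (abs_nonneg _) h2 2
  rw [sq_abs] at h3
  linarith

lemma norm_gradGamma_sub_le (h : F.BoundedBy θs γs K) {θ' : Vec d₁} (hθ : ‖θ - θs‖ ≤ 1)
    (hγ : ‖γ - γs‖ ≤ 1) :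
    ‖F.gradGamma data θ' γ - F.gradGamma data θ γ‖ ≤ 5 * K ^ 4 * ‖θ' - θ‖ := by
  have hK := h.pos
  refine norm_le_of_forall_inner_le (by positivity) fun v => ?_
  rw [inner_sub_left, inner_gradGamma, inner_gradGamma, ← empMean_sub]
  refine empMean_le data (by positivity) fun o => ?_
  have e : F.residual θ' γ o * (inner ℝ θ' (F.z o.1) * inner ℝ v (F.psi o.1.1))
      - F.residual θ γ o * (inner ℝ θ (F.z o.1) * inner ℝ v (F.psi o.1.1))
      = (F.residual θ' γ o * inner ℝ (θ' - θ) (F.z o.1)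
        + (F.residual θ' γ o - F.residual θ γ o) * inner ℝ θ (F.z o.1))
        * inner ℝ v (F.psi o.1.1) := by
    rw [inner_sub_left]; ring
  rw [e]
  refine (le_abs_self _).trans ?_
  have h1 : |F.residual θ' γ o - F.residual θ γ o| ≤ 2 * K * (‖θ' - θ‖ * K) := by
    rw [residual_eq, residual_eq, sub_sub_sub_cancel_right]
    refine (abs_sigmoid_sub_le _ _).trans ?_
    have e : F.margin θ' γ o.1 - F.margin θ γ o.1
        = F.scale γ o.1.1 * inner ℝ (θ' - θ) (F.z o.1) := by
      simp only [margin, inner_sub_left]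
      ring
    rw [e, abs_mul]
    gcongr
    · exact h.abs_scale_le hγ _
    · exact h.abs_inner_z_le _ _
  have h2 : |F.residual θ' γ o * inner ℝ (θ' - θ) (F.z o.1)
        + (F.residual θ' γ o - F.residual θ γ o) * inner ℝ θ (F.z o.1)|
      ≤ 1 * (‖θ' - θ‖ * K) + 2 * K * (‖θ' - θ‖ * K) * (2 * K) := by
    refine (abs_add_le _ _).trans ?_
    rw [abs_mul, abs_mul]
    gcongr
    · exact F.abs_residual_le θ' γ o
    · exact h.abs_inner_z_le _ _
    · exact h.abs_inner_z_le' hθ _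
  rw [abs_mul]
  have h3 := mul_le_mul h2 (h.abs_inner_psi_le v o.1.1) (abs_nonneg _) (by positivity)
  refine h3.trans ?_
  have h4 : K ^ 2 ≤ K ^ 4 := pow_le_pow_right₀ h.one_le (by norm_num)
  have h5 : K ^ 2 * (‖θ' - θ‖ * ‖v‖) ≤ K ^ 4 * (‖θ' - θ‖ * ‖v‖) := by gcongr
  nlinarith

end BoundedBy

/-- The linear part of the empirical loss at `(θs, γs)` in the direction `(u, v)`. -/
def score (F : Features X S A d₁ d₂) {n : ℕ} (data : Fin n → Obs X S A) (θs : Vec d₁) (γs : Vec d₂)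
    (u : Vec d₁) (v : Vec d₂) : ℝ :=
  empMean data fun o => F.residual θs γs o * F.tangent θs γs u v o.1

/-- The quadratic form of the Gauss-Newton part of the empirical Hessian. -/
def gaussNewton (F : Features X S A d₁ d₂) {n : ℕ} (data : Fin n → Obs X S A)
    (θs : Vec d₁) (γs : Vec d₂) (u : Vec d₁) (v : Vec d₂) : ℝ :=
  empMean data fun o => F.weight θs γs o.1 * F.tangent θs γs u v o.1 ^ 2

/-- The part of the empirical Hessian that stems from the bilinearity of the margin; its
expectation vanishes at the true parameters. -/
def noise (F : Features X S A d₁ d₂) {n : ℕ} (data : Fin n → Obs X S A) (θs : Vec d₁) (γs : Vec d₂)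
    (u : Vec d₁) (v : Vec d₂) : ℝ :=
  empMean data fun o => F.residual θs γs o * F.bend u v o.1

namespace BoundedBy

variable {F : Features X S A d₁ d₂} {θs θ : Vec d₁} {γs γ : Vec d₂} {K ρ : ℝ}
  {n : ℕ} (data : Fin n → Obs X S A)

/-- Second-order expansion of the empirical loss. -/
lemma abs_loss_expansion_le (h : F.BoundedBy θs γs K) (hθ : ‖θ - θs‖ ≤ ρ) (hγ : ‖γ - γs‖ ≤ ρ)
    (hρ : ρ ≤ 1) :
    |F.loss data θ γ - F.loss data θs γs - F.score data θs γs (θ - θs) (γ - γs)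
      - (1 / 2) * (F.gaussNewton data θs γs (θ - θs) (γ - γs)
        + 2 * F.noise data θs γs (θ - θs) (γ - γs))| ≤ 50 * K ^ 6 * ρ ^ 3 := by
  have hK := h.pos
  have hρ0 := (norm_nonneg _).trans hθ
  rw [loss_eq, loss_eq, score, gaussNewton, noise, ← empMean_const_mul, ← empMean_add,
    ← empMean_const_mul, ← empMean_sub, ← empMean_sub, ← empMean_sub]
  refine abs_empMean_le data (by positivity) fun o => ?_
  have := abs_logisticLoss_expansion_le (y := label o.2) (v := F.margin θs γs o.1) h.one_le hρ0 hρ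
    (h.abs_tangent_le hθ hγ o.1) ((h.abs_bend_le hθ hγ o.1).trans_eq (by ring))
  rw [← margin_eq_add, ← obsLoss_eq, ← obsLoss_eq, ← residual_eq, ← weight_eq] at this
  convert this using 2
  ring

/-- Expansion of the directional derivative of the empirical loss. -/
lemma abs_gradient_expansion_le (h : F.BoundedBy θs γs K) (hθ : ‖θ - θs‖ ≤ ρ) (hγ : ‖γ - γs‖ ≤ ρ)
    (hρ : ρ ≤ 1) :
    |inner ℝ (F.gradTheta data θ γ) (θ - θs) + inner ℝ (F.gradGamma data θ γ) (γ - γs)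
      - F.score data θs γs (θ - θs) (γ - γs)
      - (F.gaussNewton data θs γs (θ - θs) (γ - γs)
        + 2 * F.noise data θs γs (θ - θs) (γ - γs))| ≤ 50 * K ^ 6 * ρ ^ 3 := by
  have hK := h.pos
  have hρ0 := (norm_nonneg _).trans hθ
  rw [inner_gradTheta, inner_gradGamma, score, gaussNewton, noise, ← empMean_const_mul,
    ← empMean_add, ← empMean_add, ← empMean_sub, ← empMean_sub]
  refine abs_empMean_le data (by positivity) fun o => ?_
  have := abs_residual_expansion_le (y := label o.2) (v := F.margin θs γs o.1) h.one_le hρ0 hρ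
    (h.abs_tangent_le hθ hγ o.1) ((h.abs_bend_le hθ hγ o.1).trans_eq (by ring))
  rw [← margin_eq_add, ← residual_eq, ← residual_eq, ← weight_eq] at this
  have e : F.tangent θs γs (θ - θs) (γ - γs) o.1 + 2 * F.bend (θ - θs) (γ - γs) o.1
      = F.tangent θ γ (θ - θs) (γ - γs) o.1 := by
    rw [tangent_eq_add F θ θs γ γs]
    ring
  rw [e, tangent, mul_add] at this
  exact this

/-- The Gauss-Newton form is Lipschitz in the parameters. -/
lemma abs_gaussNewton_sub_le (h : F.BoundedBy θs γs K) (hθ : ‖θ - θs‖ ≤ ρ) (hγ : ‖γ - γs‖ ≤ ρ)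
    (hρ : ρ ≤ 1) {x : Vec d₁} {y : Vec d₂} {r : ℝ} (hx : ‖x‖ ≤ r) (hy : ‖y‖ ≤ r) :
    |F.gaussNewton data θ γ x y - F.gaussNewton data θs γs x y| ≤ 24 * K ^ 6 * ρ * r ^ 2 := by
  have hK := h.pos
  have hρ0 := (norm_nonneg _).trans hθ
  have hr0 := (norm_nonneg _).trans hx
  rw [gaussNewton, gaussNewton, ← empMean_sub]
  refine abs_empMean_le data (by positivity) fun o => ?_
  have hw : |F.weight θ γ o.1 - F.weight θs γs o.1| ≤ 3 * K ^ 2 * ρ := by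
    rw [weight_eq, weight_eq]
    refine (abs_logisticWeight_sub_le _ _).trans ?_
    rw [margin_eq_add F θ θs γ γs, add_sub_cancel_left]
    refine (abs_add_le _ _).trans ?_
    have h1 := h.abs_tangent_le hθ hγ o.1
    have h2 := h.abs_bend_le hθ hγ o.1
    have h3 : K ^ 2 * (ρ * ρ) ≤ K ^ 2 * (ρ * 1) := by gcongr
    linarith
  have hd : |F.bend x (γ - γs) o.1 + F.bend (θ - θs) y o.1| ≤ 2 * K ^ 2 * (ρ * r) := by
    refine (abs_add_le _ _).trans ?_
    have h1 := h.abs_bend_le hx hγ o.1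
    have h2 := h.abs_bend_le hθ hy o.1
    linarith
  have ht := h.abs_tangent_le hx hy o.1
  set d := F.bend x (γ - γs) o.1 + F.bend (θ - θs) y o.1
  set t := F.tangent θs γs x y o.1
  have hs : |d + 2 * t| ≤ 6 * K ^ 2 * r := by
    refine (abs_add_le _ _).trans ?_
    rw [abs_mul, abs_two]
    have h3 : 2 * K ^ 2 * (ρ * r) ≤ 2 * K ^ 2 * (1 * r) := by gcongr
    linarith
  rw [tangent_eq_add F θ θs γ γs]
  have e : F.weight θ γ o.1 * (t + d) ^ 2 - F.weight θs γs o.1 * t ^ 2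
      = (F.weight θ γ o.1 - F.weight θs γs o.1) * t ^ 2
        + F.weight θ γ o.1 * (d * (d + 2 * t)) := by ring
  rw [e]
  refine (abs_add_le _ _).trans ?_
  rw [abs_mul, abs_mul, abs_mul, abs_of_pos (F.weight_pos θ γ o.1), abs_pow]
  have h1 : |F.weight θ γ o.1 - F.weight θs γs o.1| * |t| ^ 2
      ≤ 3 * K ^ 2 * ρ * (2 * K ^ 2 * r) ^ 2 := by gcongr
  have h2 : F.weight θ γ o.1 * (|d| * |d + 2 * t|)
      ≤ 1 * (2 * K ^ 2 * (ρ * r) * (6 * K ^ 2 * r)) := by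
    gcongr
    exact F.weight_le_one θ γ o.1
  refine (add_le_add h1 h2).trans ?_
  have h3 : K ^ 4 * (ρ * r ^ 2) ≤ K ^ 6 * (ρ * r ^ 2) := by
    gcongr
    · exact h.one_le
    · norm_num
  nlinarith

end BoundedBy
end Features
end Landscape

/-! ### The information matrix -/

section Information

variable {X S A : Type*} {d₁ d₂ : ℕ}

namespace Features

section Derivatives

variable (F : Features X S A d₁ d₂) (θ : Vec d₁) (γ : Vec d₂) (o : Obs X S A)

/-- The gradient of the margin in `(θ, γ)`, in coordinates. -/
def feat (w : Task X S A) : Fin d₁ ⊕ Fin d₂ → ℝ :=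
  Sum.elim (fun j => F.scale γ w.1 * F.z w j) (fun j => inner ℝ θ (F.z w) * F.psi w.1 j)

lemma inner_single_z (j : Fin d₁) (w : Task X S A) :
    inner ℝ (EuclideanSpace.single j (1 : ℝ)) (F.z w) = F.z w j := by
  simp [EuclideanSpace.inner_single_left]

lemma inner_single_psi (j : Fin d₂) (x : X) :
    inner ℝ (EuclideanSpace.single j (1 : ℝ)) (F.psi x) = F.psi x j := by
  simp [EuclideanSpace.inner_single_left]

lemma tangent_eq_sum (u : Vec d₁) (v : Vec d₂) (w : Task X S A) :
    F.tangent θ γ u v w = ∑ k, F.feat θ γ w k * Sum.elim u.ofLp v.ofLp k := by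
  simp only [tangent, feat, Fintype.sum_sum_type, Sum.elim_inl, Sum.elim_inr, PiLp.inner_apply u,
    PiLp.inner_apply v, Finset.mul_sum, mul_assoc]
  simp

lemma bend_eq_sum (u : Vec d₁) (v : Vec d₂) (w : Task X S A) :
    F.bend u v w = ∑ p : Fin d₁ × Fin d₂, (u p.1 * v p.2) * (F.z w p.1 * F.psi w.1 p.2) := by
  simp only [bend, PiLp.inner_apply, Fintype.sum_prod_type, Finset.sum_mul_sum]
  refine Finset.sum_congr rfl fun i _ => Finset.sum_congr rfl fun j _ => ?_
  simp
  ring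

lemma hasDerivAt_residual_theta (u : Vec d₁) :
    HasDerivAt (fun t : ℝ => F.residual (θ + t • u) γ o)
      (F.weight θ γ o.1 * (F.scale γ o.1.1 * inner ℝ u (F.z o.1))) 0 := by
  have h1 := F.hasDerivAt_margin_theta θ γ u o.1 0
  have h2 := (Real.hasDerivAt_sigmoid (F.margin (θ + (0 : ℝ) • u) γ o.1)).comp (0 : ℝ) h1
  rw [zero_smul, add_zero] at h2
  simp only [residual_eq, weight_eq]
  exact h2.sub_const _

lemma hasDerivAt_residual_gamma (v : Vec d₂) :
    HasDerivAt (fun t : ℝ => F.residual θ (γ + t • v) o)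
      (F.weight θ γ o.1 * (inner ℝ θ (F.z o.1) * inner ℝ v (F.psi o.1.1))) 0 := by
  have h1 := F.hasDerivAt_margin_gamma θ γ v o.1 0
  have h2 := (Real.hasDerivAt_sigmoid (F.margin θ (γ + (0 : ℝ) • v) o.1)).comp (0 : ℝ) h1
  rw [zero_smul, add_zero] at h2
  simp only [residual_eq, weight_eq]
  exact h2.sub_const _

lemma lineDeriv_obsLoss_theta (u : Vec d₁) :
    lineDeriv ℝ (fun θ => F.obsLoss θ γ o) θ u
      = F.residual θ γ o * (F.scale γ o.1.1 * inner ℝ u (F.z o.1)) := by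
  have h1 := F.hasDerivAt_margin_theta θ γ u o.1 0
  have h2 := (hasDerivAt_logisticLoss (label o.2)
    (F.margin (θ + (0 : ℝ) • u) γ o.1)).comp (0 : ℝ) h1
  rw [zero_smul, add_zero] at h2
  simp only [lineDeriv, obsLoss_eq, residual_eq]
  exact h2.deriv

lemma lineDeriv_obsLoss_gamma (v : Vec d₂) :
    lineDeriv ℝ (fun γ => F.obsLoss θ γ o) γ v
      = F.residual θ γ o * (inner ℝ θ (F.z o.1) * inner ℝ v (F.psi o.1.1)) := by
  have h1 := F.hasDerivAt_margin_gamma θ γ v o.1 0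
  have h2 := (hasDerivAt_logisticLoss (label o.2)
    (F.margin θ (γ + (0 : ℝ) • v) o.1)).comp (0 : ℝ) h1
  rw [zero_smul, add_zero] at h2
  simp only [lineDeriv, obsLoss_eq, residual_eq]
  exact h2.deriv

lemma lineDeriv_theta_theta (j k : Fin d₁) :
    lineDeriv ℝ (fun θ' => lineDeriv ℝ (fun θ'' => F.obsLoss θ'' γ o) θ'
      (EuclideanSpace.single k 1)) θ (EuclideanSpace.single j 1)
      = F.weight θ γ o.1 * F.feat θ γ o.1 (.inl j) * F.feat θ γ o.1 (.inl k) := by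
  simp only [lineDeriv_obsLoss_theta, inner_single_z]
  have := (F.hasDerivAt_residual_theta θ γ o (EuclideanSpace.single j 1)).mul_const
    (F.scale γ o.1.1 * F.z o.1 k)
  rw [inner_single_z] at this
  simp only [feat, Sum.elim_inl]
  exact this.deriv

lemma lineDeriv_gamma_gamma (j k : Fin d₂) :
    lineDeriv ℝ (fun γ' => lineDeriv ℝ (fun γ'' => F.obsLoss θ γ'' o) γ'
      (EuclideanSpace.single k 1)) γ (EuclideanSpace.single j 1)
      = F.weight θ γ o.1 * F.feat θ γ o.1 (.inr j) * F.feat θ γ o.1 (.inr k) := by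
  simp only [lineDeriv_obsLoss_gamma, inner_single_psi]
  have := (F.hasDerivAt_residual_gamma θ γ o (EuclideanSpace.single j 1)).mul_const
    (inner ℝ θ (F.z o.1) * F.psi o.1.1 k)
  rw [inner_single_psi] at this
  simp only [feat, Sum.elim_inr]
  exact this.deriv

/-- The mixed derivative has a term proportional to the residual, because the margin is bilinear. -/
lemma lineDeriv_gamma_theta (j : Fin d₂) (k : Fin d₁) :
    lineDeriv ℝ (fun γ' => lineDeriv ℝ (fun θ' => F.obsLoss θ' γ' o) θ
      (EuclideanSpace.single k 1)) γ (EuclideanSpace.single j 1)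
      = F.weight θ γ o.1 * F.feat θ γ o.1 (.inr j) * F.feat θ γ o.1 (.inl k)
        + F.residual θ γ o * (F.z o.1 k * F.psi o.1.1 j) := by
  simp only [lineDeriv_obsLoss_theta, inner_single_z]
  have h1 := F.hasDerivAt_residual_gamma θ γ o (EuclideanSpace.single j 1)
  have h2 : HasDerivAt (fun t : ℝ => F.scale (γ + t • EuclideanSpace.single j (1 : ℝ)) o.1.1
      * F.z o.1 k) (F.psi o.1.1 j * F.z o.1 k) 0 := by
    refine HasDerivAt.mul_const ?_ _
    have e : (fun t : ℝ => F.scale (γ + t • EuclideanSpace.single j (1 : ℝ)) o.1.1)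
        = fun t => F.scale γ o.1.1 + t * F.psi o.1.1 j := by
      funext t
      simp only [scale, inner_add_left, real_inner_smul_left, inner_single_psi]
      ring
    rw [e]
    simpa using ((hasDerivAt_id (0 : ℝ)).mul_const (F.psi o.1.1 j)).const_add (F.scale γ o.1.1)
  rw [inner_single_psi] at h1
  have h3 := (h1.mul h2).deriv
  rw [zero_smul, add_zero] at h3
  rw [lineDeriv]
  refine h3.trans ?_
  simp only [feat, Sum.elim_inr, Sum.elim_inl]
  ring

lemma lineDeriv_theta_gamma (j : Fin d₁) (k : Fin d₂) :
    lineDeriv ℝ (fun θ' => lineDeriv ℝ (fun γ' => F.obsLoss θ' γ' o) γ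
      (EuclideanSpace.single k 1)) θ (EuclideanSpace.single j 1)
      = F.weight θ γ o.1 * F.feat θ γ o.1 (.inl j) * F.feat θ γ o.1 (.inr k)
        + F.residual θ γ o * (F.z o.1 j * F.psi o.1.1 k) := by
  simp only [lineDeriv_obsLoss_gamma, inner_single_psi]
  have h1 := F.hasDerivAt_residual_theta θ γ o (EuclideanSpace.single j 1)
  have h2 : HasDerivAt (fun t : ℝ => inner ℝ (θ + t • EuclideanSpace.single j (1 : ℝ)) (F.z o.1)
      * F.psi o.1.1 k) (F.z o.1 j * F.psi o.1.1 k) 0 := by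
    refine HasDerivAt.mul_const ?_ _
    have e : (fun t : ℝ => inner ℝ (θ + t • EuclideanSpace.single j (1 : ℝ)) (F.z o.1))
        = fun t => inner ℝ θ (F.z o.1) + t * F.z o.1 j := by
      funext t
      simp only [inner_add_left, real_inner_smul_left, inner_single_z]
    rw [e]
    simpa using ((hasDerivAt_id (0 : ℝ)).mul_const (F.z o.1 j)).const_add (inner ℝ θ (F.z o.1))
  rw [inner_single_z] at h1
  have h3 := (h1.mul h2).deriv
  rw [zero_smul, add_zero] at h3
  rw [lineDeriv]
  refine h3.trans ?_
  simp only [feat, Sum.elim_inr, Sum.elim_inl]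

end Derivatives

section Bounds

variable {F : Features X S A d₁ d₂} {θ : Vec d₁} {γ : Vec d₂} {K : ℝ}

lemma abs_coord_le {d : ℕ} (x : Vec d) (j : Fin d) : |x j| ≤ ‖x‖ :=
  PiLp.norm_apply_le x j

lemma BoundedBy.abs_feat_le (h : F.BoundedBy θ γ K) (w : Task X S A) (k : Fin d₁ ⊕ Fin d₂) :
    |F.feat θ γ w k| ≤ K ^ 2 := by
  have hK := h.pos
  rw [pow_two]
  cases k with
  | inl j =>
    simp only [feat, Sum.elim_inl, abs_mul]
    exact mul_le_mul (h.scale_le _) ((abs_coord_le _ _).trans (h.z_le w)) (abs_nonneg _) hK.le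
  | inr j =>
    simp only [feat, Sum.elim_inr, abs_mul]
    exact mul_le_mul (h.inner_le _) ((abs_coord_le _ _).trans (h.psi_le _)) (abs_nonneg _) hK.le

lemma BoundedBy.abs_z_mul_psi_le (h : F.BoundedBy θ γ K) (w : Task X S A) (j : Fin d₁)
    (k : Fin d₂) : |F.z w j * F.psi w.1 k| ≤ K ^ 2 := by
  have hK := h.pos
  rw [pow_two, abs_mul]
  exact mul_le_mul ((abs_coord_le _ _).trans (h.z_le w)) ((abs_coord_le _ _).trans (h.psi_le _))
    (abs_nonneg _) hK.le

lemma BoundedBy.abs_weight_mul_feat_le (h : F.BoundedBy θ γ K) (w : Task X S A)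
    (j k : Fin d₁ ⊕ Fin d₂) :
    |F.weight θ γ w * F.feat θ γ w j * F.feat θ γ w k| ≤ K ^ 4 := by
  have hK := h.pos
  rw [abs_mul, abs_mul, abs_of_pos (F.weight_pos θ γ w)]
  calc _ ≤ 1 * K ^ 2 * K ^ 2 := by
        gcongr
        · exact F.weight_le_one θ γ w
        · exact h.abs_feat_le w j
        · exact h.abs_feat_le w k
    _ = K ^ 4 := by ring

end Bounds

section Measurable

variable [MeasurableSpace X] [MeasurableSpace S] [MeasurableSpace A]
  {F : Features X S A d₁ d₂} (θ : Vec d₁) (γ : Vec d₂)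

namespace Measurability

lemma measurable_z (hF : F.Measurability) : Measurable F.z := by
  have h1 : Measurable fun w : Task X S A => (w.2.1, w.2.2.2) := by fun_prop
  have h2 : Measurable fun w : Task X S A => (w.2.1, w.2.2.1) := by fun_prop
  exact (hF.phi.comp h1).sub (hF.phi.comp h2)

lemma measurable_z_apply (hF : F.Measurability) (j : Fin d₁) :
    Measurable fun w : Task X S A => F.z w j :=
  (EuclideanSpace.proj (𝕜 := ℝ) j).continuous.measurable.comp hF.measurable_z

lemma measurable_psi_apply (hF : F.Measurability) (j : Fin d₂) :
    Measurable fun w : Task X S A => F.psi w.1 j :=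
  (EuclideanSpace.proj (𝕜 := ℝ) j).continuous.measurable.comp (hF.psi.comp measurable_fst)

lemma measurable_scale (hF : F.Measurability) : Measurable fun w : Task X S A => F.scale γ w.1 :=
  (hF.psi0.comp measurable_fst).add (measurable_const.inner (hF.psi.comp measurable_fst))

lemma measurable_inner_z (hF : F.Measurability) :
    Measurable fun w : Task X S A => (inner ℝ θ (F.z w) : ℝ) :=
  measurable_const.inner hF.measurable_z

lemma measurable_prefProb (hF : F.Measurability) : Measurable (F.prefProb θ γ) := by
  have : F.prefProb θ γ = fun w => Real.sigmoid (F.margin θ γ w) := funext (F.prefProb_eq θ γ)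
  rw [this]
  exact continuous_sigmoid.measurable.comp
    ((hF.measurable_scale γ).mul (hF.measurable_inner_z θ))

lemma measurable_weight (hF : F.Measurability) : Measurable (F.weight θ γ) :=
  (hF.measurable_prefProb θ γ).mul ((hF.measurable_prefProb θ γ).const_sub 1)

lemma measurable_residual (hF : F.Measurability) : Measurable (F.residual θ γ) :=
  ((hF.measurable_prefProb θ γ).comp measurable_fst).sub
    ((measurable_of_countable label).comp measurable_snd)

lemma measurable_feat (hF : F.Measurability) (k : Fin d₁ ⊕ Fin d₂) :
    Measurable fun w => F.feat θ γ w k := by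
  cases k with
  | inl j => exact (hF.measurable_scale γ).mul (hF.measurable_z_apply j)
  | inr j => exact (hF.measurable_inner_z θ).mul (hF.measurable_psi_apply j)

lemma measurable_weight_mul_feat (hF : F.Measurability) (j k : Fin d₁ ⊕ Fin d₂) :
    Measurable fun o : Obs X S A => F.weight θ γ o.1 * F.feat θ γ o.1 j * F.feat θ γ o.1 k :=
  (((hF.measurable_weight θ γ).mul (hF.measurable_feat θ γ j)).mul
    (hF.measurable_feat θ γ k)).comp measurable_fst

lemma measurable_residual_mul (hF : F.Measurability) {h : Task X S A → ℝ} (hh : Measurable h) :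
    Measurable fun o : Obs X S A => F.residual θ γ o * h o.1 :=
  (hF.measurable_residual θ γ).mul (hh.comp measurable_fst)

end Measurability

variable {K : ℝ} (D : Measure (Obs X S A))

/-- Under the preference model the residual is uncorrelated with every function of the task. -/
lemma integral_residual_mul (hF : F.Measurability) {D : Measure (Obs X S A)}
    [IsProbabilityMeasure D] {θ : Vec d₁} {γ : Vec d₂} (hD : FollowsPreferenceModel F D θ γ)
    {h : Task X S A → ℝ} (hh : Measurable h) {B : ℝ} (hB : ∀ w, |h w| ≤ B) :
    ∫ o, F.residual θ γ o * h o.1 ∂D = 0 := by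
  have hint : Integrable (fun o : Obs X S A => F.residual θ γ o * h o.1) D := by
    refine Integrable.of_bound (hF.measurable_residual_mul θ γ hh).aestronglyMeasurable (1 * B)
      (.of_forall fun o => ?_)
    rw [Real.norm_eq_abs, abs_mul]
    exact mul_le_mul (F.abs_residual_le θ γ o) (hB _) (abs_nonneg _) zero_le_one
  rw [← Measure.integral_condKernel hint]
  refine integral_eq_zero_of_ae ?_
  filter_upwards [hD] with w hw
  have h1 : (D.condKernel w).real {false} = 1 - F.prefProb θ γ w := by
    have := probReal_compl_eq_one_sub (μ := D.condKernel w) (measurableSet_singleton true)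
    rw [hw] at this
    rw [← this]
    congr 1
    ext b
    cases b <;> simp
  rw [integral_fintype .of_finite]
  simp [hw, h1, residual, label]
  ring

variable (F) in
/-- The Fisher information matrix `E[w ∇v ∇vᵀ]` of `(θ, γ)`, where `v` is the margin. -/
def fisher : Matrix (Fin d₁ ⊕ Fin d₂) (Fin d₁ ⊕ Fin d₂) ℝ :=
  Matrix.of fun j k => ∫ o, F.weight θ γ o.1 * F.feat θ γ o.1 j * F.feat θ γ o.1 k ∂D

lemma integrable_weight_mul_feat [IsProbabilityMeasure D] (hF : F.Measurability) {θ : Vec d₁}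
    {γ : Vec d₂}
    (hK : F.BoundedBy θ γ K) (j k : Fin d₁ ⊕ Fin d₂) :
    Integrable (fun o => F.weight θ γ o.1 * F.feat θ γ o.1 j * F.feat θ γ o.1 k) D :=
  Integrable.of_bound (hF.measurable_weight_mul_feat θ γ j k).aestronglyMeasurable (K ^ 4)
    (.of_forall fun o => hK.abs_weight_mul_feat_le o.1 j k)

lemma infoThetaTheta_eq : F.infoThetaTheta D θ γ = (F.fisher θ γ D).toBlocks₁₁ := by
  ext j k
  simp only [infoThetaTheta, lineDeriv_theta_theta]
  rfl

lemma infoGammaGamma_eq : F.infoGammaGamma D θ γ = (F.fisher θ γ D).toBlocks₂₂ := by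
  ext j k
  simp only [infoGammaGamma, lineDeriv_gamma_gamma]
  rfl

lemma infoGammaTheta_eq (hF : F.Measurability) {D : Measure (Obs X S A)} [IsProbabilityMeasure D]
    {θ : Vec d₁} {γ : Vec d₂} (hK : F.BoundedBy θ γ K) (hD : FollowsPreferenceModel F D θ γ) :
    F.infoGammaTheta D θ γ = (F.fisher θ γ D).toBlocks₂₁ := by
  ext j k
  have hm := (hF.measurable_z_apply k).mul (hF.measurable_psi_apply j)
  have h0 := integral_residual_mul hF hD hm fun w => hK.abs_z_mul_psi_le w k j
  have hi : Integrable (fun o => F.residual θ γ o * (F.z o.1 k * F.psi o.1.1 j)) D := by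
    refine Integrable.of_bound (hF.measurable_residual_mul θ γ hm).aestronglyMeasurable
      (1 * K ^ 2) (.of_forall fun o => ?_)
    rw [Real.norm_eq_abs, abs_mul]
    exact mul_le_mul (F.abs_residual_le θ γ o) (hK.abs_z_mul_psi_le _ _ _) (abs_nonneg _)
      zero_le_one
  simp only [infoGammaTheta, lineDeriv_gamma_theta, Matrix.of_apply]
  rw [integral_add (integrable_weight_mul_feat D hF hK _ _) hi]
  simp only [Pi.mul_apply] at h0
  rw [h0, add_zero]
  rfl

lemma infoThetaGamma_eq (hF : F.Measurability) {D : Measure (Obs X S A)} [IsProbabilityMeasure D]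
    {θ : Vec d₁} {γ : Vec d₂} (hK : F.BoundedBy θ γ K) (hD : FollowsPreferenceModel F D θ γ) :
    F.infoThetaGamma D θ γ = (F.fisher θ γ D).toBlocks₁₂ := by
  ext j k
  have hm := (hF.measurable_z_apply j).mul (hF.measurable_psi_apply k)
  have h0 := integral_residual_mul hF hD hm fun w => hK.abs_z_mul_psi_le w j k
  have hi : Integrable (fun o => F.residual θ γ o * (F.z o.1 j * F.psi o.1.1 k)) D := by
    refine Integrable.of_bound (hF.measurable_residual_mul θ γ hm).aestronglyMeasurable
      (1 * K ^ 2) (.of_forall fun o => ?_)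
    rw [Real.norm_eq_abs, abs_mul]
    exact mul_le_mul (F.abs_residual_le θ γ o) (hK.abs_z_mul_psi_le _ _ _) (abs_nonneg _)
      zero_le_one
  simp only [infoThetaGamma, lineDeriv_theta_gamma, Matrix.of_apply]
  rw [integral_add (integrable_weight_mul_feat D hF hK _ _) hi]
  simp only [Pi.mul_apply] at h0
  rw [h0, add_zero]
  rfl

lemma fisher_isHermitian : (F.fisher θ γ D).IsHermitian := by
  ext j k
  simp only [fisher, Matrix.conjTranspose_apply, Matrix.of_apply, star_trivial]
  congr 1
  funext o
  ring

lemma fisher_toBlocks₂₁ :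
    (F.fisher θ γ D).toBlocks₂₁ = (F.fisher θ γ D).toBlocks₁₂.conjTranspose := by
  have := fisher_isHermitian (F := F) θ γ D
  ext j k
  exact (this.apply _ _).symm

end Measurable

end Features
end Information

/-! ### Schur complements and the confidence set -/

section MatrixBounds

open Matrix

variable {ι κ : Type*} [Fintype ι] [Fintype κ] [DecidableEq κ]

/-- A positive definite quadratic form dominates a multiple of the squared norm. -/
lemma exists_pos_mul_le_of_posDef [DecidableEq ι] {M : Matrix ι ι ℝ} (hM : M.PosDef) :
    ∃ m > 0, ∀ x : ι → ℝ, m * (x ⬝ᵥ x) ≤ x ⬝ᵥ M *ᵥ x := by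
  rcases isEmpty_or_nonempty ι with hι | hι
  · exact ⟨1, one_pos, fun x => by simp [dotProduct]⟩
  obtain ⟨i, -, hi⟩ := Finset.exists_min_image Finset.univ hM.1.eigenvalues Finset.univ_nonempty
  refine ⟨hM.1.eigenvalues i, hM.eigenvalues_pos i, fun x => ?_⟩
  set c := hM.1.eigenvalues i
  have hH : (M - c • (1 : Matrix ι ι ℝ)).IsHermitian :=
    hM.1.sub (by simp [IsHermitian])
  have h : (M - c • (1 : Matrix ι ι ℝ)).PosSemidef := by
    refine hH.posSemidef_iff_eigenvalues_nonneg.2 fun j => ?_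
    have hj := hH.eigenvalues_mem_spectrum_real j
    rw [Pi.zero_apply]
    generalize hH.eigenvalues j = t at hj ⊢
    rw [← Algebra.algebraMap_eq_smul_one, ← spectrum.sub_singleton_eq,
      hM.1.spectrum_real_eq_range_eigenvalues] at hj
    obtain ⟨_, ⟨k, rfl⟩, _, rfl, hk⟩ := hj
    exact (sub_nonneg.2 (hi k (Finset.mem_univ k))).trans_eq hk
  have := h.dotProduct_mulVec_nonneg x
  simp only [star_trivial, sub_mulVec, smul_mulVec, one_mulVec, dotProduct_sub,
    dotProduct_smul, smul_eq_mul] at this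
  linarith

lemma posDef_of_forall_mem_spectrum [DecidableEq ι] {M : Matrix ι ι ℝ} (hM : M.IsHermitian)
    (h : ∀ t ∈ spectrum ℝ M, 0 < t) : M.PosDef :=
  hM.posDef_iff_eigenvalues_pos.2 fun i => h _ (hM.eigenvalues_mem_spectrum_real i)

variable {A : Matrix ι ι ℝ} {B : Matrix ι κ ℝ} {C : Matrix κ κ ℝ}

/-- Completing the square in a block quadratic form. -/
lemma dotProduct_fromBlocks_mulVec (hC : C.PosDef) (x : ι → ℝ) (y : κ → ℝ) :
    Sum.elim x y ⬝ᵥ fromBlocks A B Bᴴ C *ᵥ Sum.elim x y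
      = ((C⁻¹ * Bᴴ) *ᵥ x + y) ⬝ᵥ C *ᵥ ((C⁻¹ * Bᴴ) *ᵥ x + y)
        + x ⬝ᵥ (A - B * C⁻¹ * Bᴴ) *ᵥ x := by
  have := hC.isUnit.invertible
  have h := schur_complement_eq₂₂ A B x y hC.1
  simpa only [star_trivial, ← dotProduct_mulVec] using h

lemma posDef_fromBlocks_of_schur (hC : C.PosDef) (hS : (A - B * C⁻¹ * Bᴴ).PosDef)
    (hM : (fromBlocks A B Bᴴ C).IsHermitian) : (fromBlocks A B Bᴴ C).PosDef := by
  refine PosDef.of_dotProduct_mulVec_pos hM fun ξ hξ => ?_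
  obtain ⟨x, y, rfl⟩ : ∃ x y, ξ = Sum.elim x y := ⟨_, _, (Sum.elim_comp_inl_inr ξ).symm⟩
  rw [star_trivial, dotProduct_fromBlocks_mulVec hC]
  rcases eq_or_ne x 0 with rfl | hx
  · have hy : y ≠ 0 := by
      rintro rfl
      exact hξ (by ext i; cases i <;> rfl)
    simpa using hC.dotProduct_mulVec_pos hy
  · have h1 := hC.posSemidef.dotProduct_mulVec_nonneg ((C⁻¹ * Bᴴ) *ᵥ x + y)
    have h2 := hS.dotProduct_mulVec_pos hx
    simp only [star_trivial] at h1 h2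
    linarith

/-- A Schur complement inherits the lower bound of the block quadratic form. -/
lemma mul_le_schur {m : ℝ} (hm : 0 < m) (hC : C.IsHermitian)
    (h : ∀ (x : ι → ℝ) (y : κ → ℝ), m * (x ⬝ᵥ x + y ⬝ᵥ y)
      ≤ Sum.elim x y ⬝ᵥ fromBlocks A B Bᴴ C *ᵥ Sum.elim x y) (x : ι → ℝ) :
    m * (x ⬝ᵥ x) ≤ x ⬝ᵥ (A - B * C⁻¹ * Bᴴ) *ᵥ x := by
  have hC' : C.PosDef := by
    refine PosDef.of_dotProduct_mulVec_pos hC fun y hy => ?_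
    have := h 0 y
    simp only [fromBlocks_mulVec] at this
    simp at this
    have h2 : 0 < y ⬝ᵥ y := by
      rw [← star_trivial y]
      exact dotProduct_star_self_pos_iff.2 (by simpa using hy)
    rw [star_trivial]
    nlinarith
  -- This vector `y` minimises the form for the given `x`.
  have := h x (-((C⁻¹ * Bᴴ) *ᵥ x))
  rw [dotProduct_fromBlocks_mulVec hC', add_neg_cancel] at this
  simp only [mulVec_zero, dotProduct_zero, zero_add, neg_dotProduct, dotProduct_neg, neg_neg]
    at this
  have h2 : 0 ≤ ((C⁻¹ * Bᴴ) *ᵥ x) ⬝ᵥ ((C⁻¹ * Bᴴ) *ᵥ x) :=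
    Finset.sum_nonneg fun i _ => mul_self_nonneg _
  nlinarith

lemma isUnit_of_mul_le [DecidableEq ι] {m : ℝ} (hm : 0 < m)
    (h : ∀ x : ι → ℝ, m * (x ⬝ᵥ x) ≤ x ⬝ᵥ A *ᵥ x) :
    IsUnit A := by
  refine mulVec_injective_iff_isUnit.1 fun x y hxy => ?_
  have h1 := h (x - y)
  have h0 : A *ᵥ (x - y) = 0 := by rw [mulVec_sub]; exact sub_eq_zero.2 hxy
  rw [h0, dotProduct_zero] at h1
  have h2 : (x - y) ⬝ᵥ (x - y) = 0 :=
    le_antisymm (by nlinarith) (Finset.sum_nonneg fun i _ => mul_self_nonneg _)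
  exact sub_eq_zero.1 (dotProduct_self_eq_zero.1 h2)

lemma dotProduct_ofLp_self {d : ℕ} (x : Vec d) : x.ofLp ⬝ᵥ x.ofLp = ‖x‖ ^ 2 := by
  rw [EuclideanSpace.norm_sq_eq]
  simp only [dotProduct, Real.norm_eq_abs, pow_two, abs_mul_abs_self]

end MatrixBounds

section ConfidenceSet

open Matrix

variable {X S A : Type*} {d₁ d₂ : ℕ} (F : Features X S A d₁ d₂) {n : ℕ}
  (data : Fin n → Obs X S A) (θ : Vec d₁) (γ : Vec d₂)

namespace Features

/-- The joint empirical information matrix of `(θ, γ)`. -/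
def empFisher : Matrix (Fin d₁ ⊕ Fin d₂) (Fin d₁ ⊕ Fin d₂) ℝ :=
  Matrix.of fun j k => empMean data fun o => F.weight θ γ o.1 * F.feat θ γ o.1 j * F.feat θ γ o.1 k

lemma empFisher_eq_fromBlocks :
    F.empFisher data θ γ = fromBlocks (F.empThetaTheta data θ γ)
      (F.empGammaTheta data θ γ)ᵀ (F.empGammaTheta data θ γ)ᵀᴴ (F.empGammaGamma data θ γ) := by
  ext j k
  cases j <;> cases k <;>
  · simp only [empFisher, empMean, feat, of_apply, Sum.elim_inl, Sum.elim_inr, fromBlocks_apply₁₁,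
      fromBlocks_apply₁₂, fromBlocks_apply₂₁, fromBlocks_apply₂₂, empThetaTheta, empGammaGamma,
      empGammaTheta, conjTranspose_apply, transpose_apply, star_trivial]
    congr 1
    refine Finset.sum_congr rfl fun i _ => ?_
    ring

lemma gaussNewton_eq (u : Vec d₁) (v : Vec d₂) :
    F.gaussNewton data θ γ u v = Sum.elim u.ofLp v.ofLp ⬝ᵥ F.empFisher data θ γ
      *ᵥ Sum.elim u.ofLp v.ofLp := by
  set ξ := Sum.elim u.ofLp v.ofLp with hξ
  have e (o : Obs X S A) : F.weight θ γ o.1 * F.tangent θ γ u v o.1 ^ 2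
      = ∑ j, ∑ k, (ξ j * ξ k) * (F.weight θ γ o.1 * F.feat θ γ o.1 j * F.feat θ γ o.1 k) := by
    rw [tangent_eq_sum, ← hξ, pow_two, Finset.sum_mul_sum, Finset.mul_sum]
    refine Finset.sum_congr rfl fun j _ => ?_
    rw [Finset.mul_sum]
    refine Finset.sum_congr rfl fun k _ => ?_
    ring
  simp only [gaussNewton, e, empMean_sum, empMean_const_mul, dotProduct, mulVec, Finset.mul_sum,
    empFisher, of_apply]
  refine Finset.sum_congr rfl fun j _ => Finset.sum_congr rfl fun k _ => ?_
  ring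

end Features

/-- If the empirical information is bounded below, the confidence set is contained in a ball around
its centre. -/
lemma norm_sub_le_of_mem_confSet {m : ℝ} (hm : 0 < m)
    (h : ∀ u v, m * (‖u‖ ^ 2 + ‖v‖ ^ 2) ≤ F.gaussNewton data θ γ u v) {α : ℝ} {θ' : Vec d₁}
    (hθ' : θ' ∈ confSet F data θ γ α) :
    Real.sqrt m * ‖θ' - θ‖ ≤ normalQuantile (1 - α / 2) / Real.sqrt n := by
  have h1 : ∀ x : Fin d₁ → ℝ, m * (x ⬝ᵥ x) ≤ x ⬝ᵥ (F.empThetaTheta data θ γ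
      - (F.empGammaTheta data θ γ)ᵀ * (F.empGammaGamma data θ γ)⁻¹
        * F.empGammaTheta data θ γ) *ᵥ x := by
    have hC : (F.empGammaGamma data θ γ).IsHermitian := by
      ext j k
      simp only [Features.empGammaGamma, conjTranspose_apply, of_apply, star_trivial]
      congr 1
      refine Finset.sum_congr rfl fun i _ => ?_
      ring
    refine mul_le_schur (B := (F.empGammaTheta data θ γ)ᵀ) hm hC fun x y => ?_
    have := h (WithLp.toLp 2 x) (WithLp.toLp 2 y)
    rw [Features.gaussNewton_eq, Features.empFisher_eq_fromBlocks, ← dotProduct_ofLp_self,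
      ← dotProduct_ofLp_self] at this
    exact this
  have h2 : (F.sTheta2 data θ γ)⁻¹ = F.empThetaTheta data θ γ
      - (F.empGammaTheta data θ γ)ᵀ * (F.empGammaGamma data θ γ)⁻¹
        * F.empGammaTheta data θ γ :=
    nonsing_inv_nonsing_inv _ ((isUnit_iff_isUnit_det _).1 (isUnit_of_mul_le hm h1))
  refine le_trans ?_ hθ'
  rw [weightedNorm, h2]
  refine Real.le_sqrt_of_sq_le ?_
  rw [mul_pow, Real.sq_sqrt hm.le, ← dotProduct_ofLp_self]
  exact h1 _

end ConfidenceSet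

section Population

open Matrix

variable {X S A : Type*} {d₁ d₂ : ℕ} [MeasurableSpace X] [MeasurableSpace S] [MeasurableSpace A]
  {F : Features X S A d₁ d₂} {θ : Vec d₁} {γ : Vec d₂} {K : ℝ}
  {D : Measure (Obs X S A)} [IsProbabilityMeasure D]

namespace Features

/-- The `γ`-information is positive definite because the design matrix is and the weight is
positive. -/
lemma infoGammaGamma_posDef (hF : F.Measurability) (hK : F.BoundedBy θ γ K) {l : ℝ}
    (hl : IsPosSmallestEigenvalue (F.designGamma D θ) l) : (F.infoGammaGamma D θ γ).PosDef := by
  have hmt (v : Vec d₂) : Measurable fun o : Obs X S A => F.tangent θ γ 0 v o.1 := by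
    simp only [tangent_eq_sum]
    exact (Finset.measurable_fun_sum _ fun k _ =>
      (hF.measurable_feat θ γ k).mul_const _).comp measurable_fst
  have htan (v : Vec d₂) (w : Task X S A) :
      F.tangent θ γ 0 v w = ∑ j, (inner ℝ θ (F.z w) * F.psi w.1 j) * v j := by
    simp [tangent_eq_sum, feat]
  have hbd (v : Vec d₂) (w : Task X S A) : |F.tangent θ γ 0 v w| ≤ 2 * K ^ 2 * ‖v‖ :=
    hK.abs_tangent_le (by simp) le_rfl w
  have hbd' (v : Vec d₂) (w : Task X S A) : F.tangent θ γ 0 v w ^ 2 ≤ (2 * K ^ 2 * ‖v‖) ^ 2 := by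
    rw [← sq_abs]
    exact pow_le_pow_left₀ (abs_nonneg _) (hbd v w) 2
  have hIw (j k : Fin d₂) := integrable_weight_mul_feat D hF hK (.inr j) (.inr k)
  have hI (j k : Fin d₂) : Integrable (fun o : Obs X S A => (inner ℝ θ (F.z o.1)) ^ 2
      * F.psi o.1.1 j * F.psi o.1.1 k) D := by
    have e (o : Obs X S A) : (inner ℝ θ (F.z o.1)) ^ 2 * F.psi o.1.1 j * F.psi o.1.1 k
      = F.feat θ γ o.1 (.inr j) * F.feat θ γ o.1 (.inr k) := by
      simp only [feat, Sum.elim_inr]; ring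
    simp only [e]
    refine Integrable.of_bound (((hF.measurable_feat θ γ _).mul
      (hF.measurable_feat θ γ _)).comp measurable_fst).aestronglyMeasurable (K ^ 2 * K ^ 2)
      (.of_forall fun o => ?_)
    rw [Real.norm_eq_abs, abs_mul]
    exact mul_le_mul (hK.abs_feat_le _ _) (hK.abs_feat_le _ _) (abs_nonneg _) (sq_nonneg _)
  have hsum (c : Obs X S A → ℝ) (M : Matrix (Fin d₂) (Fin d₂) ℝ)
      (f : Fin d₂ → Fin d₂ → Obs X S A → ℝ) (hM : ∀ j k, M j k = ∫ o, f j k o ∂D)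
      (hf : ∀ j k o, f j k o = c o * ((inner ℝ θ (F.z o.1) * F.psi o.1.1 j)
        * (inner ℝ θ (F.z o.1) * F.psi o.1.1 k)))
      (hfI : ∀ j k, Integrable (f j k) D) (v : Vec d₂) :
      v.ofLp ⬝ᵥ M *ᵥ v.ofLp = ∫ o, c o * F.tangent θ γ 0 v o.1 ^ 2 ∂D := by
    have e (o : Obs X S A) : c o * F.tangent θ γ 0 v o.1 ^ 2
        = ∑ j, ∑ k, (v j * v k) * f j k o := by
      rw [htan, pow_two, Finset.sum_mul_sum, Finset.mul_sum]
      refine Finset.sum_congr rfl fun j _ => ?_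
      rw [Finset.mul_sum]
      refine Finset.sum_congr rfl fun k _ => ?_
      rw [hf]
      ring
    simp only [e]
    rw [integral_finsetSum _ fun j _ => integrable_finsetSum _ fun k _ => (hfI j k).const_mul _]
    simp only [dotProduct, mulVec, Finset.mul_sum]
    refine Finset.sum_congr rfl fun j _ => ?_
    rw [integral_finsetSum _ fun k _ => (hfI j k).const_mul _]
    refine Finset.sum_congr rfl fun k _ => ?_
    rw [integral_const_mul, ← hM]
    ring
  have hG (v : Vec d₂) : v.ofLp ⬝ᵥ F.infoGammaGamma D θ γ *ᵥ v.ofLp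
      = ∫ o, F.weight θ γ o.1 * F.tangent θ γ 0 v o.1 ^ 2 ∂D := by
    rw [infoGammaGamma_eq]
    exact hsum _ _ _ (fun j k => rfl) (fun j k o => by
      simp only [feat, Sum.elim_inr]; ring) hIw v
  have hB (v : Vec d₂) : v.ofLp ⬝ᵥ F.designGamma D θ *ᵥ v.ofLp
      = ∫ o, 1 * F.tangent θ γ 0 v o.1 ^ 2 ∂D :=
    hsum _ _ _ (fun j k => rfl) (fun j k o => by ring) hI v
  have hBpos : (F.designGamma D θ).PosDef := by
    refine posDef_of_forall_mem_spectrum ?_ fun t ht => hl.2.trans_le (hl.1.2 ht)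
    ext j k
    simp only [designGamma, conjTranspose_apply, of_apply, star_trivial]
    congr 1
    funext o
    ring
  have hGherm : (F.infoGammaGamma D θ γ).IsHermitian := by
    rw [infoGammaGamma_eq]
    ext j k
    exact (fisher_isHermitian (F := F) θ γ D).apply _ _
  refine PosDef.of_dotProduct_mulVec_pos hGherm fun x hx => ?_
  rw [star_trivial]
  have hpos := hBpos.dotProduct_mulVec_pos hx
  rw [star_trivial, hB (WithLp.toLp 2 x)] at hpos
  rw [hG (WithLp.toLp 2 x)]
  set v : Vec d₂ := WithLp.toLp 2 x
  have hnn (o : Obs X S A) : 0 ≤ F.weight θ γ o.1 * F.tangent θ γ 0 v o.1 ^ 2 :=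
    mul_nonneg (F.weight_pos θ γ o.1).le (sq_nonneg _)
  have hint : Integrable (fun o : Obs X S A => F.weight θ γ o.1 * F.tangent θ γ 0 v o.1 ^ 2) D := by
    refine Integrable.of_bound (((hF.measurable_weight θ γ).comp measurable_fst).mul
      ((hmt v).pow_const 2)).aestronglyMeasurable (1 * (2 * K ^ 2 * ‖v‖) ^ 2)
      (.of_forall fun o => ?_)
    rw [Real.norm_of_nonneg (hnn o)]
    exact mul_le_mul (F.weight_le_one θ γ o.1) (hbd' v o.1) (sq_nonneg _) zero_le_one
  refine lt_of_le_of_ne (integral_nonneg hnn) fun h0 => hpos.ne' ?_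
  have h1 := (integral_eq_zero_iff_of_nonneg hnn hint).1 h0.symm
  refine integral_eq_zero_of_ae (h1.mono fun o ho => ?_)
  rcases mul_eq_zero.1 ho with h2 | h2
  · exact absurd h2 (F.weight_pos θ γ o.1).ne'
  · simp [h2]

/-- The Fisher information of `(θ, γ)` is positive definite: its `γ`-block and the adjusted
information for `θ`, which is the Schur complement, are. -/
lemma fisher_posDef (hF : F.Measurability) (hK : F.BoundedBy θ γ K)
    (hD : FollowsPreferenceModel F D θ γ) {l : ℝ}
    (hl : IsPosSmallestEigenvalue (F.designGamma D θ) l) (hI : (F.infoTilde D θ γ).PosDef) :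
    (F.fisher θ γ D).PosDef := by
  have hG := infoGammaGamma_posDef hF hK hl (γ := γ)
  rw [infoGammaGamma_eq] at hG
  rw [infoTilde, infoThetaTheta_eq, infoGammaGamma_eq, infoGammaTheta_eq hF hK hD,
    infoThetaGamma_eq hF hK hD, fisher_toBlocks₂₁] at hI
  have e := (fromBlocks_toBlocks (F.fisher θ γ D)).symm
  rw [fisher_toBlocks₂₁] at e
  have hH := fisher_isHermitian (F := F) θ γ D
  rw [e] at hH ⊢
  exact posDef_fromBlocks_of_schur hG hI hH

end Features

end Population

/-! ### Near-optimal best-of-`N` selection -/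

section Policy

variable {X S A : Type*} {d₁ d₂ N : ℕ} {F : Features X S A d₁ d₂}

lemma abs_reward_sub_le {B : ℝ} (hB : ∀ s a, ‖F.phi s a‖ ≤ B) (θ θ' : Vec d₁) (s : S) (a : A) :
    |F.reward θ s a - F.reward θ' s a| ≤ ‖θ - θ'‖ * B := by
  rw [Features.reward, Features.reward, ← inner_sub_left]
  exact (abs_real_inner_le_norm _ _).trans (by gcongr; exact hB s a)

/-- On a confidence set of small radius the pessimistic value is close to the plug-in reward. -/
lemma abs_pessValue_sub_le {B r : ℝ} (hB : ∀ s a, ‖F.phi s a‖ ≤ B) {n : ℕ}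
    {data : Fin n → Obs X S A} {θ : Vec d₁} {γ : Vec d₂} {α : ℝ}
    (hθ : θ ∈ confSet F data θ γ α) (hr : ∀ θ' ∈ confSet F data θ γ α, ‖θ' - θ‖ ≤ r)
    (s : S) (a : A) : |pessValue F data θ γ α s a - F.reward θ s a| ≤ r * B := by
  have hB0 : 0 ≤ B := (norm_nonneg _).trans (hB s a)
  have h : ∀ θ' ∈ confSet F data θ γ α, F.reward θ s a - r * B ≤ F.reward θ' s a :=
    fun θ' hθ' => by
      have h1 := (abs_le.1 (abs_reward_sub_le hB θ' θ s a)).1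
      have h2 : ‖θ' - θ‖ * B ≤ r * B := by gcongr; exact hr θ' hθ'
      linarith
  have hbdd : BddBelow ((fun θ => F.reward θ s a) '' confSet F data θ γ α) :=
    ⟨F.reward θ s a - r * B, by rintro _ ⟨θ', hθ', rfl⟩; exact h θ' hθ'⟩
  have h1 : pessValue F data θ γ α s a ≤ F.reward θ s a := csInf_le hbdd ⟨θ, hθ, rfl⟩
  have h2 : F.reward θ s a - r * B ≤ pessValue F data θ γ α s a :=
    le_csInf ⟨_, θ, hθ, rfl⟩ (by rintro _ ⟨θ', hθ', rfl⟩; exact h θ' hθ')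
  have h3 : 0 ≤ r * B := mul_nonneg ((norm_nonneg _).trans (hr θ hθ)) hB0
  exact abs_le.2 ⟨by linarith, by linarith⟩

variable [MeasurableSpace S] [MeasurableSpace A]

/-- Maximising a value function that is uniformly close to the true reward loses little. -/
lemma reward_sub_le_of_isBestOfN {θs : Vec d₁} {cand : Fin N → S → A} {aStar π : S → A}
    {v : S → A → ℝ} {r : ℝ} (haStar : IsBestOfN cand (F.reward θs) aStar) (hπ : IsBestOfN cand v π)
    (hv : ∀ s a, |v s a - F.reward θs s a| ≤ r) (s : S) :
    F.reward θs s (aStar s) - F.reward θs s (π s) ≤ 2 * r := by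
  obtain ⟨j, hj⟩ := haStar.mem s
  have h1 := hπ.le s j
  simp only at hj
  rw [hj] at h1
  have h2 := (abs_le.1 (hv s (aStar s))).1
  have h3 := (abs_le.1 (hv s (π s))).2
  linarith

variable (F) in
/-- The prompts at which some suboptimal candidate has a suboptimality gap of at most `ρ`. -/
def nearTies (θs : Vec d₁) (cand : Fin N → S → A) (aStar : S → A) (ρ : ℝ) : Set S :=
  {s | ∃ j, 0 < F.reward θs s (aStar s) - F.reward θs s (cand j s)
    ∧ F.reward θs s (aStar s) - F.reward θs s (cand j s) ≤ ρ}

variable [MeasurableSpace X] {θs : Vec d₁} {cand : Fin N → S → A} {aStar : S → A}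
  (ν : Measure S) [IsProbabilityMeasure ν]

lemma measurable_reward (hF : F.Measurability) {π : S → A} (hπ : Measurable π) :
    Measurable fun s => F.reward θs s (π s) :=
  measurable_const.inner (hF.phi.comp (measurable_id.prodMk hπ))

lemma measurableSet_nearTies (hF : F.Measurability) (hcand : ∀ j, Measurable (cand j))
    (haStar : Measurable aStar) (ρ : ℝ) : MeasurableSet (nearTies F θs cand aStar ρ) := by
  have : nearTies F θs cand aStar ρ
      = ⋃ j, {s | 0 < F.reward θs s (aStar s) - F.reward θs s (cand j s)}
        ∩ {s | F.reward θs s (aStar s) - F.reward θs s (cand j s) ≤ ρ} := by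
    ext s
    simp [nearTies]
  rw [this]
  refine .iUnion fun j => ?_
  have hm := (measurable_reward (θs := θs) hF haStar).sub
    (measurable_reward (θs := θs) hF (hcand j))
  exact (measurableSet_lt measurable_const hm).inter (measurableSet_le hm measurable_const)

/-- Near ties become rare: the sets of near ties decrease to the empty set. -/
lemma exists_pos_measureReal_nearTies_le (hF : F.Measurability) (hcand : ∀ j, Measurable (cand j))
    (haStar : Measurable aStar) {ε : ℝ} (hε : 0 < ε) :
    ∃ ρ₀ > 0, ∀ ρ ≤ ρ₀, ν.real (nearTies F θs cand aStar ρ) ≤ ε := by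
  set E : ℕ → Set S := fun k => nearTies F θs cand aStar (1 / ((k : ℝ) + 1)) with hE
  have hmono {ρ ρ' : ℝ} (h : ρ ≤ ρ') :
      nearTies F θs cand aStar ρ ⊆ nearTies F θs cand aStar ρ' :=
    fun s ⟨j, h1, h2⟩ => ⟨j, h1, h2.trans h⟩
  have hanti : Antitone E := fun k l hkl => hmono (Nat.one_div_le_one_div hkl)
  have hempty : ⋂ k, E k = ∅ := by
    refine Set.eq_empty_of_forall_notMem fun s hs => ?_
    rw [Set.mem_iInter] at hs
    choose j hj1 hj2 using hs
    have : ∃ δ > 0, ∀ j, 0 < F.reward θs s (aStar s) - F.reward θs s (cand j s) →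
        δ ≤ F.reward θs s (aStar s) - F.reward θs s (cand j s) := by
      obtain ⟨i, hi0, hi⟩ := Finset.exists_min_image
        ((Finset.univ : Finset (Fin N)).filter fun j =>
          0 < F.reward θs s (aStar s) - F.reward θs s (cand j s))
        (fun j => F.reward θs s (aStar s) - F.reward θs s (cand j s))
        ⟨j 0, by simpa using hj1 0⟩
      exact ⟨_, (Finset.mem_filter.1 hi0).2, fun l hl => hi l (by simpa using hl)⟩
    obtain ⟨δ, hδ, hle⟩ := this
    obtain ⟨k, hk⟩ := exists_nat_one_div_lt hδ
    exact absurd (hle (j k) (hj1 k)) (not_le.2 ((hj2 k).trans_lt hk))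
  have ht := tendsto_measure_iInter_atTop (μ := ν)
    (fun k => (measurableSet_nearTies hF hcand haStar _).nullMeasurableSet) hanti
    ⟨0, measure_ne_top _ _⟩
  rw [hempty, measure_empty] at ht
  have ht' := (ENNReal.tendsto_toReal ENNReal.zero_ne_top).comp ht
  obtain ⟨k, hk⟩ := (ht'.eventually_le_const (by simpa using hε)).exists
  exact ⟨1 / ((k : ℝ) + 1), by positivity, fun ρ hρ => (measureReal_mono (hmono hρ)).trans hk⟩

/-- If all gaps of a best-of-`N` policy are at most `ρ`, only near ties contribute to its
suboptimality. -/
lemma subOpt_le (hF : F.Measurability) (hcand : ∀ j, Measurable (cand j))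
    (haStar : IsBestOfN cand (F.reward θs) aStar) {v : S → A → ℝ} {π : S → A}
    (hπ : IsBestOfN cand v π) {ρ : ℝ} (hρ : 0 ≤ ρ)
    (h : ∀ s, F.reward θs s (aStar s) - F.reward θs s (π s) ≤ ρ) :
    subOpt F ν θs aStar π ≤ ρ * ν.real (nearTies F θs cand aStar ρ) := by
  have hm := measurableSet_nearTies (F := F) (θs := θs) hF hcand haStar.measurable ρ
  have hnn (s : S) : 0 ≤ F.reward θs s (aStar s) - F.reward θs s (π s) := by
    obtain ⟨j, hj⟩ := hπ.mem s
    simp only at hj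
    rw [← hj]
    exact sub_nonneg.2 (haStar.le s j)
  calc subOpt F ν θs aStar π
      ≤ ∫ s, (nearTies F θs cand aStar ρ).indicator (fun _ => ρ) s ∂ν := by
        refine integral_mono_of_nonneg (.of_forall hnn) ((integrable_const ρ).indicator hm)
          (.of_forall fun s => ?_)
        rcases (hnn s).eq_or_lt with h0 | h0
        · simp only [← h0]
          exact Set.indicator_nonneg (fun _ _ => hρ) s
        · obtain ⟨j, hj⟩ := hπ.mem s
          simp only at hj
          have hs : s ∈ nearTies F θs cand aStar ρ :=
            ⟨j, by rw [hj]; exact h0, by rw [hj]; exact h s⟩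
          simp only [Set.indicator_of_mem hs]
          exact h s
    _ = ρ * ν.real (nearTies F θs cand aStar ρ) := by
        rw [integral_indicator_const _ hm, smul_eq_mul, mul_comm]

end Policy

/-! ### Positivity of the normal quantile and of the scale of the bound -/

lemma cdf_gaussianReal_zero : cdf (gaussianReal 0 1) 0 = 1 / 2 := by
  set P := gaussianReal 0 1 with hP
  have hna : NullSingletonClass P := nullSingletonClass_gaussianReal one_ne_zero
  have h1 : P.real (Set.Iic 0) = P.real (Set.Ici 0) := by
    have h := gaussianReal_map_neg (μ := 0) (v := 1)
    rw [neg_zero] at h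
    conv_lhs => rw [hP, ← h]
    rw [map_measureReal_apply measurable_neg measurableSet_Iic]
    congr 1
    ext x
    simp
  have h2 : P.real (Set.Ici 0) = P.real (Set.Ioi 0) := measureReal_congr Ioi_ae_eq_Ici.symm
  have h3 : P.real (Set.Ioi 0) = 1 - P.real (Set.Iic 0) := by
    rw [← Set.compl_Iic]
    exact probReal_compl_eq_one_sub measurableSet_Iic
  rw [cdf_eq_real]
  linarith

lemma normalQuantile_pos {p : ℝ} (hp : 1 / 2 < p) (hp1 : p < 1) : 0 < normalQuantile p := by
  set f := cdf (gaussianReal 0 1) with hf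
  have h0 : f 0 < p := cdf_gaussianReal_zero.trans_lt hp
  obtain ⟨x₀, hx₀, hlt⟩ : ∃ x₀ > 0, f x₀ < p := by
    have hr : Filter.Tendsto f (nhdsWithin 0 (Set.Ioi 0)) (nhds (f 0)) :=
      (f.right_continuous 0).mono_left (nhdsWithin_mono _ Set.Ioi_subset_Ici_self)
    obtain ⟨x, h1, h2⟩ := ((hr.eventually_lt_const h0).and self_mem_nhdsWithin).exists
    exact ⟨x, h2, h1⟩
  obtain ⟨x₁, hx₁⟩ := ((tendsto_cdf_atTop (gaussianReal 0 1)).eventually_const_le hp1).exists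
  refine hx₀.trans_le (le_csInf ⟨x₁, hx₁⟩ fun x hx => ?_)
  by_contra! hlt'
  exact absurd (le_trans hx (monotone_cdf _ hlt'.le)) (not_le.2 hlt)

lemma invSqrtMulVec_ne_zero {d : ℕ} {B : Matrix (Fin d) (Fin d) ℝ} (hB : B.PosDef) {v : Vec d}
    (hv : v ≠ 0) : invSqrtMulVec B v ≠ 0 := by
  have hpos : ∀ t ∈ spectrum ℝ B, 0 < t := fun t ht => by
    rw [hB.1.spectrum_real_eq_range_eigenvalues] at ht
    obtain ⟨i, rfl⟩ := ht
    exact hB.eigenvalues_pos i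
  have hsa : IsSelfAdjoint B := hB.1
  have hu : IsUnit (cfc (fun t : ℝ => t ^ (-(1 / 2) : ℝ)) B) := by
    rw [isUnit_cfc_iff _ _ (fun t ht => (Real.continuousAt_rpow_const _ _
      (.inl (hpos t ht).ne')).continuousWithinAt)]
    exact fun t ht => (Real.rpow_pos_of_pos (hpos t ht) _).ne'
  intro h
  have h1 : (cfc (fun t : ℝ => t ^ (-(1 / 2) : ℝ)) B).mulVec v.ofLp = 0 :=
    congrArg WithLp.ofLp h
  have h2 := Matrix.mulVec_injective_iff_isUnit.2 hu
    (h1.trans (Matrix.mulVec_zero _).symm)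
  exact hv (by ext i; exact congrFun h2 i)

/-! ### The typical event -/

section Typical

variable {X S A : Type*} {d₁ d₂ : ℕ} [MeasurableSpace X] [MeasurableSpace S] [MeasurableSpace A]

namespace Features

/-- A dataset is typical, at the levels `τ` and `ε`, if the coordinates of the score at `(θ, γ)`
are at most `τ`, and the empirical second-order quantities are within `ε` of their expectations. -/
structure Typical (F : Features X S A d₁ d₂) (D : Measure (Obs X S A)) (θ : Vec d₁) (γ : Vec d₂)
    {n : ℕ} (data : Fin n → Obs X S A) (τ ε : ℝ) : Prop where
  score : ∀ k, |empMean data fun o => F.residual θ γ o * F.feat θ γ o.1 k| ≤ τ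
  fisher : ∀ j k, |(empMean data fun o => F.weight θ γ o.1 * F.feat θ γ o.1 j * F.feat θ γ o.1 k)
    - F.fisher θ γ D j k| ≤ ε
  noise : ∀ j k, |empMean data fun o => F.residual θ γ o * (F.z o.1 j * F.psi o.1.1 k)| ≤ ε

/-- With high probability a dataset is typical, at a score level of order `1 / √n`. -/
lemma exists_typical_event {F : Features X S A d₁ d₂} {D : Measure (Obs X S A)}
    [IsProbabilityMeasure D] {θ : Vec d₁} {γ : Vec d₂} {K : ℝ} (hF : F.Measurability)
    (hK : F.BoundedBy θ γ K) (hD : FollowsPreferenceModel F D θ γ) {n : ℕ} (hn : 0 < n) {τ ε : ℝ}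
    (hτ : 0 < τ) (hε : 0 < ε) :
    ∃ G : Set (Fin n → Obs X S A), MeasurableSet G ∧ (∀ data ∈ G, F.Typical D θ γ data τ ε) ∧
      1 - ((d₁ + d₂ : ℕ) * (K ^ 4) ^ 2 / (n * τ ^ 2)
        + ((d₁ + d₂ : ℕ) ^ 2 + d₁ * d₂) * (K ^ 4) ^ 2 / (n * ε ^ 2))
        ≤ (Measure.pi fun _ : Fin n => D).real G := by
  have hK0 := hK.pos
  have hK24 : K ^ 2 ≤ K ^ 4 := pow_le_pow_right₀ hK.one_le (by norm_num)
  have hz (j : Fin d₁) (k : Fin d₂) : Measurable fun w : Task X S A => F.z w j * F.psi w.1 k :=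
    (hF.measurable_z_apply j).mul (hF.measurable_psi_apply k)
  have hres {h : Task X S A → ℝ} (hh : ∀ w, |h w| ≤ K ^ 2) (o : Obs X S A) :
      |F.residual θ γ o * h o.1| ≤ K ^ 4 := by
    rw [abs_mul]
    calc _ ≤ 1 * K ^ 2 :=
          mul_le_mul (F.abs_residual_le θ γ o) (hh _) (abs_nonneg _) zero_le_one
      _ ≤ K ^ 4 := by linarith
  let ι := Fin d₁ ⊕ Fin d₂
  let f : ι ⊕ ((ι × ι) ⊕ (Fin d₁ × Fin d₂)) → Obs X S A → ℝ :=
    Sum.elim (fun k o => F.residual θ γ o * F.feat θ γ o.1 k)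
      (Sum.elim (fun p o => F.weight θ γ o.1 * F.feat θ γ o.1 p.1 * F.feat θ γ o.1 p.2)
        (fun p o => F.residual θ γ o * (F.z o.1 p.1 * F.psi o.1.1 p.2)))
  let t : ι ⊕ ((ι × ι) ⊕ (Fin d₁ × Fin d₂)) → ℝ := Sum.elim (fun _ => τ) (fun _ => ε)
  have hf : ∀ k, Measurable (f k) := by
    rintro (k | p | p)
    · exact hF.measurable_residual_mul θ γ (hF.measurable_feat θ γ k)
    · exact hF.measurable_weight_mul_feat θ γ p.1 p.2
    · exact hF.measurable_residual_mul θ γ (hz p.1 p.2)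
  have hB : ∀ k o, |f k o| ≤ K ^ 4 := by
    rintro (k | p | p) o
    · exact hres (fun w => hK.abs_feat_le w k) o
    · exact hK.abs_weight_mul_feat_le o.1 p.1 p.2
    · exact hres (fun w => hK.abs_z_mul_psi_le w p.1 p.2) o
  have ht : ∀ k, 0 < t k := by
    rintro (k | p)
    · exact hτ
    · exact hε
  obtain ⟨hm, hP⟩ := measureReal_forall_empMean_sub_integral_lt_ge D hn hf hB ht
  refine ⟨_, hm, fun data hdata => ⟨fun k => ?_, fun j k => ?_, fun j k => ?_⟩,
    le_trans (le_of_eq ?_) hP⟩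
  · have h1 := (hdata (.inl k)).le
    have h0 := integral_residual_mul hF hD (hF.measurable_feat θ γ k)
      (fun w => hK.abs_feat_le w k)
    simp only [f, t, Sum.elim_inl, h0, sub_zero] at h1
    exact h1
  · exact (hdata (.inr (.inl (j, k)))).le
  · have h1 := (hdata (.inr (.inr (j, k)))).le
    have h0 := integral_residual_mul hF hD (hz j k) (fun w => hK.abs_z_mul_psi_le w j k)
    simp only [f, t, Sum.elim_inr, h0, sub_zero] at h1
    exact h1
  · simp [t, ι, Fintype.sum_sum_type]
    ring

/-- Conditions on the constants under which the empirical loss of a typical dataset is well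
conditioned on the ball of radius `R`: `m` bounds the Fisher information from below, `ε` and `R`
are small multiples of `m`. -/
structure WellConditioned (F : Features X S A d₁ d₂) (D : Measure (Obs X S A)) (θs : Vec d₁)
    (γs : Vec d₂) (K m R ε : ℝ) : Prop where
  bounded : F.BoundedBy θs γs K
  m_pos : 0 < m
  le_fisher : ∀ ξ, m * (ξ ⬝ᵥ ξ) ≤ ξ ⬝ᵥ (F.fisher θs γs D).mulVec ξ
  ε_nonneg : 0 ≤ ε
  ε_le : ε * (d₁ + d₂ : ℕ) ≤ m / 16
  radius_pos : 0 < R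
  radius_le : R ≤ 1
  mul_radius_le : 50 * K ^ 6 * R ≤ m / 16

lemma sum_sq_elim (u : Vec d₁) (v : Vec d₂) :
    ∑ k, Sum.elim u.ofLp v.ofLp k ^ 2 = ‖u‖ ^ 2 + ‖v‖ ^ 2 := by
  simp [Fintype.sum_sum_type, EuclideanSpace.norm_sq_eq]

namespace Typical

variable {F : Features X S A d₁ d₂} {D : Measure (Obs X S A)} {θs θ : Vec d₁} {γs γ : Vec d₂}
  {n : ℕ} {data : Fin n → Obs X S A} {τ ε m K R : ℝ}

lemma abs_score_le (h : F.Typical D θs γs data τ ε) (hm : 0 < m) (u : Vec d₁) (v : Vec d₂) :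
    |F.score data θs γs u v|
      ≤ m / 16 * (‖u‖ ^ 2 + ‖v‖ ^ 2) + 4 * (d₁ + d₂ : ℕ) * τ ^ 2 / m := by
  set ξ := Sum.elim u.ofLp v.ofLp with hξ
  have e : F.score data θs γs u v
      = ∑ k, ξ k * empMean data fun o => F.residual θs γs o * F.feat θs γs o.1 k := by
    simp only [Features.score, tangent_eq_sum, ← hξ, Finset.mul_sum, ← empMean_const_mul,
      ← empMean_sum]
    congr 1
    funext o
    exact Finset.sum_congr rfl fun k _ => by ring
  rw [e]
  refine (Finset.abs_sum_le_sum_abs _ _).trans ?_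
  have hk (k) : |ξ k * empMean data fun o => F.residual θs γs o * F.feat θs γs o.1 k|
      ≤ m / 16 * ξ k ^ 2 + 4 * τ ^ 2 / m := by
    rw [abs_mul]
    have h1 := mul_le_mul_of_nonneg_left (h.score k) (abs_nonneg (ξ k))
    have h2 : 0 ≤ (m * |ξ k| - 8 * τ) ^ 2 / (16 * m) := by positivity
    have e2 : (m * |ξ k| - 8 * τ) ^ 2 / (16 * m)
        = m / 16 * |ξ k| ^ 2 + 4 * τ ^ 2 / m - |ξ k| * τ := by
      field_simp; ring
    rw [e2, sq_abs] at h2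
    linarith
  refine (Finset.sum_le_sum fun k _ => hk k).trans_eq ?_
  rw [Finset.sum_add_distrib, ← Finset.mul_sum, hξ, sum_sq_elim]
  simp
  ring

lemma abs_gaussNewton_sub_le (h : F.Typical D θs γs data τ ε) (u : Vec d₁) (v : Vec d₂) :
    |F.gaussNewton data θs γs u v - Sum.elim u.ofLp v.ofLp ⬝ᵥ (F.fisher θs γs D).mulVec
      (Sum.elim u.ofLp v.ofLp)| ≤ ε * (d₁ + d₂ : ℕ) * (‖u‖ ^ 2 + ‖v‖ ^ 2) := by
  rw [gaussNewton_eq, ← dotProduct_sub, ← Matrix.sub_mulVec]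
  set ξ := Sum.elim u.ofLp v.ofLp with hξ
  simp only [dotProduct, Matrix.mulVec, Finset.mul_sum]
  refine (Finset.abs_sum_le_sum_abs _ _).trans
    ((Finset.sum_le_sum fun j _ => Finset.abs_sum_le_sum_abs _ _).trans ?_)
  have hjk (j k) : |ξ j * ((F.empFisher data θs γs - F.fisher θs γs D) j k * ξ k)|
      ≤ ε * (ξ j ^ 2 / 2 + ξ k ^ 2 / 2) := by
    have h1 : |(F.empFisher data θs γs - F.fisher θs γs D) j k| ≤ ε := h.fisher j k
    have h0 := (abs_nonneg _).trans h1
    rw [abs_mul, abs_mul]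
    calc _ = |(F.empFisher data θs γs - F.fisher θs γs D) j k| * (|ξ j| * |ξ k|) := by ring
      _ ≤ ε * (|ξ j| * |ξ k|) := by gcongr
      _ ≤ _ := by
        gcongr
        rw [← sq_abs (ξ j), ← sq_abs (ξ k)]
        linarith [two_mul_le_add_sq |ξ j| |ξ k|]
  refine (Finset.sum_le_sum fun j _ => Finset.sum_le_sum fun k _ => hjk j k).trans_eq ?_
  have hS : ∑ k, ξ k ^ 2 = ‖u‖ ^ 2 + ‖v‖ ^ 2 := by rw [hξ, sum_sq_elim]
  simp only [← Finset.mul_sum, Finset.sum_add_distrib, ← Finset.sum_div, Finset.sum_const, hS,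
    nsmul_eq_mul, Finset.card_univ, Fintype.card_sum, Fintype.card_fin]
  ring

lemma abs_noise_le (h : F.Typical D θs γs data τ ε) (hε : 0 ≤ ε) (u : Vec d₁) (v : Vec d₂) :
    |F.noise data θs γs u v| ≤ ε * (d₁ + d₂ : ℕ) * (‖u‖ ^ 2 + ‖v‖ ^ 2) := by
  have e : F.noise data θs γs u v = ∑ p : Fin d₁ × Fin d₂, (u p.1 * v p.2)
      * empMean data fun o => F.residual θs γs o * (F.z o.1 p.1 * F.psi o.1.1 p.2) := by
    simp only [Features.noise, bend_eq_sum, Finset.mul_sum, ← empMean_const_mul, ← empMean_sum]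
    congr 1
    funext o
    exact Finset.sum_congr rfl fun k _ => by ring
  rw [e]
  refine (Finset.abs_sum_le_sum_abs _ _).trans ?_
  have hp (p : Fin d₁ × Fin d₂) : |(u p.1 * v p.2) * empMean data fun o => F.residual θs γs o
      * (F.z o.1 p.1 * F.psi o.1.1 p.2)| ≤ ε * (u p.1 ^ 2 + v p.2 ^ 2) := by
    have h1 := h.noise p.1 p.2
    rw [abs_mul, abs_mul]
    calc _ ≤ |u p.1| * |v p.2| * ε := by gcongr
      _ = ε * (|u p.1| * |v p.2|) := by ring
      _ ≤ _ := by
        gcongr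
        rw [← sq_abs (u p.1), ← sq_abs (v p.2)]
        nlinarith [two_mul_le_add_sq |u p.1| |v p.2|, abs_nonneg (u p.1), abs_nonneg (v p.2)]
  refine (Finset.sum_le_sum fun p _ => hp p).trans ?_
  have e1 : ∑ i, u i ^ 2 = ‖u‖ ^ 2 := by simp [EuclideanSpace.norm_sq_eq]
  have e2 : ∑ i, v i ^ 2 = ‖v‖ ^ 2 := by simp [EuclideanSpace.norm_sq_eq]
  rw [← Finset.mul_sum, Fintype.sum_prod_type]
  simp only [Finset.sum_add_distrib, Finset.sum_const, e2]
  rw [← Finset.smul_sum, e1]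
  simp only [Finset.card_univ, Fintype.card_fin, nsmul_eq_mul]
  push_cast
  rw [mul_assoc]
  gcongr
  nlinarith [mul_nonneg (Nat.cast_nonneg (α := ℝ) d₁) (sq_nonneg ‖u‖),
    mul_nonneg (Nat.cast_nonneg (α := ℝ) d₂) (sq_nonneg ‖v‖)]

lemma le_gaussNewton (h : F.Typical D θs γs data τ ε) (hc : WellConditioned F D θs γs K m R ε)
    (u : Vec d₁) (v : Vec d₂) :
    15 / 16 * m * (‖u‖ ^ 2 + ‖v‖ ^ 2) ≤ F.gaussNewton data θs γs u v := by
  have h1 := (abs_le.1 (h.abs_gaussNewton_sub_le u v)).1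
  have h2 := hc.le_fisher (Sum.elim u.ofLp v.ofLp)
  have e : Sum.elim u.ofLp v.ofLp ⬝ᵥ Sum.elim u.ofLp v.ofLp = ‖u‖ ^ 2 + ‖v‖ ^ 2 := by
    rw [← sum_sq_elim]
    simp only [dotProduct, pow_two]
  rw [e] at h2
  have h3 := mul_le_mul_of_nonneg_right hc.ε_le (by positivity : 0 ≤ ‖u‖ ^ 2 + ‖v‖ ^ 2)
  linarith

/-- The Gauss-Newton form stays bounded below near the true parameters. -/
lemma le_gaussNewton_near (h : F.Typical D θs γs data τ ε) (hc : WellConditioned F D θs γs K m R ε)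
    (hq : ‖θ - θs‖ ^ 2 + ‖γ - γs‖ ^ 2 ≤ R ^ 2) (u : Vec d₁) (v : Vec d₂) :
    m / 4 * (‖u‖ ^ 2 + ‖v‖ ^ 2) ≤ F.gaussNewton data θ γ u v := by
  have hθ : ‖θ - θs‖ ≤ R :=
    le_of_sq_le_sq (by nlinarith [sq_nonneg ‖γ - γs‖]) hc.radius_pos.le
  have hγ : ‖γ - γs‖ ≤ R :=
    le_of_sq_le_sq (by nlinarith [sq_nonneg ‖θ - θs‖]) hc.radius_pos.le
  have hu : ‖u‖ ≤ √(‖u‖ ^ 2 + ‖v‖ ^ 2) := Real.le_sqrt_of_sq_le (by nlinarith [sq_nonneg ‖v‖])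
  have hv : ‖v‖ ≤ √(‖u‖ ^ 2 + ‖v‖ ^ 2) := Real.le_sqrt_of_sq_le (by nlinarith [sq_nonneg ‖u‖])
  have h1 := (abs_le.1 (hc.bounded.abs_gaussNewton_sub_le data hθ hγ hc.radius_le hu hv)).1
  rw [Real.sq_sqrt (by positivity)] at h1
  have h2 := h.le_gaussNewton hc u v
  have h3 := mul_le_mul_of_nonneg_right hc.mul_radius_le (by positivity : 0 ≤ ‖u‖ ^ 2 + ‖v‖ ^ 2)
  have h4 : 0 ≤ m * (‖u‖ ^ 2 + ‖v‖ ^ 2) := mul_nonneg hc.m_pos.le (by positivity)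
  have h5 : 0 ≤ K ^ 6 * R * (‖u‖ ^ 2 + ‖v‖ ^ 2) := by
    have := hc.bounded.pos
    have := hc.radius_pos
    positivity
  linarith

/-- The empirical loss of a typical dataset has the landscape needed for alternating gradient
descent, with a tolerance of the order of the squared score. -/
lemma descentLandscape (h : F.Typical D θs γs data τ ε) (hc : WellConditioned F D θs γs K m R ε) :
    DescentLandscape (F.loss data) (F.gradTheta data) (F.gradGamma data) θs γs R (m / 4)
      (5 * K ^ 4 + m) (4 * (d₁ + d₂ : ℕ) * τ ^ 2 / m) := by
  have hb := hc.bounded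
  have hm := hc.m_pos
  have hK := hb.pos
  have hK24 : K ^ 2 ≤ K ^ 4 := pow_le_pow_right₀ hb.one_le (by norm_num)
  have hK4 : 1 ≤ K ^ 4 := one_le_pow₀ hb.one_le
  set ς := 4 * (d₁ + d₂ : ℕ) * τ ^ 2 / m
  -- The parts of the expansions at a point of the ball: the linear term `s`, the Hessian form `H`,
  -- and the remainders `r₁` for the loss and `r₂` for its directional derivative.
  have key : ∀ (θ : Vec d₁) (γ : Vec d₂), ‖θ - θs‖ ^ 2 + ‖γ - γs‖ ^ 2 ≤ R ^ 2 →
      ∃ s H r₁ r₂, |s| ≤ m / 16 * (‖θ - θs‖ ^ 2 + ‖γ - γs‖ ^ 2) + ς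
        ∧ 13 / 16 * m * (‖θ - θs‖ ^ 2 + ‖γ - γs‖ ^ 2) ≤ H
        ∧ H ≤ (4 * K ^ 4 + m / 8) * (‖θ - θs‖ ^ 2 + ‖γ - γs‖ ^ 2)
        ∧ |r₁| ≤ m / 16 * (‖θ - θs‖ ^ 2 + ‖γ - γs‖ ^ 2)
        ∧ |r₂| ≤ m / 16 * (‖θ - θs‖ ^ 2 + ‖γ - γs‖ ^ 2)
        ∧ F.loss data θ γ - F.loss data θs γs = s + 1 / 2 * H + r₁
        ∧ inner ℝ (F.gradTheta data θ γ) (θ - θs) + inner ℝ (F.gradGamma data θ γ) (γ - γs)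
          = s + H + r₂ := by
    intro θ γ hq
    set q := ‖θ - θs‖ ^ 2 + ‖γ - γs‖ ^ 2 with hq_def
    have hq0 : 0 ≤ q := by positivity
    have hθ : ‖θ - θs‖ ≤ √q := Real.le_sqrt_of_sq_le (by nlinarith [sq_nonneg ‖γ - γs‖])
    have hγ : ‖γ - γs‖ ≤ √q := Real.le_sqrt_of_sq_le (by nlinarith [sq_nonneg ‖θ - θs‖])
    have hR : √q ≤ R := Real.sqrt_le_iff.2 ⟨hc.radius_pos.le, hq⟩
    have hrem : 50 * K ^ 6 * √q ^ 3 ≤ m / 16 * q := by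
      have e : 50 * K ^ 6 * √q ^ 3 = 50 * K ^ 6 * √q * q := by
        rw [pow_succ (√q), Real.sq_sqrt hq0]; ring
      rw [e]
      refine mul_le_mul_of_nonneg_right (le_trans ?_ hc.mul_radius_le) hq0
      gcongr
    have hgN : F.gaussNewton data θs γs (θ - θs) (γ - γs) ≤ 4 * K ^ 4 * q := by
      rw [gaussNewton]
      refine empMean_le data (by positivity) fun o => ?_
      have h1 := pow_le_pow_left₀ (abs_nonneg _) (hb.abs_tangent_le hθ hγ o.1) 2
      rw [sq_abs, mul_pow, Real.sq_sqrt hq0] at h1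
      have h2 := mul_le_mul (F.weight_le_one θs γs o.1) h1 (sq_nonneg _) zero_le_one
      linarith
    have hgN' := h.le_gaussNewton hc (θ - θs) (γ - γs)
    have hno := abs_le.1 ((h.abs_noise_le hc.ε_nonneg (θ - θs) (γ - γs)).trans
      (mul_le_mul_of_nonneg_right hc.ε_le hq0))
    rw [← hq_def] at hgN' hno
    refine ⟨F.score data θs γs (θ - θs) (γ - γs), F.gaussNewton data θs γs (θ - θs) (γ - γs)
      + 2 * F.noise data θs γs (θ - θs) (γ - γs), _, _, h.abs_score_le hm _ _, by linarith,
      by linarith, (hb.abs_loss_expansion_le data hθ hγ (hR.trans hc.radius_le)).trans hrem,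
      (hb.abs_gradient_expansion_le data hθ hγ (hR.trans hc.radius_le)).trans hrem, ?_, ?_⟩
    · ring
    · ring
  refine
    { radius_pos := hc.radius_pos
      radius_le := hc.radius_le
      m_pos := by positivity
      m_le := by linarith
      one_le := by linarith
      tol_nonneg := by positivity
      norm_g₁_le := fun u v _ hv => (hb.norm_gradTheta_le data hv).trans (by linarith)
      norm_g₂_le := fun u v hu _ => (hb.norm_gradGamma_le data hu).trans (by linarith)
      descent₁ := fun u u' v _ hv => (hb.loss_theta_descent data hv u').trans (by gcongr; linarith)
      descent₂ := fun u v v' hu _ => (hb.loss_gamma_descent data hu v').trans (by gcongr; linarith)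
      lipschitz := fun u u' v hu _ hv =>
        (hb.norm_gradGamma_sub_le data hu hv).trans (by gcongr; linarith)
      le_inner := fun u v huv => ?_
      le_sub := fun u v huv => ?_
      sub_le := fun u v huv => ?_ }
  all_goals
    obtain ⟨s, H, r₁, r₂, h1, h2, h3, h4, h5, h6, h7⟩ := key u v huv
    have hq0 : 0 ≤ ‖u - θs‖ ^ 2 + ‖v - γs‖ ^ 2 := by positivity
    set q := ‖u - θs‖ ^ 2 + ‖v - γs‖ ^ 2
    have hmq : 0 ≤ m * q := by positivity
    have hKq : 0 ≤ K ^ 4 * q := by positivity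
    obtain ⟨h1a, h1b⟩ := abs_le.1 h1
    obtain ⟨h4a, h4b⟩ := abs_le.1 h4
    obtain ⟨h5a, h5b⟩ := abs_le.1 h5
  · rw [h7]; linarith
  · rw [h6]; linarith
  · rw [h6]; linarith

end Typical

end Features

end Typical

/-! ### The suboptimality bound -/

section Final

variable {X S A : Type*} {d₁ d₂ : ℕ} {F : Features X S A d₁ d₂} {θs : Vec d₁} {γs : Vec d₂}

lemma exists_boundedBy {B C : ℝ} (hB : ∀ s a, ‖F.phi s a‖ ≤ B)
    (hC : ∀ x, Real.sqrt (F.psi0 x ^ 2 + ‖F.psi x‖ ^ 2) ≤ C) (hB0 : 0 ≤ B) (hC0 : 0 ≤ C) :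
    ∃ K, F.BoundedBy θs γs K := by
  have hz (w : Task X S A) : ‖F.z w‖ ≤ 2 * B := by
    have := norm_sub_le (F.phi w.2.1 w.2.2.2) (F.phi w.2.1 w.2.2.1)
    have h1 := hB w.2.1 w.2.2.2
    have h2 := hB w.2.1 w.2.2.1
    rw [Features.z]
    linarith
  have hpsi (x : X) : ‖F.psi x‖ ≤ C :=
    (Real.le_sqrt_of_sq_le (by nlinarith [sq_nonneg (F.psi0 x)])).trans (hC x)
  have hpsi0 (x : X) : |F.psi0 x| ≤ C :=
    (Real.le_sqrt_of_sq_le (by rw [sq_abs]; nlinarith [sq_nonneg ‖F.psi x‖])).trans (hC x)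
  have hscale (x : X) : |F.scale γs x| ≤ C + ‖γs‖ * C := by
    refine (abs_add_le _ _).trans (add_le_add (hpsi0 x) ?_)
    exact (abs_real_inner_le_norm _ _).trans (by gcongr; exact hpsi x)
  have hin (w : Task X S A) : |inner ℝ θs (F.z w)| ≤ ‖θs‖ * (2 * B) :=
    (abs_real_inner_le_norm _ _).trans (by gcongr; exact hz w)
  have h1 : 0 ≤ ‖γs‖ * C := by positivity
  have h2 : 0 ≤ ‖θs‖ * (2 * B) := by positivity
  refine ⟨1 + 2 * B + (C + ‖γs‖ * C) + ‖θs‖ * (2 * B), by linarith,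
    fun w => (hz w).trans (by linarith), fun x => (hpsi x).trans (by linarith),
    fun x => (hscale x).trans (by linarith), fun w => (hin w).trans (by linarith)⟩

lemma pow_le_one_div_of_log_lt {κ : ℝ} (hκ : 0 < κ) (hκ1 : κ ≤ 1) {n T : ℕ} (hn : 0 < n)
    (h : 1 / κ * Real.log n < T) : (1 - κ) ^ T ≤ 1 / (n : ℝ) := by
  have hn' : (0 : ℝ) < n := by positivity
  have h1 : Real.log n ≤ T * κ := by
    rw [one_div, inv_mul_lt_iff₀ hκ] at h
    linarith
  calc (1 - κ) ^ T ≤ Real.exp (-κ) ^ T :=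
        pow_le_pow_left₀ (by linarith) (Real.one_sub_le_exp_neg κ) T
    _ = Real.exp (-(T * κ)) := by rw [← Real.exp_nat_mul]; ring_nf
    _ ≤ Real.exp (-Real.log n) := by gcongr
    _ = 1 / n := by rw [Real.exp_neg, Real.exp_log hn', one_div]

lemma Features.agd_succ_fst {n : ℕ} (data : Fin n → Obs X S A) (η₁ η₂ : ℝ) (θ₀ : Vec d₁)
    (γ₀ : Vec d₂) (t : ℕ) :
    (F.agd data η₁ η₂ θ₀ γ₀ (t + 1)).1 = (F.agd data η₁ η₂ θ₀ γ₀ t).1 - η₁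
      • F.gradTheta data (F.agd data η₁ η₂ θ₀ γ₀ t).1 (F.agd data η₁ η₂ θ₀ γ₀ t).2 := by
  rw [← gradient_loss_theta]
  rfl

lemma Features.agd_succ_snd {n : ℕ} (data : Fin n → Obs X S A) (η₁ η₂ : ℝ) (θ₀ : Vec d₁)
    (γ₀ : Vec d₂) (t : ℕ) :
    (F.agd data η₁ η₂ θ₀ γ₀ (t + 1)).2 = (F.agd data η₁ η₂ θ₀ γ₀ t).2 - η₂
      • F.gradGamma data (F.agd data η₁ η₂ θ₀ γ₀ (t + 1)).1 (F.agd data η₁ η₂ θ₀ γ₀ t).2 := by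
  rw [← gradient_loss_gamma]
  rfl

variable [MeasurableSpace X] [MeasurableSpace S] [MeasurableSpace A]

/-- For a typical dataset of score level `√(C / n)`, the squared error of sufficiently many rounds
of alternating gradient descent is of order `1 / n`. -/
lemma agd_error_le {D : Measure (Obs X S A)} {K m R ε C η₁ η₂ b : ℝ} {n : ℕ}
    {data : Fin n → Obs X S A} (hn : 0 < n) (hC : 0 ≤ C)
    (h : F.Typical D θs γs data (√(C / n)) ε)
    (hc : Features.WellConditioned F D θs γs K m R ε) (hη₁ : 0 < η₁) (hη₂ : 0 < η₂)
    (hη₁' : η₁ < R / (4 * (5 * K ^ 4 + m))) (hη₂' : η₂ < R / (4 * (5 * K ^ 4 + m)))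
    (hb0 : 0 ≤ b) (hb : b < R / 4 * (m / 4 / (5 * K ^ 4 + m)))
    (hnς : (4 * (d₁ + d₂ : ℕ) * C / m) / n ≤ m / 4 * R ^ 2 / 16)
    {θ₀ : Vec d₁} {γ₀ : Vec d₂} (hθ₀ : ‖θ₀ - θs‖ ≤ b / √2) (hγ₀ : ‖γ₀ - γs‖ ≤ b / √2) {T : ℕ}
    (hT : 1 / (min η₁ η₂ / 4 * ((m / 4) ^ 2 / (5 * K ^ 4 + m))) * Real.log n < T) :
    ‖(F.agd data η₁ η₂ θ₀ γ₀ T).1 - θs‖ ^ 2 + ‖(F.agd data η₁ η₂ θ₀ γ₀ T).2 - γs‖ ^ 2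
      ≤ ((m + 4 * (d₁ + d₂ : ℕ) * C / m + (2 + 2 * (5 * K ^ 4 + m) / (m / 4))
        * (4 * (d₁ + d₂ : ℕ) * C / m)) / (m / 4)) / n
    ∧ ‖(F.agd data η₁ η₂ θ₀ γ₀ T).1 - θs‖ ^ 2 + ‖(F.agd data η₁ η₂ θ₀ γ₀ T).2 - γs‖ ^ 2
      ≤ R ^ 2 / 4 := by
  have hL := h.descentLandscape hc
  have hm := hc.m_pos
  have hR := hc.radius_pos
  have hR1 := hc.radius_le
  have hn' : (0 : ℝ) < n := by positivity
  have hn1 : (1 : ℝ) ≤ n := by exact_mod_cast hn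
  have hςeq : 4 * (d₁ + d₂ : ℕ) * √(C / n) ^ 2 / m = (4 * (d₁ + d₂ : ℕ) * C / m) / n := by
    rw [Real.sq_sqrt (by positivity)]
    ring
  rw [hςeq] at hL
  have hΛ1 := hL.one_le
  have hmΛ := hL.m_le
  set Λ := 5 * K ^ 4 + m
  have hΛ : 0 < Λ := by linarith
  set ς₀ := 4 * (d₁ + d₂ : ℕ) * C / m
  have hς₀ : 0 ≤ ς₀ := by positivity
  have hη : 0 < min η₁ η₂ := lt_min hη₁ hη₂
  have hs1 : Λ * η₁ ≤ R / 4 := by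
    rw [lt_div_iff₀ (by positivity)] at hη₁'
    linarith
  have hs2 : Λ * η₂ ≤ R / 4 := by
    rw [lt_div_iff₀ (by positivity)] at hη₂'
    linarith
  have hratio : m / 4 / Λ ≤ 1 := (div_le_one hΛ).2 hmΛ
  have hratio0 : 0 ≤ m / 4 / Λ := by positivity
  have hb2 : b ^ 2 ≤ (R / 4 * (m / 4 / Λ)) ^ 2 := pow_le_pow_left₀ hb0 hb.le 2
  have hbR : b ^ 2 ≤ R ^ 2 / 4 := by
    refine hb2.trans ((pow_le_pow_left₀ (by positivity)
      (mul_le_of_le_one_right (by positivity) hratio) 2).trans ?_)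
    nlinarith
  have hΛb : Λ * b ^ 2 ≤ m / 4 * R ^ 2 / 16 := by
    calc Λ * b ^ 2 ≤ Λ * (R / 4 * (m / 4 / Λ)) ^ 2 := by gcongr
      _ = m / 4 * R ^ 2 / 16 * (m / 4 / Λ) := by field_simp; ring
      _ ≤ m / 4 * R ^ 2 / 16 := mul_le_of_le_one_right (by positivity) hratio
  have hinit {E : Type _} [SeminormedAddCommGroup E] {x : E} (hx : ‖x‖ ≤ b / √2) :
      ‖x‖ ^ 2 ≤ b ^ 2 / 2 := by
    have := pow_le_pow_left₀ (norm_nonneg _) hx 2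
    rwa [div_pow, Real.sq_sqrt (by norm_num)] at this
  have h0 : ‖(F.agd data η₁ η₂ θ₀ γ₀ 0).1 - θs‖ ^ 2 + ‖(F.agd data η₁ η₂ θ₀ γ₀ 0).2 - γs‖ ^ 2
      ≤ b ^ 2 := by
    have h1 := hinit hθ₀
    have h2 := hinit hγ₀
    simp only [Features.agd]
    linarith
  obtain ⟨hq, hqR⟩ := hL.iterate_le (min_le_left η₁ η₂) (min_le_right η₁ η₂) hη hs1 hs2
    (F.agd_succ_fst data η₁ η₂ θ₀ γ₀) (F.agd_succ_snd data η₁ η₂ θ₀ γ₀) h0 hbR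
    (by linarith [show 0 ≤ m * R ^ 2 by positivity]) T
  refine ⟨hq.trans ?_, hqR⟩
  have hpow := pow_le_one_div_of_log_lt (by positivity)
    (hL.rate_le_one (min_le_left η₁ η₂) hη hs1) hn hT
  have hςn : ς₀ / n ≤ ς₀ := div_le_self hς₀ hn1
  have hbm : Λ * b ^ 2 ≤ m := by
    have : R ^ 2 ≤ 1 := pow_le_one₀ hR.le hR1
    nlinarith
  have hnum : (1 - min η₁ η₂ / 4 * ((m / 4) ^ 2 / Λ)) ^ T * (Λ * b ^ 2 + ς₀ / n)
      + (2 + 2 * Λ / (m / 4)) * (ς₀ / n)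
      ≤ (m + ς₀ + (2 + 2 * Λ / (m / 4)) * ς₀) / n := by
    calc _ ≤ 1 / n * (m + ς₀) + (2 + 2 * Λ / (m / 4)) * (ς₀ / n) := by gcongr
      _ = _ := by ring
  exact (div_le_div_of_nonneg_right hnum (by positivity : 0 ≤ m / 4)).trans_eq
    (div_right_comm _ _ _)

/-- A dataset is typical at the score level `√(C / n)` with probability at least `1 - δ`, if `C` is
large and if `n` is large. -/
lemma exists_typical_event_of_le {D : Measure (Obs X S A)} [IsProbabilityMeasure D] {K ε δ : ℝ}
    (hF : F.Measurability) (hK : F.BoundedBy θs γs K) (hD : FollowsPreferenceModel F D θs γs)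
    {n : ℕ} (hn : 0 < n) (hε : 0 < ε) (hδ : 0 < δ)
    (hnδ : (((d₁ + d₂ : ℕ) : ℝ) ^ 2 + d₁ * d₂) * (K ^ 4) ^ 2 / ε ^ 2 / n ≤ δ / 2) :
    ∃ G : Set (Fin n → Obs X S A), MeasurableSet G ∧
      (∀ data ∈ G, F.Typical D θs γs data
        (√(2 * ((d₁ + d₂ : ℕ) + 1) * (K ^ 4) ^ 2 / δ / n)) ε) ∧
      1 - δ ≤ (Measure.pi fun _ : Fin n => D).real G := by
  have hK0 := hK.pos
  have hn' : (0 : ℝ) < n := by positivity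
  obtain ⟨G, hGm, hG, hP⟩ := Features.exists_typical_event hF hK hD hn
    (Real.sqrt_pos.2 (by positivity : 0 < 2 * ((d₁ + d₂ : ℕ) + 1) * (K ^ 4) ^ 2 / δ / n)) hε
  refine ⟨G, hGm, hG, le_trans ?_ hP⟩
  rw [Real.sq_sqrt (by positivity), mul_div_cancel₀ _ hn'.ne', mul_comm (n : ℝ), ← div_div]
  have h1 : ((d₁ + d₂ : ℕ) : ℝ) * (K ^ 4) ^ 2 / (2 * ((d₁ + d₂ : ℕ) + 1) * (K ^ 4) ^ 2 / δ)
      ≤ δ / 2 := by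
    rw [div_le_iff₀ (by positivity)]
    have e : δ / 2 * (2 * (((d₁ + d₂ : ℕ) : ℝ) + 1) * (K ^ 4) ^ 2 / δ)
        = ((d₁ + d₂ : ℕ) : ℝ) * (K ^ 4) ^ 2 + (K ^ 4) ^ 2 := by field_simp
    rw [e]
    linarith [sq_nonneg (K ^ 4)]
  linarith

/-- If the estimate and the radius of the confidence set are within `1 / √n` of the truth, up to
constants, then so is the largest gap of the pessimistic policy. -/
lemma gap_le {D : Measure (Obs X S A)} {K m R τ ε α B C₁ : ℝ} {n N : ℕ}
    {data : Fin n → Obs X S A} {θ : Vec d₁} {γ : Vec d₂} {cand : Fin N → S → A} {aStar π : S → A}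
    (hB : ∀ s a, ‖F.phi s a‖ ≤ B) (hB0 : 0 ≤ B) (h : F.Typical D θs γs data τ ε)
    (hc : Features.WellConditioned F D θs γs K m R ε)
    (hq : ‖θ - θs‖ ^ 2 + ‖γ - γs‖ ^ 2 ≤ C₁ / n)
    (hqR : ‖θ - θs‖ ^ 2 + ‖γ - γs‖ ^ 2 ≤ R ^ 2) (hquant : 0 ≤ normalQuantile (1 - α / 2))
    (haStar : IsBestOfN cand (F.reward θs) aStar)
    (hπ : IsBestOfN cand (pessValue F data θ γ α) π) (s : S) :
    F.reward θs s (aStar s) - F.reward θs s (π s)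
      ≤ 2 * (normalQuantile (1 - α / 2) / √(m / 4) + √C₁) * B / √n := by
  have hm := hc.m_pos
  have hcen : θ ∈ confSet F data θ γ α := by
    simp only [confSet, Set.mem_ofPred_eq, sub_self, weightedNorm]
    simp only [WithLp.ofLp_zero, zero_dotProduct, Real.sqrt_zero]
    positivity
  have hrad : ∀ θ' ∈ confSet F data θ γ α,
      ‖θ' - θ‖ ≤ normalQuantile (1 - α / 2) / √n / √(m / 4) := fun θ' hθ' => by
    have := norm_sub_le_of_mem_confSet F data θ γ (by positivity : 0 < m / 4)
      (h.le_gaussNewton_near hc hqR) hθ'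
    rwa [le_div_iff₀' (Real.sqrt_pos.2 (by positivity))]
  have herr : ‖θ - θs‖ ≤ √C₁ / √n := by
    rw [← Real.sqrt_div' _ (Nat.cast_nonneg n)]
    exact Real.le_sqrt_of_sq_le (by nlinarith [sq_nonneg ‖γ - γs‖])
  have hv (s : S) (a : A) : |pessValue F data θ γ α s a - F.reward θs s a|
      ≤ normalQuantile (1 - α / 2) / √n / √(m / 4) * B + √C₁ / √n * B := by
    refine (abs_sub_le _ (F.reward θ s a) _).trans
      (add_le_add (abs_pessValue_sub_le hB hcen hrad s a) ?_)
    exact (abs_reward_sub_le hB θ θs s a).trans (by gcongr)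
  exact (reward_sub_le_of_isBestOfN haStar hπ hv s).trans_eq (by ring)

end Final

end HetPref

end

open HetPref in
theorem mainTheorem6
    {X S A : Type*} [MeasurableSpace X] [MeasurableSpace S] [MeasurableSpace A]
    {d₁ d₂ N : ℕ}
    (F : Features X S A d₁ d₂) (hF : F.Measurability)
    (θs : Vec d₁) (γs : Vec d₂)
    (φmax θmax ψmax γmax lamφ lamψ : ℝ)
    -- the law of one labelled comparison
    (D : MeasureTheory.Measure (Obs X S A)) [MeasureTheory.IsProbabilityMeasure D]
    (hD : FollowsPreferenceModel F D θs γs)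
    -- the standing assumptions
    (hreward : RewardAssumption F θs φmax θmax)
    (hscale : ScaleAssumption F γs ψmax γmax)
    (hlamφ : IsPosSmallestEigenvalue (F.designTheta D γs) lamφ)
    (hlamψ : IsPosSmallestEigenvalue (F.designGamma D θs) lamψ)
    (hM : F.coupling D θs γs
      < min lamφ lamψ / (6 * cZero d₁ d₂ φmax θmax ψmax γmax lamφ lamψ))
    (hI : (F.infoTilde D θs γs).PosDef)
    -- the law of the prompts, the candidate responses and the oracle policy
    (ν : MeasureTheory.Measure S) [MeasureTheory.IsProbabilityMeasure ν]
    (cand : Fin N → S → A) (hcand : ∀ j, Measurable (cand j))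
    (aStar : S → A) (haStar : IsBestOfN cand (F.reward θs) aStar)
    (hne : ∫ s, F.phi s (aStar s) ∂ν ≠ 0) :
    ∃ b₀ > (0 : ℝ), ∃ η₀ > (0 : ℝ),
      ∀ b < b₀, ∀ η₁ η₂ : ℝ, 0 < η₁ → η₁ < η₀ → 0 < η₂ → η₂ < η₀ →
      ∃ c > (0 : ℝ), ∀ δ α : ℝ, 0 < δ → δ < 1 → 0 < α → α < 1 →
      ∃ n₀ T₀ : ℕ, ∀ n T : ℕ, n₀ < n → T₀ < T → c * Real.log n < T →
      ∀ (θ₀ : Vec d₁) (γ₀ : Vec d₂),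
        ‖θ₀ - θs‖ ≤ b / Real.sqrt 2 → ‖γ₀ - γs‖ ≤ b / Real.sqrt 2 →
        WithProbAtLeast (MeasureTheory.Measure.pi fun _ : Fin n => D) (1 - δ - 1 / (n : ℝ))
          {data | ∀ π : S → A,
            IsBestOfN cand
              (pessValue F data (F.agd data η₁ η₂ θ₀ γ₀ T).1 (F.agd data η₁ η₂ θ₀ γ₀ T).2 α) π →
            subOpt F ν θs aStar π
              ≤ 3 * normalQuantile (1 - α / 2)
                * ‖invSqrtMulVec (F.infoTilde D θs γs) (∫ s, F.phi s (aStar s) ∂ν)‖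
                / Real.sqrt n} := by
  have hφ0 : 0 ≤ φmax := hreward.phi_pos.le
  obtain ⟨K, hK⟩ := exists_boundedBy (F := F) (θs := θs) (γs := γs) hreward.phi_le hscale.psi_le
    hφ0 hscale.psi_pos.le
  have hK0 := hK.pos
  obtain ⟨m, hm, hmle⟩ := exists_pos_mul_le_of_posDef (Features.fisher_posDef hF hK hD hlamψ hI)
  -- The cubic remainders on the ball of radius `R`, and the deviations `ε` of the empirical
  -- second-order quantities, each cost at most a sixteenth of the curvature `m`.
  set R := min 1 (m / (800 * K ^ 6)) with hR
  have hR0 : 0 < R := lt_min one_pos (by positivity)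
  set ε := m / (16 * ((d₁ + d₂ : ℕ) + 1)) with hε
  have hε0 : 0 < ε := by positivity
  have hc : Features.WellConditioned F D θs γs K m R ε :=
    { bounded := hK
      m_pos := hm
      le_fisher := hmle
      ε_nonneg := hε0.le
      ε_le := by
        rw [hε, div_mul_eq_mul_div, div_le_div_iff₀ (by positivity) (by norm_num)]
        linarith
      radius_pos := hR0
      radius_le := min_le_left _ _
      mul_radius_le := by
        have : R ≤ m / (800 * K ^ 6) := min_le_right _ _
        rw [le_div_iff₀ (by positivity)] at this
        linarith }
  refine ⟨R / 4 * (m / 4 / (5 * K ^ 4 + m)), by positivity, R / (4 * (5 * K ^ 4 + m)),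
    by positivity, fun b hb η₁ η₂ hη₁ hη₁' hη₂ hη₂' =>
    ⟨1 / (min η₁ η₂ / 4 * ((m / 4) ^ 2 / (5 * K ^ 4 + m))), ?_, fun δ α hδ hδ1 hα hα1 => ?_⟩⟩
  · have : 0 < min η₁ η₂ := lt_min hη₁ hη₂
    positivity
  have hquant : 0 < normalQuantile (1 - α / 2) :=
    normalQuantile_pos (by linarith) (by linarith)
  set q := normalQuantile (1 - α / 2)
  have hV : 0 < ‖invSqrtMulVec (F.infoTilde D θs γs) (∫ s, F.phi s (aStar s) ∂ν)‖ :=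
    norm_pos_iff.2 (invSqrtMulVec_ne_zero hI hne)
  set V := ‖invSqrtMulVec (F.infoTilde D θs γs) (∫ s, F.phi s (aStar s) ∂ν)‖
  -- The score level `√(C / n)` is exceeded with probability at most `δ / 2`.
  set C := 2 * ((d₁ + d₂ : ℕ) + 1) * (K ^ 4) ^ 2 / δ with hC
  have hC0 : 0 < C := by positivity
  set ς₀ := 4 * (d₁ + d₂ : ℕ) * C / m with hς₀
  -- `C₁ / n` bounds the squared error of the estimate and `C₃ / √n` the gaps of the policy.
  set C₁ := (m + ς₀ + (2 + 2 * (5 * K ^ 4 + m) / (m / 4)) * ς₀) / (m / 4) with hC₁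
  set C₃ := 2 * (q / √(m / 4) + √C₁) * φmax with hC₃
  have hC₃0 : 0 < C₃ := by
    have := hreward.phi_pos
    positivity
  obtain ⟨ρ₀, hρ₀, hρ⟩ := exists_pos_measureReal_nearTies_le (F := F) (θs := θs) ν hF hcand
    haStar.measurable (ε := 3 * q * V / C₃) (by positivity)
  set s₂ := (((d₁ + d₂ : ℕ) : ℝ) ^ 2 + d₁ * d₂) * (K ^ 4) ^ 2 / ε ^ 2
  have hev : ∀ᶠ n : ℕ in Filter.atTop, s₂ / n ≤ δ / 2 ∧ ς₀ / n ≤ m / 4 * R ^ 2 / 16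
      ∧ C₃ / √n ≤ ρ₀ ∧ 0 < n := by
    have hs : Filter.Tendsto (fun n : ℕ => C₃ / √(n : ℝ)) Filter.atTop (nhds 0) :=
      (Real.tendsto_sqrt_atTop.comp tendsto_natCast_atTop_atTop).const_div_atTop C₃
    exact ((tendsto_const_div_atTop_nhds_zero_nat s₂).eventually_le_const (by positivity)).and
      (((tendsto_const_div_atTop_nhds_zero_nat ς₀).eventually_le_const (by positivity)).and
        ((hs.eventually_le_const hρ₀).and (Filter.eventually_gt_atTop 0)))
  obtain ⟨n₀, hn₀⟩ := Filter.eventually_atTop.1 hev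
  refine ⟨n₀, 0, fun n T hn _ hT θ₀ γ₀ hθ₀ hγ₀ => ?_⟩
  obtain ⟨hs₂, hς, hnρ, hn0⟩ := hn₀ n hn.le
  have hn' : (0 : ℝ) < n := by positivity
  have hb0 : 0 ≤ b := by
    have := (norm_nonneg _).trans hθ₀
    rwa [le_div_iff₀ (by positivity), zero_mul] at this
  obtain ⟨G, hGm, hG, hP⟩ := exists_typical_event_of_le hF hK hD hn0 hε0 hδ hs₂
  refine ⟨G, hGm, fun data hdata π hπ => ?_,
    (sub_le_self _ (by positivity)).trans hP⟩
  have hty := hG data hdata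
  obtain ⟨hq, hqR⟩ := agd_error_le hn0 hC0.le hty hc hη₁ hη₂ hη₁' hη₂' hb0 hb hς hθ₀ hγ₀ hT
  have hgap := gap_le hreward.phi_le hφ0 hty hc hq (by nlinarith) hquant.le haStar hπ
  have hle := subOpt_le ν hF hcand haStar hπ (div_nonneg hC₃0.le (Real.sqrt_nonneg _)) hgap
  refine hle.trans ?_
  calc C₃ / √n * ν.real (nearTies F θs cand aStar (C₃ / √n))
      ≤ C₃ / √n * (3 * q * V / C₃) := by gcongr; exact hρ _ hnρ
    _ = 3 * q * V / √n := by field_simp
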